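/- **Setting.** Let $D\ge 2$, let $V=[v_1,\dots,v_D]\in\mathbb R^{D\times D}$ be invertible with unit columns, let $T_1,\dots,T_D>0$, $\mathbf T=\mathrm{diag}(T_1,\dots,T_D)$, and $\Omega_1,\dots,\Omega_D>0$. The space $\mathsf{PW}_{\Omega}(\mathbb R^D)$ consists of the (continuous) real functions $f\in L^2(\mathbb R^D)$ whose Fourier transform vanishes (almost everywhere) outside $\{V^{-\top}\omega : |\omega_d|<\Omega_d\ \forall d\}$. For $\bar x=(x_2,\dots,x_D)$ put $f_{\bar x}(x_1)=f(x_1v_1+\dots+x_Dv_D)$. **Operator.** Let $B>0$, $\lambda\in\mathbb R$, $0\le h<2\lambda/3$. For $\bar b=(b_2,\dots,b_D)\in\mathbb Z^{D-1}$ let $\mathcal R_{\bar b}=\prod_{d=2}^D[b_dB,(b_d+1)B)$ and $M_{\bar b}=\lfloor(\inf_{\bar x\in\mathcal R_{\bar b}}f_{\bar x}(0)+\lambda)/h\rfloor-1$. Start with $\tau_{\bar b,0}=0$ and $\varepsilon_{\bar b,0}\equiv hM_{\bar b}$. As long as the set $\{x_1>\tau_{\bar b,r}:\sup_{\bar x\in\mathcal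 R_{\bar b}}|f_{\bar x}(x_1)-\varepsilon_{\bar b,r}(x_1)|=\lambda\}$ is non-empty, let $\tau_{\bar b,r+1}$ be its infimum, $s_{\bar b,r+1}=\mathrm{sign}[f_{B\bar b}(\tau_{\bar b,r+1})-\varepsilon_{\bar b,r}(\tau_{\bar b,r+1})]$ and $\varepsilon_{\bar b,r+1}=\varepsilon_{\bar b,r}+h\,s_{\bar b,r+1}\mathbf 1_{[\tau_{\bar b,r+1},\infty)}$. With $\varepsilon_{\bar b}$ the last function obtained, the modulo-hysteresis output is $z(V\mathbf x)=f(V\mathbf x)-\varepsilon_{\bar b}(x_1)$ for $x_1\ge0$ and $\bar x\in\mathcal R_{\bar b}$; for $x_1<0$ the same operator is applied to the function reflected in $x_1$. **Samples.** Let $N\ge1$ be an integer. Assume that $N_d^B=B/T_d$ is an integer for $d\in\{2,\dots,D\}$. Let $K^d_{\max}\ge1$ be integers for $d\in\{1,\dots,D\}$, with $K^d_{\max}=B^d_{\max}N_d^B$, $B^d_{\max}\in\mathbb Z$, for $d\ge2$. Let $\mathcal K$ be the block of all $\mathbf k\in\mathbb Z^D$ with $1\le k_1\le K^1_{\max}$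 and $0\le k_d\le K^d_{\max}-1$ for $d\ge2$; it fills $\prod_{d\ge2}B^d_{\max}$ bands. **Theorem.** There is a measurable reconstruction map $R:\mathbb R^{\mathcal K}\to\mathbb R^{\mathcal K}$, depending only on $D,V,\mathbf T,\Omega,\lambda,h,B,N$ and the block, such that the following holds for every $f\in\mathsf{PW}_\Omega(\mathbb R^D)$ with $$\|f\|_\infty B\sqrt D\,\|\Omega\|_2<\min\{h/2,\,2\lambda-3h\},\qquad (T_d\Omega_de)^N\|f\|_\infty<h/2\quad(1\le d\le D),$$ $$(N+1)T_1\,\Omega_1\|f\|_\infty<h,\qquad (N+1)T_d<B\quad(2\le d\le D),$$ and for every $\sigma>0$. 1. Let $\eta[\mathbf k]$, $\mathbf k\in\mathcal K$, be i.i.d. $\mathcal N(0,\sigma^2)$ and let $y[\mathbf k]=z(V\mathbf T\mathbf k)+\eta[\mathbf k]$. Then the input samples are recovered, that is, $R(y)[\mathbf k]=f(V\mathbf T\mathbf k)+\eta[\mathbf k]-hM_{\bar 0}$ for all $\mathbf k\in\mathcal K$, with probability strictly greater than $$\bigl(1-e^{-C^2}\bigr)^{K^1_{\max}\prod_{d=2}^DB^d_{\max}}\cdot\bigl(1-e^{-\kappa_{\min}^2}\bigr)^{\prod_{d=2}^DB^d_{\max}},$$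 where, with $T_{\max}=\max_{2\le d\le D}T_d$, $$C=\frac{h/2-(T_1\Omega_1e)^N\|f\|_\infty}{\sigma\sqrt{2^{N+1}}}\prod_{d=2}^D\sqrt{\frac B{T_d}},\qquad \kappa_{\min}=\frac{h/2-\bigl[(\max_{2\le d\le D}T_d\Omega_d)\,e\bigr]^N\|f\|_\infty}{\sigma\sqrt{2^{N+1}}}\sqrt{\frac{B^{D-2}}{T_{\max}^{D-2}}}.$$ 2. As functions of the sampling periods, with all other quantities fixed: if $T_2,\dots,T_D$ are replaced by positive numbers that are not larger, then $\kappa_{\min}$ does not decrease, and $C$ strictly increases unless all the $T_d$ are unchanged. If $D\ge3$, the bound in 1 tends to $1$ as $(T_2,\dots,T_D)\to0$ with $K^1_{\max}$ and the $B^d_{\max}$ fixed. -/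

import Mathlib

open MeasureTheory ProbabilityTheory Filter Topology
open scoped FourierTransform Matrix ENNReal NNReal

noncomputable section

namespace ModHyst

/-! The dimension is `D = n + 1`. The coordinate `0 : Fin (n + 1)` is the first coordinate `x₁`, the
coordinates `d.succ` with `d : Fin n` are `x₂, …, x_D`; `Fin.cons x₁ xb` is the vector `[x₁, xb]`. -/

variable {n : ℕ}

/-- The Cartesian point `V x` with lattice coordinates `x`. -/
def point (V : Matrix (Fin (n + 1)) (Fin (n + 1)) ℝ) (x : Fin (n + 1) → ℝ) :
    EuclideanSpace ℝ (Fin (n + 1)) :=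
  WithLp.toLp 2 (V *ᵥ x)

/-- The lattice point `V T k`, with `T` the diagonal matrix of the sampling periods. -/
def latticePoint (V : Matrix (Fin (n + 1)) (Fin (n + 1)) ℝ) (T : Fin (n + 1) → ℝ)
    (k : Fin (n + 1) → ℤ) : EuclideanSpace ℝ (Fin (n + 1)) :=
  point V (fun d => T d * (k d : ℝ))

/-- The frequency domain `{V⁻ᵀ ω : |ω_d| < Ω_d for all d}`. -/
def freqBox (V : Matrix (Fin (n + 1)) (Fin (n + 1)) ℝ) (Om : Fin (n + 1) → ℝ) :
    Set (EuclideanSpace ℝ (Fin (n + 1))) :=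
  {w | ∃ om : Fin (n + 1) → ℝ, (∀ d, |om d| < Om d) ∧ w = point (V⁻¹)ᵀ om}

/-- The Paley-Wiener space of bandwidth `Om` relative to `V`: continuous square integrable functions
whose `L²` Fourier transform vanishes almost everywhere outside `freqBox V Om`. Mathlib's transform
is taken with respect to `exp (-2πi⟨w, x⟩)`, so that the angular frequency of `w` is `2π w`. -/
def PaleyWiener (V : Matrix (Fin (n + 1)) (Fin (n + 1)) ℝ) (Om : Fin (n + 1) → ℝ)
    (f : EuclideanSpace ℝ (Fin (n + 1)) → ℝ) : Prop :=
  Continuous f ∧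
  ∃ hf : MemLp (fun x => (f x : ℂ)) 2 (volume : Measure (EuclideanSpace ℝ (Fin (n + 1)))),
    ∀ᵐ w ∂(volume : Measure (EuclideanSpace ℝ (Fin (n + 1)))),
      (2 * Real.pi) • w ∉ freqBox V Om →
        (𝓕 (hf.toLp (fun x => (f x : ℂ))) :
          Lp ℂ 2 (volume : Measure (EuclideanSpace ℝ (Fin (n + 1))))) w = 0

/-- The norm of `f` in `L^∞(ℝ^D)`. -/
def normInf (f : EuclideanSpace ℝ (Fin (n + 1)) → ℝ) : ℝ :=
  (eLpNorm f ∞ volume).toReal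

/-! ### The multi-dimensional modulo-hysteresis operator

Below `g` is the input in lattice coordinates, `g x = f (V x)`. -/

/-- The rectangular polytope `∏_d [b_d B, (b_d + 1) B)`. -/
def bandRect (B : ℝ) (b : Fin n → ℤ) : Set (Fin n → ℝ) :=
  {xb | ∀ d, (b d : ℝ) * B ≤ xb d ∧ xb d < ((b d : ℝ) + 1) * B}

/-- The index `b` of the band with `xb ∈ bandRect B b`. -/
def bandOf (B : ℝ) (xb : Fin n → ℝ) : Fin n → ℤ := fun d => ⌊xb d / B⌋

/-- The constant `M_b = ⌊(inf_{xb ∈ R_b} g(0, xb) + lam) / h⌋ - 1`. -/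
def initConst (lam h B : ℝ) (g : (Fin (n + 1) → ℝ) → ℝ) (b : Fin n → ℤ) : ℤ :=
  ⌊(sInf ((fun xb : Fin n → ℝ => g (Fin.cons 0 xb)) '' bandRect B b) + lam) / h⌋ - 1

/-- One stage of the folding recursion in a band: the folding time `τ_r`, the folding sign `s_r` and
the residual function `ε_r`. -/
structure FoldState where
  time : ℝ
  sign : ℝ
  resid : ℝ → ℝ

/-- The set `{x₁ > τ_r : sup_{xb ∈ R_b} |g(x₁, xb) - ε_r(x₁)| = lam}`. -/
def foldSet (lam B : ℝ) (g : (Fin (n + 1) → ℝ) → ℝ) (b : Fin n → ℤ) (st : FoldState) : Set ℝ :=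
  {x1 | st.time < x1 ∧
    sSup ((fun xb : Fin n → ℝ => |g (Fin.cons x1 xb) - st.resid x1|) '' bandRect B b) = lam}

/-- From stage `r` to stage `r + 1` of the folding recursion. -/
def foldStep (lam h B : ℝ) (g : (Fin (n + 1) → ℝ) → ℝ) (b : Fin n → ℤ) (st : FoldState) :
    FoldState :=
  let tau : ℝ := sInf (foldSet lam B g b st)
  let s : ℝ := Real.sign (g (Fin.cons tau (fun d => B * (b d : ℝ))) - st.resid tau)
  { time := tau
    sign := s
    resid := fun x1 => st.resid x1 + h * s * (Set.Ici tau).indicator 1 x1 }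

/-- The stages of the folding recursion, starting from `τ_0 = s_0 = 0` and `ε_0 = h M_b`. -/
def foldState (lam h B : ℝ) (g : (Fin (n + 1) → ℝ) → ℝ) (b : Fin n → ℤ) : ℕ → FoldState
  | 0 => { time := 0, sign := 0, resid := fun _ => h * (initConst lam h B g b : ℝ) }
  | r + 1 => foldStep lam h B g b (foldState lam h B g b r)

/-- The number `R_b⁺` of folds in band `b`: the first stage after which there is no fold. -/
def numFolds (lam h B : ℝ) (g : (Fin (n + 1) → ℝ) → ℝ) (b : Fin n → ℤ) : ℕ :=
  sInf {r | foldSet lam B g b (foldState lam h B g b r) = ∅}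

/-- The operator in lattice coordinates for `x₁ ≥ 0`: the input minus the residual of its band. -/
def modHystPos (lam h B : ℝ) (g : (Fin (n + 1) → ℝ) → ℝ) (x : Fin (n + 1) → ℝ) : ℝ :=
  g x - (foldState lam h B g (bandOf B (Fin.tail x))
    (numFolds lam h B g (bandOf B (Fin.tail x)))).resid (x 0)

/-- The reflection of the first lattice coordinate. -/
def mirror (x : Fin (n + 1) → ℝ) : Fin (n + 1) → ℝ := Fin.cons (-(x 0)) (Fin.tail x)

/-- The operator in lattice coordinates; for `x₁ < 0` it acts on the mirrored input. -/
def modHystLattice (lam h B : ℝ) (g : (Fin (n + 1) → ℝ) → ℝ) (x : Fin (n + 1) → ℝ) : ℝ :=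
  if 0 ≤ x 0 then modHystPos lam h B g x
  else modHystPos lam h B (fun u => g (mirror u)) (mirror x)

/-- The multi-dimensional modulo-hysteresis operator `f ↦ z` with threshold `lam`, hysteresis `h` and
bands of width `B` along the columns `2, …, D` of `V`. -/
def modHyst (lam h B : ℝ) (V : Matrix (Fin (n + 1)) (Fin (n + 1)) ℝ)
    (f : EuclideanSpace ℝ (Fin (n + 1)) → ℝ) (x : EuclideanSpace ℝ (Fin (n + 1))) : ℝ :=
  modHystLattice lam h B (fun u => f (point V u)) (V⁻¹ *ᵥ x.ofLp)

/-! ### The sampled block and the constants of the probability bound -/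

/-- The block of indices `k₁ ∈ {1, …, K₁}` and `k_d ∈ {0, …, K_d - 1}` for `d ≥ 2`. -/
def block (K : Fin (n + 1) → ℕ) : Finset (Fin (n + 1) → ℤ) :=
  Fintype.piFinset fun d =>
    if d = 0 then Finset.Icc 1 (K d : ℤ) else Finset.Ico 0 (K d : ℤ)

/-- The constant `C`; `F` stands for `‖f‖_∞`. -/
def constC (N : ℕ) (h sig B F : ℝ) (Om T : Fin (n + 1) → ℝ) : ℝ :=
  (h / 2 - (T 0 * Om 0 * Real.exp 1) ^ N * F) / (sig * √(2 ^ (N + 1))) *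
    ∏ d : Fin n, √(B / T d.succ)

/-- The constant `κ_min`, both maxima being over `d ≥ 2`; `F` stands for `‖f‖_∞`. -/
def constKappa (N : ℕ) (h sig B F : ℝ) (Om T : Fin (n + 1) → ℝ) : ℝ :=
  (h / 2 - ((⨆ d : Fin n, T d.succ * Om d.succ) * Real.exp 1) ^ N * F) /
      (sig * √(2 ^ (N + 1))) *
    √(B ^ (n - 1) / (⨆ d : Fin n, T d.succ) ^ (n - 1))

/-- The lower bound for the probability of recovery. -/
def accBound (K₁ : ℕ) (Bmax : Fin n → ℕ) (N : ℕ) (h sig B F : ℝ) (Om T : Fin (n + 1) → ℝ) : ℝ :=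
  (1 - Real.exp (-(constC N h sig B F Om T) ^ 2)) ^ (K₁ * ∏ d, Bmax d) *
    (1 - Real.exp (-(constKappa N h sig B F Om T) ^ 2)) ^ (∏ d, Bmax d)

end ModHyst

end

open ModHyst

/-!
The operator subtracts from `f` a function that is, in each band, a step function of `x₁` with
values in `h ℤ`. So `y = f + η - h E`, where the integers `E` depend only on `k₁` and on the band of
`k`. Whether the folding recursion stops does not matter: the residual of every stage has values in
`h ℤ` (`foldState_resid_eq`). Since the oscillation of `f` over a band is at most `2λ - 3h`, the
folded input starts within `λ - h` of zero, so that the first fold needs the time in which `f` can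
move by `h`; by Bernstein's inequality and the third hypothesis on `f` this is more than
`(N + 1) T₁`. Hence `E` is the initial constant `M_b` for the first `N + 1` samples of every band
(`PaleyWiener.exists_fold_counts`).

It remains to find the integers `E - M_0`. The samples are tested with linear statistics of two
kinds: the error of a linear prediction, along the first index, of the mean over a band; and, at
`k₁ = 1`, the mean of the jump between neighbouring samples of two adjacent bands. A wrong integer
changes the first statistic that it enters by at least `h` in absolute value. So if all statistics
of `f + η` are smaller than `h / 2`, then `E - M_0` is the only pattern for which the unfolded
samples have this property (`Explains.unique`): it is zero in band `0` at the start, then passes to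
the other bands through the jumps, and to later times through the predictions. The reconstruction
adds back the unique pattern that explains the samples; there are only countably many patterns, so
it is measurable (`exists_reconstruction`).

The part of a statistic that is due to `f` is bounded by first and second differences, that is, by
Bernstein's inequality (`PaleyWiener.abs_sub_le`, `PaleyWiener.abs_second_diff_le`). This rests on
the Fourier series of the triangle wave, by which the derivative of a band-limited function is an
absolutely convergent combination of its translates, and on Fourier inversion. The `N`-th difference
itself is not needed: under the hypotheses on `f`, a predictor from the last one or three samples
has at least the ratio of margin to noise that appears in `C` (`exists_predictor`), and a first
difference the one in `κ_min` (`four_mul_sq_div_le_sq_sub`).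

The part due to the noise consists of centred, jointly Gaussian but dependent variables. By Šidák's
inequality (`sidak_stdGaussian`) the probability that all of them stay below their thresholds is at
least the product of the single probabilities, and `P(|Z| < r) ≥ 1 - exp (-r² / 2)` for standard
normal `Z` (`one_sub_exp_le_gaussianReal`) bounds each of these. Šidák's inequality is the
correlation of a symmetric convex set with a symmetric slab: by the Prékopa-Leindler inequality, the
measure of the sections of the set parallel to the slab is log-concave and even. The bound is strict
because band `0` needs no jump statistic. The behaviour of `C` and `κ_min` under changes of the
sampling periods is elementary.
-/

/-! ### Bernstein's inequality for oscillatory integrals -/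

theorem hasSum_cos_odd_div_sq {x : ℝ} (hx0 : 0 ≤ x) (hx1 : x ≤ 1 / 2) :
    HasSum (fun j : ℕ => 1 / (2 * (j : ℝ) + 1) ^ 2 * Real.cos (2 * Real.pi * (2 * j + 1) * x))
      (Real.pi ^ 2 * (1 / 8 - x / 2)) := by
  have key : ∀ y : ℝ, y ∈ Set.Icc (0 : ℝ) 1 →
      HasSum (fun n : ℕ => 1 / (n : ℝ) ^ 2 * Real.cos (2 * Real.pi * n * y))
        (Real.pi ^ 2 * (y ^ 2 - y + 6⁻¹)) := by
    intro y hy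
    convert! hasSum_one_div_nat_pow_mul_cos one_ne_zero hy using 1
    have := bernoulliFun_two y
    rw [bernoulliFun] at this
    simp only [mul_one, this]
    norm_num [Nat.factorial]
    left
    ring
  have hall := key x ⟨hx0, by linarith⟩
  -- the even terms are a quarter of the whole series at `2 x`
  have heven : HasSum (fun j : ℕ => 1 / ((2 * j : ℕ) : ℝ) ^ 2 *
      Real.cos (2 * Real.pi * ((2 * j : ℕ) : ℝ) * x))
      (Real.pi ^ 2 * ((2 * x) ^ 2 - 2 * x + 6⁻¹) / 4) := by
    convert! (key (2 * x) ⟨by linarith, by linarith⟩).div_const 4 using 1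
    ext j
    push_cast
    rw [show 2 * Real.pi * (2 * (j : ℝ)) * x = 2 * Real.pi * j * (2 * x) by ring, mul_pow, one_div,
      one_div, mul_inv]
    ring
  have hodd : Summable (fun j : ℕ => 1 / ((2 * j + 1 : ℕ) : ℝ) ^ 2 *
      Real.cos (2 * Real.pi * ((2 * j + 1 : ℕ) : ℝ) * x)) :=
    hall.summable.comp_injective (i := fun j : ℕ => 2 * j + 1) (fun a b hab => by simpa using hab)
  have hsum := HasSum.even_add_odd
    (f := fun n : ℕ => 1 / (n : ℝ) ^ 2 * Real.cos (2 * Real.pi * n * x)) heven hodd.hasSum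
  have heq := hsum.unique hall
  have := hodd.hasSum
  rw [show (∑' j : ℕ, 1 / ((2 * j + 1 : ℕ) : ℝ) ^ 2 *
      Real.cos (2 * Real.pi * ((2 * j + 1 : ℕ) : ℝ) * x)) = Real.pi ^ 2 * (1 / 8 - x / 2) by
    linarith] at this
  simpa using this

theorem hasSum_sin_odd_div_sq {θ : ℝ} (h0 : |θ| ≤ Real.pi / 2) :
    HasSum (fun j : ℕ => (-1) ^ j / (2 * (j : ℝ) + 1) ^ 2 * Real.sin ((2 * j + 1) * θ))
      (Real.pi * θ / 4) := by
  obtain ⟨h1, h2⟩ := abs_le.1 h0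
  have hpi := Real.pi_pos
  have := hasSum_cos_odd_div_sq (x := (Real.pi / 2 - θ) / (2 * Real.pi)) (by
    apply div_nonneg <;> linarith) (by rw [div_le_iff₀ (by positivity)]; linarith)
  convert! this using 1
  · ext j
    have : 2 * Real.pi * (2 * (j : ℝ) + 1) * ((Real.pi / 2 - θ) / (2 * Real.pi)) =
        (Real.pi / 2 - (2 * j + 1) * θ) + j * Real.pi := by
      field_simp; ring
    rw [this, Real.cos_add_nat_mul_pi, Real.cos_pi_div_two_sub]
    ring
  · field_simp; ring

theorem hasSum_one_div_odd_sq :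
    HasSum (fun j : ℕ => 1 / (2 * (j : ℝ) + 1) ^ 2) (Real.pi ^ 2 / 8) := by
  simpa [div_eq_mul_inv] using hasSum_cos_odd_div_sq (x := 0) le_rfl (by norm_num)

/-- The Fourier series of the triangle wave: on `[-Ω, Ω]` the symbol `iθ` of the derivative is an
absolutely convergent combination of symbols of translations, with total weight `Ω`. -/
theorem hasSum_triangle_wave {Om θ : ℝ} (hOm : 0 < Om) (hθ : |θ| ≤ Om) :
    HasSum (fun j : ℕ => ((4 * Om / Real.pi ^ 2 * ((-1) ^ j / (2 * (j : ℝ) + 1) ^ 2) : ℝ) : ℂ) *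
      (Complex.exp (Complex.I * (((2 * j + 1) * Real.pi / (2 * Om) : ℝ) * θ)) -
        Complex.exp (Complex.I * ((-((2 * j + 1) * Real.pi / (2 * Om)) : ℝ) * θ))))
      (Complex.I * θ) := by
  have hpi := Real.pi_pos
  have h1 := hasSum_sin_odd_div_sq (θ := Real.pi / (2 * Om) * θ) (by
    rw [abs_mul, abs_of_pos (by positivity)]
    calc Real.pi / (2 * Om) * |θ| ≤ Real.pi / (2 * Om) * Om := by gcongr
      _ = Real.pi / 2 := by field_simp)
  have h2 := (Complex.hasSum_ofReal.2 (h1.mul_left (8 * Om / Real.pi ^ 2))).mul_left Complex.I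
  convert! h2 using 1
  · ext j
    have hs : Complex.exp (Complex.I * (((2 * j + 1) * Real.pi / (2 * Om) : ℝ) * θ)) -
        Complex.exp (Complex.I * ((-((2 * j + 1) * Real.pi / (2 * Om)) : ℝ) * θ)) =
        2 * Complex.I * (Real.sin ((2 * j + 1) * (Real.pi / (2 * Om) * θ)) : ℝ) := by
      rw [Complex.ofReal_sin, Complex.sin]
      have e1 : Complex.I * (((2 * j + 1) * Real.pi / (2 * Om) : ℝ) * θ) =
        ((2 * j + 1) * (Real.pi / (2 * Om) * θ) : ℝ) * Complex.I := by push_cast; ring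
      have e2 : Complex.I * ((-((2 * j + 1) * Real.pi / (2 * Om)) : ℝ) * θ) =
        -((2 * j + 1) * (Real.pi / (2 * Om) * θ) : ℝ) * Complex.I := by push_cast; ring
      rw [e1, e2]
      linear_combination (Complex.exp (((2 * j + 1) * (Real.pi / (2 * Om) * θ) : ℝ) * Complex.I) -
        Complex.exp (-((2 * j + 1) * (Real.pi / (2 * Om) * θ) : ℝ) * Complex.I)) * (Complex.I_sq)
    rw [hs]
    push_cast
    ring
  · have : Real.pi * (Real.pi / (2 * Om) * θ) / 4 * (8 * Om / Real.pi ^ 2) = θ := by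
      field_simp; ring
    rw [mul_comm (8 * Om / Real.pi ^ 2), this]

section bernstein

variable {X : Type*} [MeasurableSpace X] {μ : Measure X}

/-- The function `t ↦ ∫ G e^{iθt} dμ`, whose frequencies are the values of `θ` on the support
of `G`. -/
noncomputable def oscInt (μ : Measure X) (G : X → ℂ) (θ : X → ℝ) (t : ℝ) : ℂ :=
  ∫ w, G w * Complex.exp (Complex.I * (t * θ w)) ∂μ

theorem norm_exp_I_mul (t θ : ℝ) : ‖Complex.exp (Complex.I * (t * θ))‖ = 1 := by
  rw [mul_comm, ← Complex.ofReal_mul]; exact Complex.norm_exp_ofReal_mul_I _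

theorem oscInt_integrable {G : X → ℂ} {θ : X → ℝ} (hG : Integrable G μ) (hθ : Measurable θ)
    (t : ℝ) : Integrable (fun w => G w * Complex.exp (Complex.I * (t * θ w))) μ := by
  refine hG.mono (hG.1.mul (by fun_prop)) (ae_of_all _ fun w => ?_)
  rw [norm_mul, norm_exp_I_mul, mul_one]

theorem integrable_freq_mul {G : X → ℂ} {θ : X → ℝ} {Om : ℝ} (hG : Integrable G μ)
    (hθ : Measurable θ) (hs : ∀ᵐ w ∂μ, G w ≠ 0 → |θ w| ≤ Om) :
    Integrable (fun w => Complex.I * θ w * G w) μ := by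
  refine (hG.norm.const_mul Om).mono' ((by fun_prop : AEStronglyMeasurable
    (fun w => Complex.I * (θ w : ℂ)) μ).mul hG.1) ?_
  filter_upwards [hs] with w hw
  by_cases h : G w = 0
  · simp [h]
  · simp only [norm_mul, Complex.norm_I, one_mul, Complex.norm_real, Real.norm_eq_abs]
    gcongr
    exact hw h

theorem hasDerivAt_oscInt {G : X → ℂ} {θ : X → ℝ} {Om : ℝ} (hG : Integrable G μ)
    (hθ : Measurable θ) (hs : ∀ᵐ w ∂μ, G w ≠ 0 → |θ w| ≤ Om) (t : ℝ) :
    HasDerivAt (oscInt μ G θ) (oscInt μ (fun w => Complex.I * θ w * G w) θ t) t := by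
  have hG' := integrable_freq_mul hG hθ hs
  refine (hasDerivAt_integral_of_dominated_loc_of_deriv_le (𝕜 := ℝ)
    (F' := fun s w => Complex.I * θ w * G w * Complex.exp (Complex.I * (s * θ w)))
    (bound := fun w => ‖Complex.I * θ w * G w‖) (s := Set.univ) Filter.univ_mem ?_ ?_ ?_ ?_ ?_ ?_).2
  · exact Eventually.of_forall fun s => (oscInt_integrable hG hθ s).1
  · exact oscInt_integrable hG hθ t
  · exact (oscInt_integrable hG' hθ t).1
  · refine ae_of_all _ fun w s _ => ?_
    rw [norm_mul, norm_exp_I_mul, mul_one]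
  · exact hG'.norm
  · refine ae_of_all _ fun w s _ => ?_
    have h1 : HasDerivAt (fun s : ℝ => Complex.I * ((s : ℂ) * θ w)) (Complex.I * (1 * θ w)) s :=
      ((Complex.ofRealCLM.hasDerivAt (x := s)).mul_const (θ w : ℂ)).const_mul Complex.I
    convert! (h1.cexp).const_mul (G w) using 1
    ring

/-- **Bernstein's inequality**: if the frequencies are bounded by `Om`, then `‖u'‖_∞ ≤ Om ‖u‖_∞`. By
the triangle wave, the derivative is an absolutely convergent combination of translates of `u` of
total weight `Om`. -/
theorem norm_oscInt_deriv_le {G : X → ℂ} {θ : X → ℝ} {Om F : ℝ} (hOm : 0 < Om) (hG : Integrable G μ)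
    (hθ : Measurable θ) (hs : ∀ᵐ w ∂μ, G w ≠ 0 → |θ w| ≤ Om) (hF : ∀ t, ‖oscInt μ G θ t‖ ≤ F)
    (t : ℝ) : ‖oscInt μ (fun w => Complex.I * θ w * G w) θ t‖ ≤ Om * F := by
  have hpi := Real.pi_pos
  set c : ℕ → ℝ := fun j => 4 * Om / Real.pi ^ 2 * ((-1) ^ j / (2 * (j : ℝ) + 1) ^ 2) with hc
  set s : ℕ → ℝ := fun j => (2 * j + 1) * Real.pi / (2 * Om) with hsdef
  have hcabs : ∀ j, |c j| = 4 * Om / Real.pi ^ 2 * (1 / (2 * (j : ℝ) + 1) ^ 2) := by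
    intro j
    rw [hc]; simp only [abs_mul, abs_div, abs_pow, abs_neg, abs_one, one_pow]
    rw [abs_of_pos hpi, abs_of_pos hOm, abs_of_pos (by positivity : (0:ℝ) < 2 * j + 1)]
    norm_num
  have hcsum : HasSum (fun j => |c j|) (Om / 2) := by
    simp_rw [hcabs]
    convert! hasSum_one_div_odd_sq.mul_left (4 * Om / Real.pi ^ 2) using 1
    field_simp; norm_num
  set E : ℝ → X → ℂ := fun t w => G w * Complex.exp (Complex.I * (t * θ w)) with hE
  have hEint : ∀ t, Integrable (E t) μ := fun t => oscInt_integrable hG hθ t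
  have hEnorm : ∀ t w, ‖E t w‖ = ‖G w‖ := fun t w => by
    simp only [hE]; rw [norm_mul, norm_exp_I_mul, mul_one]
  -- insert the triangle wave under the integral and integrate term by term
  have hsum : HasSum (fun j => ∫ w, (c j : ℂ) * (E (t + s j) w - E (t - s j) w) ∂μ)
      (∫ w, ∑' j, (c j : ℂ) * (E (t + s j) w - E (t - s j) w) ∂μ) := by
    refine hasSum_integral_of_summable_integral_norm
      (fun j => ((hEint _).sub (hEint _)).const_mul _) ?_
    refine Summable.of_nonneg_of_le (fun j => integral_nonneg fun w => norm_nonneg _) (fun j => ?_)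
      (hcsum.summable.mul_right (2 * ∫ w, ‖G w‖ ∂μ))
    rw [← integral_const_mul, ← integral_const_mul]
    refine integral_mono (((hEint _).sub (hEint _)).const_mul _).norm
      ((hG.norm.const_mul _).const_mul _) fun w => ?_
    simp only [norm_mul, Complex.norm_real, Real.norm_eq_abs]
    gcongr
    refine (norm_sub_le _ _).trans ?_
    rw [hEnorm, hEnorm]; linarith
  have hval : (∫ w, ∑' j, (c j : ℂ) * (E (t + s j) w - E (t - s j) w) ∂μ) =
      oscInt μ (fun w => Complex.I * θ w * G w) θ t := by
    refine integral_congr_ae ?_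
    filter_upwards [hs] with w hw
    by_cases h : G w = 0
    · simp [hE, h]
    · have := (hasSum_triangle_wave hOm (hw h)).mul_left
        (G w * Complex.exp (Complex.I * (t * θ w)))
      refine Eq.trans ?_ (this.tsum_eq.trans (by ring))
      refine tsum_congr fun j => ?_
      simp only [hE]
      rw [show Complex.I * (((t + s j : ℝ) : ℂ) * θ w) = Complex.I * (t * θ w) +
        Complex.I * ((s j : ℝ) * θ w) by push_cast; ring,
        show Complex.I * (((t - s j : ℝ) : ℂ) * θ w) = Complex.I * (t * θ w) +
        Complex.I * ((-(s j) : ℝ) * θ w) by push_cast; ring, Complex.exp_add, Complex.exp_add]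
      ring
  rw [hval] at hsum
  rw [← hsum.tsum_eq]
  have hterm : ∀ j, ‖∫ w, (c j : ℂ) * (E (t + s j) w - E (t - s j) w) ∂μ‖ ≤ |c j| * (2 * F) := by
    intro j
    rw [integral_const_mul, integral_sub (hEint _) (hEint _), norm_mul, Complex.norm_real,
      Real.norm_eq_abs]
    gcongr
    refine (norm_sub_le _ _).trans ?_
    have h1 := hF (t + s j)
    have h2 := hF (t - s j)
    simp only [oscInt] at h1 h2
    simp only [hE]
    linarith
  have := tsum_of_norm_bounded (hcsum.mul_right (2 * F)) hterm
  linarith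

/-- **Bernstein's inequality** in the form of a Lipschitz bound. -/
theorem norm_oscInt_sub_le {G : X → ℂ} {θ : X → ℝ} {Om F : ℝ} (hOm : 0 < Om) (hG : Integrable G μ)
    (hθ : Measurable θ) (hs : ∀ᵐ w ∂μ, G w ≠ 0 → |θ w| ≤ Om) (hF : ∀ t, ‖oscInt μ G θ t‖ ≤ F)
    (t : ℝ) : ‖oscInt μ G θ (t + 1) - oscInt μ G θ t‖ ≤ Om * F := by
  have := Convex.norm_image_sub_le_of_norm_hasDerivWithin_le (𝕜 := ℝ) (s := Set.univ)
    (f := oscInt μ G θ) (x := t) (y := t + 1)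
    (fun x _ => (hasDerivAt_oscInt hG hθ hs x).hasDerivWithinAt)
    (fun x _ => norm_oscInt_deriv_le hOm hG hθ hs hF x) convex_univ (Set.mem_univ _)
    (Set.mem_univ _)
  simpa using this

/-- **Bernstein's inequality**, used twice, for second differences. -/
theorem norm_oscInt_second_diff_le {G : X → ℂ} {θ : X → ℝ} {Om F : ℝ} (hOm : 0 < Om)
    (hG : Integrable G μ) (hθ : Measurable θ) (hs : ∀ᵐ w ∂μ, G w ≠ 0 → |θ w| ≤ Om)
    (hF : ∀ t, ‖oscInt μ G θ t‖ ≤ F) :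
    ‖oscInt μ G θ 2 - 2 * oscInt μ G θ 1 + oscInt μ G θ 0‖ ≤ Om ^ 2 * F := by
  have hG' := integrable_freq_mul hG hθ hs
  have hs' : ∀ᵐ w ∂μ, Complex.I * θ w * G w ≠ 0 → |θ w| ≤ Om := by
    filter_upwards [hs] with w hw h
    exact hw (right_ne_zero_of_mul h)
  have hd : ∀ x : ℝ, HasDerivAt (fun t => oscInt μ G θ (t + 1) - oscInt μ G θ t)
      (oscInt μ (fun w => Complex.I * θ w * G w) θ (x + 1) -
        oscInt μ (fun w => Complex.I * θ w * G w) θ x) x := fun x =>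
    ((hasDerivAt_oscInt hG hθ hs (x + 1)).comp_add_const x 1).sub (hasDerivAt_oscInt hG hθ hs x)
  have := Convex.norm_image_sub_le_of_norm_hasDerivWithin_le (𝕜 := ℝ) (s := Set.univ)
    (x := (0 : ℝ)) (y := 1) (fun x _ => (hd x).hasDerivWithinAt)
    (fun x _ => norm_oscInt_sub_le hOm hG' hθ hs'
      (fun t => norm_oscInt_deriv_le hOm hG hθ hs hF t) x) convex_univ (Set.mem_univ _)
      (Set.mem_univ _)
  norm_num at this
  convert! this using 1
  · congr 1
    ring
  · ring

end bernstein

/-! ### Paley-Wiener functions -/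

/-- An `L²` function whose `L²` Fourier transform is integrable is almost everywhere the inverse
Fourier integral of that transform. -/
theorem MeasureTheory.Lp.ae_eq_fourierInv {E : Type*} [NormedAddCommGroup E] [InnerProductSpace ℝ E]
    [FiniteDimensional ℝ E] [MeasurableSpace E] [BorelSpace E] (u : Lp (α := E) ℂ 2 volume)
    (hG : Integrable (𝓕 u : Lp (α := E) ℂ 2 volume) volume) :
    u =ᵐ[volume] 𝓕⁻ ((𝓕 u : Lp (α := E) ℂ 2 volume) : E → ℂ) := by
  set G : Lp (α := E) ℂ 2 volume := 𝓕 u with hGdef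
  have hcont : Continuous (𝓕⁻ (G : E → ℂ)) := by
    rw [Real.fourierInv_eq_fourier_comp_neg]
    exact VectorFourier.fourierIntegral_continuous Real.continuous_fourierChar
      (by exact continuous_inner) hG.comp_neg
  -- test against smooth functions, and move the transform to the test function on both sides
  refine ae_eq_of_integral_contDiff_smul_eq
    ((Lp.memLp u).locallyIntegrable (by norm_num)) hcont.locallyIntegrable ?_
  intro g hg hgs
  have hgs' : HasCompactSupport (fun x => (g x : ℂ)) :=
    hgs.comp_left (g := fun r : ℝ => (r : ℂ)) Complex.ofReal_zero
  set φ : SchwartzMap E ℂ := hgs'.toSchwartzMap (Complex.ofRealCLM.contDiff.comp hg) with hφ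
  have hφx : ∀ x, φ x = (g x : ℂ) := fun x => rfl
  have hu : u = 𝓕⁻ G := (FourierTransform.fourierInv_fourier_eq u).symm
  have h1 : Lp.toTemperedDistribution u φ = ∫ x, φ x • u x := Lp.toTemperedDistribution_apply u φ
  have h2 : Lp.toTemperedDistribution u φ = ∫ x, (𝓕⁻ φ) x • G x := by
    rw [hu, ← Lp.fourierInv_toTemperedDistribution_eq, TemperedDistribution.fourierInv_apply,
      Lp.toTemperedDistribution_apply]
  have h3 : ∫ x, (𝓕⁻ φ) x • G x = ∫ x, φ x • (𝓕⁻ (G : E → ℂ)) x := by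
    have := VectorFourier.integral_fourierIntegral_smul_eq_flip (μ := (volume : Measure E))
      (ν := (volume : Measure E)) (L := -innerₗ E)
      (e := Real.fourierChar) (f := φ) (g := (G : E → ℂ)) Real.continuous_fourierChar
      (by
        have : Continuous fun p : E × E => -(inner ℝ p.1 p.2) := continuous_inner.neg
        exact this) φ.integrable hG
    have hflip : (-innerₗ E : E →ₗ[ℝ] E →ₗ[ℝ] ℝ).flip = -innerₗ E := by
      ext x y; simp [real_inner_comm]
    rw [hflip] at this
    have hinv : ∀ (f : E → ℂ), 𝓕⁻ f =
      VectorFourier.fourierIntegral Real.fourierChar volume (-innerₗ E) f := fun f => rfl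
    rw [SchwartzMap.fourierInv_coe, hinv, hinv]
    exact this
  have e1 : ∀ x, g x • u x = φ x • u x := fun x => by rw [hφx]; rfl
  have e2 : ∀ x, g x • (𝓕⁻ (G : E → ℂ)) x = φ x • (𝓕⁻ (G : E → ℂ)) x := fun x => by rw [hφx]; rfl
  simp_rw [e1, e2]
  rw [← h1, h2, h3]

namespace ModHyst

variable {n : ℕ}

theorem point_add (V : Matrix (Fin (n + 1)) (Fin (n + 1)) ℝ) (x y : Fin (n + 1) → ℝ) :
    point V (x + y) = point V x + point V y := by
  simp [point, Matrix.mulVec_add]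

theorem point_smul (V : Matrix (Fin (n + 1)) (Fin (n + 1)) ℝ) (c : ℝ) (x : Fin (n + 1) → ℝ) :
    point V (c • x) = c • point V x := by
  simp [point, Matrix.mulVec_smul]

theorem inner_point (V : Matrix (Fin (n + 1)) (Fin (n + 1)) ℝ) (hV : V.det ≠ 0)
    (om v : Fin (n + 1) → ℝ) : inner ℝ (point (V⁻¹)ᵀ om) (point V v) = ∑ d, om d * v d := by
  have : inner ℝ (point (V⁻¹)ᵀ om) (point V v) = ((V⁻¹)ᵀ *ᵥ om) ⬝ᵥ (V *ᵥ v) := by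
    simp [point, EuclideanSpace.inner_eq_star_dotProduct, dotProduct_comm]
  rw [this, Matrix.mulVec_transpose, Matrix.dotProduct_mulVec, Matrix.vecMul_vecMul,
    Matrix.nonsing_inv_mul _ (isUnit_iff_ne_zero.2 hV), Matrix.vecMul_one]
  rfl

theorem abs_inner_freqBox_le {V : Matrix (Fin (n + 1)) (Fin (n + 1)) ℝ} (hV : V.det ≠ 0)
    {Om : Fin (n + 1) → ℝ} {w : EuclideanSpace ℝ (Fin (n + 1))} (hw : w ∈ freqBox V Om)
    (v : Fin (n + 1) → ℝ) : |inner ℝ w (point V v)| ≤ ∑ d, Om d * |v d| := by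
  obtain ⟨om, hom, rfl⟩ := hw
  rw [inner_point V hV]
  refine (Finset.abs_sum_le_sum_abs _ _).trans (Finset.sum_le_sum fun d _ => ?_)
  rw [abs_mul]
  gcongr
  exact (hom d).le

theorem exists_norm_le_of_mem_freqBox (V : Matrix (Fin (n + 1)) (Fin (n + 1)) ℝ)
    (Om : Fin (n + 1) → ℝ) : ∃ r : ℝ, ∀ w ∈ freqBox V Om, ‖w‖ ≤ r := by
  have hcont : Continuous (point (V⁻¹)ᵀ) := by
    unfold point
    exact (PiLp.continuous_toLp 2 _).comp (Continuous.matrix_mulVec continuous_const continuous_id)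
  have hK : IsCompact (Set.pi Set.univ fun d => Set.Icc (-Om d) (Om d)) :=
    isCompact_univ_pi fun d => isCompact_Icc
  obtain ⟨r, hr⟩ := (hK.image hcont).isBounded.exists_norm_le
  refine ⟨r, ?_⟩
  rintro w ⟨om, hom, rfl⟩
  exact hr _ ⟨om, fun d _ => abs_le.1 (hom d).le, rfl⟩

/-- A Paley-Wiener function is the inverse Fourier integral of an integrable function that vanishes
outside the frequency box: its `L²` transform, which is integrable as the box is bounded. -/
theorem PaleyWiener.exists_repr {V : Matrix (Fin (n + 1)) (Fin (n + 1)) ℝ}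
    {Om : Fin (n + 1) → ℝ} {f : EuclideanSpace ℝ (Fin (n + 1)) → ℝ} (hf : PaleyWiener V Om f) :
    ∃ G : EuclideanSpace ℝ (Fin (n + 1)) → ℂ, Integrable G ∧
      (∀ᵐ w, G w ≠ 0 → (2 * Real.pi) • w ∈ freqBox V Om) ∧ ∀ x, (f x : ℂ) = 𝓕⁻ G x := by
  obtain ⟨hc, h2, hsupp⟩ := hf
  set u := h2.toLp (fun x => (f x : ℂ)) with hu
  set G : Lp ℂ 2 (volume : Measure (EuclideanSpace ℝ (Fin (n + 1)))) := 𝓕 u with hG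
  have hint : Integrable G := by
    obtain ⟨r, hr⟩ := exists_norm_le_of_mem_freqBox V Om
    have hon : IntegrableOn G (Metric.closedBall 0 (|r| / (2 * Real.pi))) := by
      have : IsFiniteMeasure ((volume : Measure (EuclideanSpace ℝ (Fin (n + 1)))).restrict
          (Metric.closedBall 0 (|r| / (2 * Real.pi)))) :=
        ⟨by simpa using measure_closedBall_lt_top⟩
      exact ((Lp.memLp G).restrict _).integrable (by norm_num)
    refine (integrable_indicator_iff measurableSet_closedBall).2 hon |>.congr ?_
    filter_upwards [hsupp] with w hw
    by_cases hm : w ∈ Metric.closedBall (0 : EuclideanSpace ℝ (Fin (n + 1))) (|r| / (2 * Real.pi))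
    · rw [Set.indicator_of_mem hm]
    · rw [Set.indicator_of_notMem hm]
      refine (hw fun hbox => hm ?_).symm
      have := hr _ hbox
      rw [norm_smul, Real.norm_eq_abs, abs_of_pos Real.two_pi_pos] at this
      rw [mem_closedBall_zero_iff, le_div_iff₀ Real.two_pi_pos, mul_comm]
      exact this.trans (le_abs_self r)
  refine ⟨G, hint, ?_, ?_⟩
  · filter_upwards [hsupp] with w hw h
    by_contra hb
    exact h (hw hb)
  · have hcont : Continuous (𝓕⁻ (G : EuclideanSpace ℝ (Fin (n + 1)) → ℂ)) := by
      rw [Real.fourierInv_eq_fourier_comp_neg]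
      exact VectorFourier.fourierIntegral_continuous Real.continuous_fourierChar
        (by exact continuous_inner) hint.comp_neg
    have := (h2.coeFn_toLp.symm.trans (Lp.ae_eq_fourierInv u hint))
    exact congrFun ((Complex.continuous_ofReal.comp hc).ae_eq_iff_eq volume hcont |>.1 this)

theorem PaleyWiener.abs_le_normInf {V : Matrix (Fin (n + 1)) (Fin (n + 1)) ℝ}
    {Om : Fin (n + 1) → ℝ} {f : EuclideanSpace ℝ (Fin (n + 1)) → ℝ} (hf : PaleyWiener V Om f)
    (x : EuclideanSpace ℝ (Fin (n + 1))) : |f x| ≤ normInf f := by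
  obtain ⟨G, hG, -, hrep⟩ := hf.exists_repr
  have hbdd : ∀ x, ‖f x‖ ≤ ∫ w, ‖G w‖ := fun x => by
    rw [← Complex.norm_real, hrep, Real.fourierInv_eq']
    refine (norm_integral_le_integral_norm _).trans (le_of_eq ?_)
    congr 1; ext w
    rw [norm_smul, Complex.norm_exp_ofReal_mul_I, one_mul]
  have htop : eLpNorm f ∞ volume ≠ ∞ :=
    (memLp_top_of_bound hf.1.aestronglyMeasurable _ (ae_of_all _ hbdd)).2.ne
  have hae : ∀ᵐ x, ‖f x‖ ≤ normInf f := by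
    filter_upwards [ae_le_eLpNormEssSup (f := f) (μ := volume)] with x hx
    have := ENNReal.toReal_mono (by rwa [eLpNorm_exponent_top] at htop) hx
    simpa [normInf] using this
  have hcl : IsClosed {x | ‖f x‖ ≤ normInf f} := isClosed_le hf.1.norm continuous_const
  have hd : Dense {x | ‖f x‖ ≤ normInf f} := Measure.dense_of_ae hae
  have := hd.closure_eq
  rw [hcl.closure_eq] at this
  exact (this ▸ Set.mem_univ x : x ∈ {x | ‖f x‖ ≤ normInf f})

theorem normInf_nonneg (f : EuclideanSpace ℝ (Fin (n + 1)) → ℝ) : 0 ≤ normInf f :=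
  ENNReal.toReal_nonneg

/-- Along any line a Paley-Wiener function is an oscillatory integral with frequencies bounded by
the support function of the frequency box. -/
theorem PaleyWiener.exists_oscInt {V : Matrix (Fin (n + 1)) (Fin (n + 1)) ℝ} (hV : V.det ≠ 0)
    {Om : Fin (n + 1) → ℝ} {f : EuclideanSpace ℝ (Fin (n + 1)) → ℝ} (hf : PaleyWiener V Om f)
    (x v : Fin (n + 1) → ℝ) :
    ∃ (G : EuclideanSpace ℝ (Fin (n + 1)) → ℂ) (θ : EuclideanSpace ℝ (Fin (n + 1)) → ℝ),
      Integrable G ∧ Measurable θ ∧ (∀ᵐ w, G w ≠ 0 → |θ w| ≤ ∑ d, Om d * |v d|) ∧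
      ∀ t : ℝ, (f (point V (x + t • v)) : ℂ) = oscInt volume G θ t := by
  obtain ⟨G, hG, hs, hrep⟩ := hf.exists_repr
  refine ⟨fun w => G w *
      Complex.exp (Complex.I * ((1 : ℝ) * (2 * Real.pi * inner ℝ w (point V x) : ℝ))),
    fun w => inner ℝ ((2 * Real.pi) • w) (point V v), ?_, ?_, ?_, ?_⟩
  · exact oscInt_integrable hG (by fun_prop) 1
  · fun_prop
  · filter_upwards [hs] with w hw h
    exact abs_inner_freqBox_le hV (hw (left_ne_zero_of_mul h)) v
  · intro t
    rw [hrep, Real.fourierInv_eq', oscInt]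
    congr 1; ext w
    rw [point_add, point_smul, inner_add_right, real_inner_smul_right, real_inner_smul_left,
      smul_eq_mul, mul_comm, mul_assoc (G w), ← Complex.exp_add]
    congr 2
    push_cast
    ring

/-- **Bernstein's inequality** for first differences of a Paley-Wiener function. -/
theorem PaleyWiener.abs_sub_le {V : Matrix (Fin (n + 1)) (Fin (n + 1)) ℝ} (hV : V.det ≠ 0)
    {Om : Fin (n + 1) → ℝ} (hOm : ∀ d, 0 < Om d)
    {f : EuclideanSpace ℝ (Fin (n + 1)) → ℝ} (hf : PaleyWiener V Om f) (x v : Fin (n + 1) → ℝ) :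
    |f (point V (x + v)) - f (point V x)| ≤ (∑ d, Om d * |v d|) * normInf f := by
  by_cases hv : v = 0
  · simp [hv]
  have hpos : 0 < ∑ d, Om d * |v d| := by
    obtain ⟨d, hd⟩ := Function.ne_iff.1 hv
    exact Finset.sum_pos' (fun d _ => mul_nonneg (hOm d).le (abs_nonneg _))
      ⟨d, Finset.mem_univ _, mul_pos (hOm d) (abs_pos.2 hd)⟩
  obtain ⟨G, θ, hG, hθ, hs, hrep⟩ := hf.exists_oscInt hV x v
  have hF : ∀ t, ‖oscInt volume G θ t‖ ≤ normInf f := fun t => by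
    rw [← hrep, Complex.norm_real]; exact hf.abs_le_normInf _
  have := norm_oscInt_sub_le hpos hG hθ hs hF 0
  rw [← hrep, ← hrep, ← Complex.ofReal_sub, Complex.norm_real] at this
  simpa using this

/-- **Bernstein's inequality** for second differences of a Paley-Wiener function. -/
theorem PaleyWiener.abs_second_diff_le {V : Matrix (Fin (n + 1)) (Fin (n + 1)) ℝ} (hV : V.det ≠ 0)
    {Om : Fin (n + 1) → ℝ} (hOm : ∀ d, 0 < Om d)
    {f : EuclideanSpace ℝ (Fin (n + 1)) → ℝ} (hf : PaleyWiener V Om f) (x v : Fin (n + 1) → ℝ) :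
    |f (point V (x + (2 : ℝ) • v)) - 2 * f (point V (x + v)) + f (point V x)| ≤
      (∑ d, Om d * |v d|) ^ 2 * normInf f := by
  by_cases hv : v = 0
  · simp [hv]; ring_nf
  have hpos : 0 < ∑ d, Om d * |v d| := by
    obtain ⟨d, hd⟩ := Function.ne_iff.1 hv
    exact Finset.sum_pos' (fun d _ => mul_nonneg (hOm d).le (abs_nonneg _))
      ⟨d, Finset.mem_univ _, mul_pos (hOm d) (abs_pos.2 hd)⟩
  obtain ⟨G, θ, hG, hθ, hs, hrep⟩ := hf.exists_oscInt hV x v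
  have hF : ∀ t, ‖oscInt volume G θ t‖ ≤ normInf f := fun t => by
    rw [← hrep, Complex.norm_real]; exact hf.abs_le_normInf _
  have := norm_oscInt_second_diff_le hpos hG hθ hs hF
  rw [← hrep, ← hrep, ← hrep] at this
  simp only [zero_smul, add_zero, one_smul] at this
  rw [← Real.norm_eq_abs, ← Complex.norm_real]
  push_cast
  exact this

end ModHyst

/-! ### The Prékopa-Leindler inequality and Gaussian measures of slabs -/

/-- The one-dimensional Brunn-Minkowski inequality for compact sets. -/
theorem volume_add_volume_le_of_isCompact {K L S : Set ℝ} (hK : IsCompact K) (hL : IsCompact L)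
    (hKn : K.Nonempty) (hLn : L.Nonempty) (h : ∀ a ∈ K, ∀ b ∈ L, a + b ∈ S) :
    volume K + volume L ≤ volume S := by
  set k := sSup K
  set l := sInf L
  have hk : k ∈ K := hK.sSup_mem hKn
  have hl : l ∈ L := hL.sInf_mem hLn
  -- the translates `K + min L` and `max K + L` meet in a single point
  have e1 : volume ((fun x => x + l) '' K) = volume K := by
    simp
  have e2 : volume ((fun x => k + x) '' L) = volume L := by
    simp
  have hd : AEDisjoint volume ((fun x => x + l) '' K) ((fun x => k + x) '' L) := by
    refine measure_mono_null (t := {k + l}) ?_ (by simp)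
    rintro _ ⟨⟨a, ha, rfl⟩, ⟨b, hb, hab⟩⟩
    have h1 : a ≤ k := le_csSup hK.bddAbove ha
    have h2 : l ≤ b := csInf_le hL.bddBelow hb
    simp only at hab ⊢
    rw [Set.mem_singleton_iff]
    linarith
  rw [← e1, ← e2, ← measure_union₀ (hL.image (by fun_prop)).measurableSet.nullMeasurableSet hd]
  refine measure_mono (Set.union_subset ?_ ?_)
  · rintro _ ⟨a, ha, rfl⟩; exact h a ha l hl
  · rintro _ ⟨b, hb, rfl⟩; exact h k hk b hb

/-- The one-dimensional **Brunn-Minkowski inequality**. -/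
theorem volume_add_volume_le {A B S : Set ℝ} (hA : MeasurableSet A) (hB : MeasurableSet B)
    (hAn : A.Nonempty) (hBn : B.Nonempty) (h : ∀ a ∈ A, ∀ b ∈ B, a + b ∈ S) :
    volume A + volume B ≤ volume S := by
  have aux : ∀ {U : Set ℝ}, U.Nonempty → ∀ K : Set ℝ, ∃ K' : Set ℝ, K' ⊆ U ∧ IsCompact K' ∧
      K'.Nonempty ∧ (⨆ (_ : K ⊆ U) (_ : IsCompact K), volume K) ≤ volume K' := by
    rintro U ⟨u, hu⟩ K
    by_cases hK : K ⊆ U ∧ IsCompact K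
    · exact ⟨insert u K, Set.insert_subset hu hK.1, hK.2.insert u, Set.insert_nonempty _ _,
        iSup₂_le fun _ _ => measure_mono (Set.subset_insert _ _)⟩
    · exact ⟨{u}, by simpa using hu, isCompact_singleton, Set.singleton_nonempty u,
        iSup₂_le fun h1 h2 => absurd ⟨h1, h2⟩ hK⟩
  rw [hA.measure_eq_iSup_isCompact, hB.measure_eq_iSup_isCompact]
  refine ENNReal.iSup_add_iSup_le fun K L => ?_
  obtain ⟨K', hK1, hK2, hK3, hK4⟩ := aux hAn K
  obtain ⟨L', hL1, hL2, hL3, hL4⟩ := aux hBn L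
  exact (add_le_add hK4 hL4).trans (volume_add_volume_le_of_isCompact hK2 hL2 hK3 hL3
    fun a ha b hb => h a (hK1 ha) b (hL1 hb))

open scoped Pointwise in
theorem ofReal_mul_volume_add_le {A B S : Set ℝ} {t : ℝ} (ht0 : 0 < t) (ht1 : t < 1)
    (hA : MeasurableSet A) (hB : MeasurableSet B) (hAn : A.Nonempty) (hBn : B.Nonempty)
    (h : ∀ a ∈ A, ∀ b ∈ B, (1 - t) * a + t * b ∈ S) :
    ENNReal.ofReal (1 - t) * volume A + ENNReal.ofReal t * volume B ≤ volume S := by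
  have h1 : volume ((1 - t) • A) = ENNReal.ofReal (1 - t) * volume A := by
    rw [Measure.addHaar_smul]; simp [abs_of_pos (sub_pos.2 ht1)]
  have h2 : volume (t • B) = ENNReal.ofReal t * volume B := by
    rw [Measure.addHaar_smul]; simp [abs_of_pos ht0]
  rw [← h1, ← h2]
  refine volume_add_volume_le (hA.const_smul₀ _) (hB.const_smul₀ _) (hAn.smul_set) (hBn.smul_set) ?_
  rintro _ ⟨a, ha, rfl⟩ _ ⟨b, hb, rfl⟩
  exact h a ha b hb

/-- The one-dimensional **Prékopa-Leindler inequality** for functions with supremum `1`, where it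
follows from the Brunn-Minkowski inequality for the superlevel sets. -/
theorem integral_add_integral_le_of_sup_one {F G H : ℝ → ℝ} {t : ℝ} (ht0 : 0 < t) (ht1 : t < 1)
    (hFm : Measurable F) (hGm : Measurable G) (hFi : Integrable F)
    (hGi : Integrable G) (hHi : Integrable H) (hF0 : 0 ≤ F) (hG0 : 0 ≤ G) (hH0 : 0 ≤ H)
    (hF1 : ∀ x, F x ≤ 1) (hG1 : ∀ x, G x ≤ 1) (hFs : ∀ r < 1, ∃ x, r < F x)
    (hGs : ∀ r < 1, ∃ x, r < G x)
    (h : ∀ x y, F x ^ (1 - t) * G y ^ t ≤ H ((1 - t) * x + t * y)) :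
    (1 - t) * (∫ x, F x) + t * (∫ x, G x) ≤ ∫ x, H x := by
  have layer : ∀ {f : ℝ → ℝ}, Integrable f → 0 ≤ f →
      ENNReal.ofReal (∫ x, f x) = ∫⁻ s in Set.Ioi 0, volume {x | s < f x} := fun hfi hf0 => by
    rw [ofReal_integral_eq_lintegral_ofReal hfi (ae_of_all _ hf0),
      lintegral_eq_lintegral_meas_lt _ (ae_of_all _ hf0) hfi.aemeasurable]
  have anti : ∀ f : ℝ → ℝ, Measurable fun s => volume {x | s < f x} := fun f =>
    Antitone.measurable fun s s' hs => measure_mono fun x (hx : s' < f x) => lt_of_le_of_lt hs hx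
  have unit : ∀ {f : ℝ → ℝ}, (∀ x, f x ≤ 1) →
      ∫⁻ s in Set.Ioi 0, volume {x | s < f x} = ∫⁻ s in Set.Ioo 0 1, volume {x | s < f x} := by
    intro f hf
    rw [← lintegral_indicator measurableSet_Ioi, ← lintegral_indicator measurableSet_Ioo]
    congr 1; ext s
    by_cases hs : s ∈ Set.Ioo (0 : ℝ) 1
    · rw [Set.indicator_of_mem hs, Set.indicator_of_mem (show s ∈ Set.Ioi 0 from hs.1)]
    · rw [Set.indicator_of_notMem hs]
      by_cases hs0 : 0 < s
      · have : 1 ≤ s := not_lt.1 fun h1 => hs ⟨hs0, h1⟩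
        rw [Set.indicator_of_mem (show s ∈ Set.Ioi 0 from hs0)]
        have : {x | s < f x} = ∅ := by
          ext x; simpa using (hf x).trans this
        simp [this]
      · exact Set.indicator_of_notMem hs0 _
  have hFI := layer hFi hF0
  have hGI := layer hGi hG0
  have hHI := layer hHi hH0
  rw [unit hF1] at hFI
  rw [unit hG1] at hGI
  have key : ENNReal.ofReal (1 - t) * ENNReal.ofReal (∫ x, F x) +
      ENNReal.ofReal t * ENNReal.ofReal (∫ x, G x) ≤ ENNReal.ofReal (∫ x, H x) := by
    rw [hFI, hGI, hHI, ← lintegral_const_mul _ (anti F), ← lintegral_const_mul _ (anti G),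
      ← lintegral_add_left ((anti F).const_mul _)]
    refine (setLIntegral_mono' measurableSet_Ioo fun s hs => ?_).trans
      (lintegral_mono_set Set.Ioo_subset_Ioi_self)
    refine ofReal_mul_volume_add_le ht0 ht1 (measurableSet_lt measurable_const hFm)
      (measurableSet_lt measurable_const hGm) (hFs s hs.2) (hGs s hs.2) ?_
    intro x hx y hy
    refine lt_of_lt_of_le ?_ (h x y)
    calc s = s ^ (1 - t) * s ^ t := by
          rw [← Real.rpow_add hs.1, sub_add_cancel, Real.rpow_one]
      _ < F x ^ (1 - t) * G y ^ t := by
          refine mul_lt_mul (Real.rpow_lt_rpow hs.1.le hx (by linarith))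
            (Real.rpow_le_rpow hs.1.le (le_of_lt hy) ht0.le) (Real.rpow_pos_of_pos hs.1 _)
            (Real.rpow_nonneg (hF0 x) _)
  rw [← ENNReal.ofReal_mul (by linarith), ← ENNReal.ofReal_mul ht0.le,
    ← ENNReal.ofReal_add (mul_nonneg (by linarith) (integral_nonneg hF0))
      (mul_nonneg ht0.le (integral_nonneg hG0))] at key
  exact (ENNReal.ofReal_le_ofReal_iff (integral_nonneg hH0)).1 key

/-- The one-dimensional **Prékopa-Leindler inequality** for bounded functions. -/
theorem integral_rpow_mul_integral_rpow_le {F G H : ℝ → ℝ} {t M : ℝ} (ht0 : 0 < t) (ht1 : t < 1)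
    (hFm : Measurable F) (hGm : Measurable G) (hFi : Integrable F)
    (hGi : Integrable G) (hHi : Integrable H) (hF0 : 0 ≤ F) (hG0 : 0 ≤ G) (hH0 : 0 ≤ H)
    (hFM : ∀ x, F x ≤ M) (hGM : ∀ x, G x ≤ M)
    (h : ∀ x y, F x ^ (1 - t) * G y ^ t ≤ H ((1 - t) * x + t * y)) :
    (∫ x, F x) ^ (1 - t) * (∫ x, G x) ^ t ≤ ∫ x, H x := by
  have ht1' : 0 < 1 - t := by linarith
  have hFb : BddAbove (Set.range F) := ⟨M, by rintro _ ⟨x, rfl⟩; exact hFM x⟩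
  have hGb : BddAbove (Set.range G) := ⟨M, by rintro _ ⟨x, rfl⟩; exact hGM x⟩
  -- scale both functions to supremum `1`, then use the weighted AM-GM inequality
  set a := ⨆ x, F x with ha
  set b := ⨆ x, G x with hb
  have hFa : ∀ x, F x ≤ a := le_ciSup hFb
  have hGb : ∀ x, G x ≤ b := le_ciSup hGb
  rcases (le_trans (hF0 0) (hFa 0) : 0 ≤ a).eq_or_lt with ha0 | ha0
  · have : ∀ x, F x = 0 := fun x => le_antisymm (ha0 ▸ hFa x) (hF0 x)
    simp only [this, integral_zero, Real.zero_rpow ht1'.ne', zero_mul]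
    exact integral_nonneg hH0
  rcases (le_trans (hG0 0) (hGb 0) : 0 ≤ b).eq_or_lt with hb0 | hb0
  · have : ∀ x, G x = 0 := fun x => le_antisymm (hb0 ▸ hGb x) (hG0 x)
    simp only [this, integral_zero, Real.zero_rpow ht0.ne', mul_zero]
    exact integral_nonneg hH0
  set c := a ^ (1 - t) * b ^ t with hc
  have hc0 : 0 < c := mul_pos (Real.rpow_pos_of_pos ha0 _) (Real.rpow_pos_of_pos hb0 _)
  have main := integral_add_integral_le_of_sup_one (F := fun x => F x / a) (G := fun x => G x / b)
    (H := fun x => H x / c) ht0 ht1 (hFm.div_const a) (hGm.div_const b) (hFi.div_const a)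
    (hGi.div_const b) (hHi.div_const c) (fun x => div_nonneg (hF0 x) ha0.le)
    (fun x => div_nonneg (hG0 x) hb0.le) (fun x => div_nonneg (hH0 x) hc0.le)
    (fun x => (div_le_one ha0).2 (hFa x)) (fun x => (div_le_one hb0).2 (hGb x))
    (fun r hr => by
      obtain ⟨x, hx⟩ := exists_lt_of_lt_ciSup (show r * a < ⨆ x, F x by nlinarith)
      exact ⟨x, (lt_div_iff₀ ha0).2 hx⟩)
    (fun r hr => by
      obtain ⟨x, hx⟩ := exists_lt_of_lt_ciSup (show r * b < ⨆ x, G x by nlinarith)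
      exact ⟨x, (lt_div_iff₀ hb0).2 hx⟩)
    (fun x y => by
      rw [Real.div_rpow (hF0 x) ha0.le, Real.div_rpow (hG0 y) hb0.le, div_mul_div_comm]
      exact div_le_div_of_nonneg_right (h x y) hc0.le)
  rw [integral_div, integral_div, integral_div] at main
  have hI : 0 ≤ ∫ x, F x := integral_nonneg hF0
  have hJ : 0 ≤ ∫ x, G x := integral_nonneg hG0
  have amgm := Real.geom_mean_le_arith_mean2_weighted ht1'.le ht0.le (div_nonneg hI ha0.le)
    (div_nonneg hJ hb0.le) (by ring)
  have := amgm.trans main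
  rwa [Real.div_rpow hI ha0.le, Real.div_rpow hJ hb0.le, div_mul_div_comm,
    div_le_div_iff_of_pos_right hc0] at this

/-- The Gaussian density is log-concave. -/
theorem gaussianPDFReal_rpow_mul_rpow_le {t : ℝ} (ht0 : 0 < t) (ht1 : t < 1) (x y : ℝ) :
    gaussianPDFReal 0 1 x ^ (1 - t) * gaussianPDFReal 0 1 y ^ t ≤
      gaussianPDFReal 0 1 ((1 - t) * x + t * y) := by
  have hc : 0 < (√(2 * Real.pi * ((1 : ℝ≥0) : ℝ)))⁻¹ := by
    have := Real.pi_pos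
    simp; positivity
  simp only [gaussianPDFReal]
  rw [Real.mul_rpow hc.le (Real.exp_pos _).le, Real.mul_rpow hc.le (Real.exp_pos _).le,
    ← Real.exp_mul, ← Real.exp_mul, mul_mul_mul_comm, ← Real.rpow_add hc, sub_add_cancel,
    Real.rpow_one, ← Real.exp_add]
  gcongr
  simp only [NNReal.coe_one, sub_zero, mul_one]
  nlinarith [mul_nonneg (mul_nonneg ht0.le (sub_nonneg.2 ht1.le)) (sq_nonneg (x - y))]

theorem integrable_of_mem_unitInterval {α : Type*} [MeasurableSpace α] {μ : Measure α}
    [IsFiniteMeasure μ] {F : α → ℝ} (hFm : Measurable F) (hF0 : ∀ x, 0 ≤ F x) (hF1 : ∀ x, F x ≤ 1) :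
    Integrable F μ :=
  Integrable.of_bound hFm.aestronglyMeasurable 1 (ae_of_all _ fun x => by
    rw [Real.norm_eq_abs, abs_of_nonneg (hF0 x)]; exact hF1 x)

/-- The Prékopa-Leindler inequality for the standard Gaussian measure on the line. -/
theorem gaussianReal_integral_rpow_mul_le {F G H : ℝ → ℝ} {t : ℝ} (ht0 : 0 < t) (ht1 : t < 1)
    (hFm : Measurable F) (hGm : Measurable G) (hHm : Measurable H) (hF0 : ∀ x, 0 ≤ F x)
    (hG0 : ∀ x, 0 ≤ G x) (hH0 : ∀ x, 0 ≤ H x) (hF1 : ∀ x, F x ≤ 1) (hG1 : ∀ x, G x ≤ 1)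
    (hH1 : ∀ x, H x ≤ 1)
    (h : ∀ x y, F x ^ (1 - t) * G y ^ t ≤ H ((1 - t) * x + t * y)) :
    (∫ x, F x ∂gaussianReal 0 1) ^ (1 - t) * (∫ x, G x ∂gaussianReal 0 1) ^ t ≤
      ∫ x, H x ∂gaussianReal 0 1 := by
  simp only [integral_gaussianReal_eq_integral_smul one_ne_zero, smul_eq_mul]
  set p := gaussianPDFReal 0 1 with hp
  have hp0 : ∀ x, 0 ≤ p x := gaussianPDFReal_nonneg 0 1
  have hpm : Measurable p := measurable_gaussianPDFReal 0 1
  have hpi : Integrable p := integrable_gaussianPDFReal 0 1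
  have hpM : ∀ x, p x ≤ (√(2 * Real.pi * ((1 : ℝ≥0) : ℝ)))⁻¹ := fun x => by
    rw [hp, gaussianPDFReal]
    refine mul_le_of_le_one_right (by positivity) (Real.exp_le_one_iff.2 ?_)
    rw [neg_div]
    exact neg_nonpos.2 (by positivity)
  have hint : ∀ {f : ℝ → ℝ}, Measurable f → (∀ x, 0 ≤ f x) → (∀ x, f x ≤ 1) →
      Integrable fun x => p x * f x := fun hfm hf0 hf1 => by
    refine hpi.mono' (hpm.mul hfm).aestronglyMeasurable (ae_of_all _ fun x => ?_)
    rw [Real.norm_eq_abs, abs_of_nonneg (mul_nonneg (hp0 x) (hf0 x))]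
    exact mul_le_of_le_one_right (hp0 x) (hf1 x)
  refine integral_rpow_mul_integral_rpow_le ht0 ht1 (hpm.mul hFm) (hpm.mul hGm)
    (hint hFm hF0 hF1) (hint hGm hG0 hG1) (hint hHm hH0 hH1) (fun x => mul_nonneg (hp0 x) (hF0 x))
    (fun x => mul_nonneg (hp0 x) (hG0 x)) (fun x => mul_nonneg (hp0 x) (hH0 x))
    (fun x => (mul_le_of_le_one_right (hp0 x) (hF1 x)).trans (hpM x))
    (fun x => (mul_le_of_le_one_right (hp0 x) (hG1 x)).trans (hpM x)) fun x y => ?_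
  rw [Real.mul_rpow (hp0 x) (hF0 x), Real.mul_rpow (hp0 y) (hG0 y), mul_mul_mul_comm]
  exact mul_le_mul (gaussianPDFReal_rpow_mul_rpow_le ht0 ht1 x y) (h x y)
    (mul_nonneg (Real.rpow_nonneg (hF0 x) _) (Real.rpow_nonneg (hG0 y) _)) (hp0 _)

theorem measurable_cons {m : ℕ} :
    Measurable fun z : ℝ × (Fin m → ℝ) => (Fin.cons z.1 z.2 : Fin (m + 1) → ℝ) :=
  measurable_pi_iff.2 fun i => by
    refine Fin.cases ?_ (fun j => ?_) i
    · simpa using measurable_fst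
    · exact (measurable_pi_apply j).comp measurable_snd

theorem measurable_cons_left {m : ℕ} (s : ℝ) :
    Measurable fun y : Fin m → ℝ => (Fin.cons s y : Fin (m + 1) → ℝ) :=
  measurable_cons.comp measurable_prodMk_left

theorem integral_pi_gaussian_succ {m : ℕ} {F : (Fin (m + 1) → ℝ) → ℝ} (hFm : Measurable F)
    (hF0 : ∀ x, 0 ≤ F x) (hF1 : ∀ x, F x ≤ 1) :
    ∫ x, F x ∂Measure.pi (fun _ : Fin (m + 1) => gaussianReal 0 1) =
      ∫ s, ∫ y, F (Fin.cons s y) ∂Measure.pi (fun _ : Fin m => gaussianReal 0 1)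
        ∂gaussianReal 0 1 := by
  have hcons := hFm.comp (measurable_cons (m := m))
  rw [← (measurePreserving_piFinSuccAbove (fun _ : Fin (m + 1) => gaussianReal 0 1)
    0).symm.integral_comp']
  have hsymm : ∀ z : ℝ × (Fin m → ℝ), (MeasurableEquiv.piFinSuccAbove (fun _ => ℝ) 0).symm z =
      Fin.cons z.1 z.2 := fun z => by
    ext i; refine Fin.cases ?_ (fun j => ?_) i <;> simp [MeasurableEquiv.piFinSuccAbove]
  simp only [hsymm]
  exact integral_prod _ (integrable_of_mem_unitInterval hcons (fun z => hF0 _) (fun z => hF1 _))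

theorem measurable_integral_cons {m : ℕ} {F : (Fin (m + 1) → ℝ) → ℝ} (hFm : Measurable F) :
    Measurable fun s : ℝ =>
      ∫ y, F (Fin.cons s y) ∂Measure.pi (fun _ : Fin m => gaussianReal 0 1) := by
  have hcons := hFm.comp (measurable_cons (m := m))
  exact (StronglyMeasurable.integral_prod_right' hcons.stronglyMeasurable).measurable

theorem integral_mem_unitInterval {α : Type*} [MeasurableSpace α] {μ : Measure α}
    [IsProbabilityMeasure μ] {F : α → ℝ} (hFm : Measurable F) (hF0 : ∀ x, 0 ≤ F x)
    (hF1 : ∀ x, F x ≤ 1) : 0 ≤ ∫ x, F x ∂μ ∧ ∫ x, F x ∂μ ≤ 1 := by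
  refine ⟨integral_nonneg hF0, ?_⟩
  have := integral_mono (integrable_of_mem_unitInterval (μ := μ) hFm hF0 hF1)
    (integrable_const (1 : ℝ)) hF1
  simpa using this

/-- The **Prékopa-Leindler inequality** for the standard Gaussian measure on `ℝᵐ`. -/
theorem pi_gaussian_integral_rpow_mul_le {m : ℕ} {F G H : (Fin m → ℝ) → ℝ} {t : ℝ} (ht0 : 0 < t)
    (ht1 : t < 1) (hFm : Measurable F) (hGm : Measurable G) (hHm : Measurable H)
    (hF0 : ∀ x, 0 ≤ F x) (hG0 : ∀ x, 0 ≤ G x) (hH0 : ∀ x, 0 ≤ H x) (hF1 : ∀ x, F x ≤ 1)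
    (hG1 : ∀ x, G x ≤ 1) (hH1 : ∀ x, H x ≤ 1)
    (h : ∀ x y, F x ^ (1 - t) * G y ^ t ≤ H ((1 - t) • x + t • y)) :
    (∫ x, F x ∂Measure.pi (fun _ : Fin m => gaussianReal 0 1)) ^ (1 - t) *
        (∫ x, G x ∂Measure.pi (fun _ : Fin m => gaussianReal 0 1)) ^ t ≤
      ∫ x, H x ∂Measure.pi (fun _ : Fin m => gaussianReal 0 1) := by
  induction m with
  | zero =>
    have hc : ∀ (f : (Fin 0 → ℝ) → ℝ),
        ∫ x, f x ∂Measure.pi (fun _ : Fin 0 => gaussianReal 0 1) = f 0 := fun f => by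
      have : f = fun _ => f 0 := funext fun x => congrArg f (Subsingleton.elim _ _)
      rw [this]; simp
    rw [hc, hc, hc]
    exact (h 0 0).trans (le_of_eq (congrArg H (Subsingleton.elim _ _)))
  | succ m ih =>
    rw [integral_pi_gaussian_succ hFm hF0 hF1, integral_pi_gaussian_succ hGm hG0 hG1,
      integral_pi_gaussian_succ hHm hH0 hH1]
    have hmem : ∀ {f : (Fin (m + 1) → ℝ) → ℝ}, Measurable f → (∀ x, 0 ≤ f x) → (∀ x, f x ≤ 1) →
        ∀ s, 0 ≤ ∫ y, f (Fin.cons s y) ∂Measure.pi (fun _ : Fin m => gaussianReal 0 1) ∧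
          ∫ y, f (Fin.cons s y) ∂Measure.pi (fun _ : Fin m => gaussianReal 0 1) ≤ 1 :=
      fun hfm hf0 hf1 s => integral_mem_unitInterval (hfm.comp (measurable_cons_left s))
        (fun y => hf0 _) (fun y => hf1 _)
    refine gaussianReal_integral_rpow_mul_le ht0 ht1 (measurable_integral_cons hFm)
      (measurable_integral_cons hGm) (measurable_integral_cons hHm)
      (fun s => (hmem hFm hF0 hF1 s).1) (fun s => (hmem hGm hG0 hG1 s).1)
      (fun s => (hmem hHm hH0 hH1 s).1) (fun s => (hmem hFm hF0 hF1 s).2)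
      (fun s => (hmem hGm hG0 hG1 s).2) (fun s => (hmem hHm hH0 hH1 s).2) fun x y => ?_
    refine ih (hFm.comp (measurable_cons_left x)) (hGm.comp (measurable_cons_left y))
      (hHm.comp (measurable_cons_left _)) (fun _ => hF0 _) (fun _ => hG0 _) (fun _ => hH0 _)
      (fun _ => hF1 _) (fun _ => hG1 _) (fun _ => hH1 _) fun u v => ?_
    refine (h (Fin.cons x u) (Fin.cons y v)).trans (le_of_eq (congrArg H ?_))
    ext i
    refine Fin.cases ?_ (fun j => ?_) i <;> simp

/-- A symmetric convex set and a symmetric slab around a coordinate hyperplane are positively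
correlated under the standard Gaussian measure: by the Prékopa-Leindler inequality the measure of
the section at height `s` is log-concave and even in `s`, hence decreasing in `|s|`. -/
theorem pi_gaussian_inter_coord_slab {m : ℕ} {D : Set (Fin (m + 1) → ℝ)} (hD : MeasurableSet D)
    (hconv : Convex ℝ D) (hsymm : ∀ x ∈ D, -x ∈ D) (r : ℝ) :
    (Measure.pi (fun _ : Fin (m + 1) => gaussianReal 0 1)).real D *
        (gaussianReal 0 1).real {s | |s| < r} ≤
      (Measure.pi (fun _ : Fin (m + 1) => gaussianReal 0 1)).real (D ∩ {x | |x 0| < r}) := by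
  rcases le_or_gt r 0 with hr | hr
  · have : {s : ℝ | |s| < r} = ∅ := by
      ext s; simpa using hr.trans (abs_nonneg s)
    simp [this]
  have h01 : ∀ (S : Set (Fin (m + 1) → ℝ)) x, 0 ≤ S.indicator (1 : (Fin (m + 1) → ℝ) → ℝ) x ∧
      S.indicator (1 : (Fin (m + 1) → ℝ) → ℝ) x ≤ 1 := fun S x => by
    by_cases hx : x ∈ S <;> simp [hx]
  have hmeas : ∀ S : Set (Fin (m + 1) → ℝ), MeasurableSet S →
      Measurable (S.indicator (1 : (Fin (m + 1) → ℝ) → ℝ)) := fun S hS =>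
    measurable_one.indicator hS
  set γ := gaussianReal 0 1 with hγ
  set ν := Measure.pi (fun _ : Fin m => γ) with hν
  set ψ : ℝ → ℝ := fun s => ∫ y, D.indicator (1 : (Fin (m + 1) → ℝ) → ℝ) (Fin.cons s y) ∂ν with hψ
  have hψm : Measurable ψ := measurable_integral_cons (hmeas D hD)
  have hψ01 : ∀ s, 0 ≤ ψ s ∧ ψ s ≤ 1 := fun s =>
    integral_mem_unitInterval ((hmeas D hD).comp (measurable_cons_left s)) (fun y => (h01 D _).1)
      (fun y => (h01 D _).2)
  have hψeven : ∀ s, ψ (-s) = ψ s := by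
    intro s
    have hmp : MeasurePreserving (fun y : Fin m → ℝ => fun i => -y i) ν ν :=
      measurePreserving_pi _ _ fun i => ⟨measurable_neg, by rw [hγ, gaussianReal_map_neg, neg_zero]⟩
    have he : MeasurableEmbedding (fun y : Fin m → ℝ => fun i => -y i) :=
      (MeasurableEquiv.neg (Fin m → ℝ)).measurableEmbedding
    rw [hψ]
    simp only
    rw [← hmp.integral_comp he]
    congr 1; ext y
    have : (Fin.cons (-s) (fun i => -y i) : Fin (m + 1) → ℝ) = -Fin.cons s y := by
      ext i; refine Fin.cases ?_ (fun j => ?_) i <;> simp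
    rw [this]
    by_cases hm : (Fin.cons s y : Fin (m + 1) → ℝ) ∈ D
    · rw [Set.indicator_of_mem hm, Set.indicator_of_mem (hsymm _ hm)]; rfl
    · rw [Set.indicator_of_notMem hm,
        Set.indicator_of_notMem fun h => hm (by simpa using hsymm _ h)]
  have hψlc : ∀ t, 0 < t → t < 1 → ∀ x y, ψ x ^ (1 - t) * ψ y ^ t ≤ ψ ((1 - t) * x + t * y) := by
    intro t ht0 ht1 x y
    refine pi_gaussian_integral_rpow_mul_le ht0 ht1 ((hmeas D hD).comp (measurable_cons_left x))
      ((hmeas D hD).comp (measurable_cons_left y)) ((hmeas D hD).comp (measurable_cons_left _))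
      (fun _ => (h01 D _).1) (fun _ => (h01 D _).1) (fun _ => (h01 D _).1) (fun _ => (h01 D _).2)
      (fun _ => (h01 D _).2) (fun _ => (h01 D _).2) fun u v => ?_
    by_cases hu : (Fin.cons x u : Fin (m + 1) → ℝ) ∈ D
    · by_cases hv : (Fin.cons y v : Fin (m + 1) → ℝ) ∈ D
      · have : (Fin.cons ((1 - t) * x + t * y) ((1 - t) • u + t • v) : Fin (m + 1) → ℝ) =
            (1 - t) • Fin.cons x u + t • Fin.cons y v := by
          ext i; refine Fin.cases ?_ (fun j => ?_) i <;> simp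
        have hm := hconv hu hv (by linarith) ht0.le (sub_add_cancel 1 t)
        rw [this, Set.indicator_of_mem hm, Set.indicator_of_mem hu, Set.indicator_of_mem hv]
        simp
      · rw [Set.indicator_of_notMem hv, Real.zero_rpow ht0.ne', mul_zero]
        exact (h01 D _).1
    · rw [Set.indicator_of_notMem hu, Real.zero_rpow (by linarith), zero_mul]
      exact (h01 D _).1
  -- `s` is a convex combination of `-s'` and `s'`, where `ψ` takes the same value
  have hψanti : ∀ {s s' : ℝ}, |s| < s' → ψ s' ≤ ψ s := by
    intro s s' hs
    obtain ⟨h1, h2⟩ := abs_lt.1 hs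
    have hs' : 0 < s' := by linarith
    have := hψlc ((s + s') / (2 * s')) (div_pos (by linarith) (by linarith))
      ((div_lt_one (by linarith)).2 (by linarith)) (-s') s'
    rw [hψeven] at this
    have e : (1 - (s + s') / (2 * s')) * -s' + (s + s') / (2 * s') * s' = s := by
      field_simp; ring
    rw [e] at this
    refine le_trans (le_of_eq ?_) this
    rcases (hψ01 s').1.eq_or_lt with h0 | h0
    · rw [← h0, Real.zero_rpow, zero_mul]
      have := (div_lt_one (show 0 < 2 * s' by linarith)).2 (show s + s' < 2 * s' by linarith)
      linarith
    · rw [← Real.rpow_add h0, sub_add_cancel, Real.rpow_one]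
  -- both measures are integrals of the section function
  have hslabm : MeasurableSet {s : ℝ | |s| < r} := measurableSet_lt (by fun_prop) measurable_const
  have hcs : MeasurableSet {x : Fin (m + 1) → ℝ | |x 0| < r} :=
    measurableSet_lt (by fun_prop) measurable_const
  have e1 : (Measure.pi (fun _ : Fin (m + 1) => γ)).real D = ∫ s, ψ s ∂γ := by
    rw [← integral_indicator_one hD, hγ, integral_pi_gaussian_succ (hmeas D hD)
      (fun x => (h01 D x).1) (fun x => (h01 D x).2)]
  have e2 : (Measure.pi (fun _ : Fin (m + 1) => γ)).real (D ∩ {x | |x 0| < r}) =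
      ∫ s in {s : ℝ | |s| < r}, ψ s ∂γ := by
    rw [← integral_indicator_one (hD.inter hcs), hγ, integral_pi_gaussian_succ
      (hmeas _ (hD.inter hcs)) (fun x => (h01 _ x).1) (fun x => (h01 _ x).2),
      ← integral_indicator hslabm]
    congr 1; ext s
    by_cases hs : |s| < r
    · rw [Set.indicator_of_mem (show s ∈ {s : ℝ | |s| < r} from hs), hψ]
      simp only
      congr 1; ext y
      by_cases hm : (Fin.cons s y : Fin (m + 1) → ℝ) ∈ D
      · rw [Set.indicator_of_mem hm, Set.indicator_of_mem]; exact ⟨hm, by simpa using hs⟩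
      · rw [Set.indicator_of_notMem hm, Set.indicator_of_notMem fun h => hm h.1]
    · rw [Set.indicator_of_notMem (show s ∉ {s : ℝ | |s| < r} from hs)]
      refine integral_eq_zero_of_ae (ae_of_all _ fun y => ?_)
      have hn : (Fin.cons s y : Fin (m + 1) → ℝ) ∉ D ∩ {x | |x 0| < r} := fun h =>
        hs (by simpa using h.2)
      simp [Set.indicator_of_notMem hn]
  rw [e1, e2]
  have hψi : Integrable ψ γ := integrable_of_mem_unitInterval hψm (fun s => (hψ01 s).1)
    (fun s => (hψ01 s).2)
  -- `ψ ≥ ψ r` on the slab and `ψ ≤ ψ r` off it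
  set I := ∫ s in {s : ℝ | |s| < r}, ψ s ∂γ with hI
  set J := ∫ s in {s : ℝ | |s| < r}ᶜ, ψ s ∂γ with hJ
  have hsum : I + J = ∫ s, ψ s ∂γ := integral_add_compl hslabm hψi
  set p := γ.real {s : ℝ | |s| < r} with hp
  have hpc : γ.real {s : ℝ | |s| < r}ᶜ = 1 - p := probReal_compl_eq_one_sub hslabm
  have hlow : ψ r * p ≤ I := by
    have : ∫ _ in {s : ℝ | |s| < r}, ψ r ∂γ ≤ I :=
      setIntegral_mono_on (integrable_const _).integrableOn hψi.integrableOn hslabm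
        fun s hs => hψanti hs
    simpa [mul_comm] using this
  have hup : J ≤ ψ r * (1 - p) := by
    have : J ≤ ∫ _ in {s : ℝ | |s| < r}ᶜ, ψ r ∂γ := by
      refine setIntegral_mono_on hψi.integrableOn (integrable_const _).integrableOn hslabm.compl
        fun s hs => ?_
      have hs : r ≤ |s| := not_lt.1 hs
      have habs : ψ |s| = ψ s := by
        rcases abs_choice s with h | h <;> rw [h]
        exact hψeven s
      rw [← habs]
      rcases hs.eq_or_lt with h | h
      · rw [h]
      · exact hψanti (by rwa [abs_of_pos hr])
    simpa [hpc, mul_comm] using this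
  have hp0 : 0 ≤ p := measureReal_nonneg
  have hp1 : p ≤ 1 := measureReal_le_one
  rw [← hsum]
  nlinarith

/-! ### Šidák's inequality and the Gaussian tail -/

section sidak

variable {E : Type*} [NormedAddCommGroup E] [InnerProductSpace ℝ E] [FiniteDimensional ℝ E]
  [MeasurableSpace E] [BorelSpace E]

/-- Coordinates in which the unit vector `a` is the first basis vector. -/
theorem exists_gaussian_coords {a : E} (ha : ‖a‖ = 1) :
    ∃ (m : ℕ) (φ : (Fin (m + 1) → ℝ) →L[ℝ] E),
      (Measure.pi fun _ : Fin (m + 1) => gaussianReal 0 1).map φ = stdGaussian E ∧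
      ∀ x, inner ℝ a (φ x) = x 0 := by
  have hane : a ≠ 0 := by rintro rfl; simp at ha
  have : Nontrivial E := ⟨a, 0, hane⟩
  obtain ⟨m, hm⟩ := Nat.exists_eq_succ_of_ne_zero (Module.finrank_pos (R := ℝ) (M := E)).ne'
  have hm' : Module.finrank ℝ E = Fintype.card (Fin (m + 1)) := by simpa using hm
  obtain ⟨b, hb⟩ := Orthonormal.exists_orthonormalBasis_extension_of_card_eq (𝕜 := ℝ) hm'
    (v := fun _ => a) (s := {0}) (by
      constructor
      · rintro ⟨i, hi⟩; simpa using ha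
      · rintro ⟨i, hi⟩ ⟨j, hj⟩ hij
        exact absurd (Subtype.ext ((Set.mem_singleton_iff.1 hi).trans
          (Set.mem_singleton_iff.1 hj).symm)) hij)
  have hb0 : b 0 = a := hb 0 rfl
  refine ⟨m, ∑ i, (ContinuousLinearMap.proj (R := ℝ) i).smulRight (b i), ?_, fun x => ?_⟩
  · rw [stdGaussian_eq_map_pi_orthonormalBasis b]
    congr 1; ext x; simp
  · rw [← hb0]
    simp [inner_sum, inner_smul_right, orthonormal_iff_ite.1 b.orthonormal]

theorem measurableSet_slab (a : E) (r : ℝ) : MeasurableSet {x : E | |inner ℝ a x| < r} :=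
  measurableSet_lt (by fun_prop) measurable_const

/-- The standard Gaussian measure of a slab orthogonal to a unit vector does not depend on the
vector. -/
theorem stdGaussian_slab {a : E} (ha : ‖a‖ = 1) (r : ℝ) :
    (stdGaussian E).real {x | |inner ℝ a x| < r} = (gaussianReal 0 1).real {s | |s| < r} := by
  obtain ⟨m, φ, hφ, hφ0⟩ := exists_gaussian_coords ha
  rw [← hφ, map_measureReal_apply φ.continuous.measurable (measurableSet_slab a r)]
  have hmp := measurePreserving_eval (fun _ : Fin (m + 1) => gaussianReal 0 1) 0
  have := hmp.measureReal_preimage (s := {s : ℝ | |s| < r})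
    (measurableSet_lt (by fun_prop) measurable_const).nullMeasurableSet
  rw [← this]
  congr 1; ext x
  simp [hφ0]

theorem stdGaussian_inter_slab_of_norm_eq_one {a : E} (ha : ‖a‖ = 1) {C : Set E}
    (hC : MeasurableSet C) (hconv : Convex ℝ C) (hsymm : ∀ x ∈ C, -x ∈ C) (r : ℝ) :
    (stdGaussian E).real C * (stdGaussian E).real {x | |inner ℝ a x| < r} ≤
      (stdGaussian E).real (C ∩ {x | |inner ℝ a x| < r}) := by
  rw [stdGaussian_slab ha]
  obtain ⟨m, φ, hφ, hφ0⟩ := exists_gaussian_coords ha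
  have hφm := φ.continuous.measurable
  rw [← hφ, map_measureReal_apply hφm hC,
    map_measureReal_apply hφm (hC.inter (measurableSet_slab a r))]
  convert pi_gaussian_inter_coord_slab (D := φ ⁻¹' C) (hφm hC)
    (hconv.linear_preimage φ.toLinearMap) (fun x hx => by
      simpa using hsymm _ hx) r using 2
  ext x
  simp [hφ0]

/-- The Gaussian correlation inequality for a symmetric convex set and a symmetric slab. -/
theorem stdGaussian_inter_slab (a : E) {C : Set E}
    (hC : MeasurableSet C) (hconv : Convex ℝ C) (hsymm : ∀ x ∈ C, -x ∈ C) (r : ℝ) :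
    (stdGaussian E).real C * (stdGaussian E).real {x | |inner ℝ a x| < r} ≤
      (stdGaussian E).real (C ∩ {x | |inner ℝ a x| < r}) := by
  by_cases ha : a = 0
  · by_cases hr : 0 < r <;> simp [ha, hr]
  have hn : 0 < ‖a‖ := norm_pos_iff.2 ha
  have he : {x : E | |inner ℝ a x| < r} = {x | |inner ℝ (‖a‖⁻¹ • a) x| < r / ‖a‖} := by
    ext x
    simp only [Set.mem_ofPred_eq, real_inner_smul_left, abs_mul, abs_inv, abs_norm]
    rw [lt_div_iff₀ hn]
    field_simp
  rw [he]
  exact stdGaussian_inter_slab_of_norm_eq_one (by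
    rw [norm_smul, norm_inv, norm_norm, inv_mul_cancel₀ hn.ne']) hC hconv hsymm _

/-- **Šidák's inequality**: centred Gaussian events `|⟪a j, x⟫| < r j` are positively correlated. -/
theorem sidak_stdGaussian {J : Type*} (s : Finset J) (a : J → E) (r : J → ℝ) :
    ∏ j ∈ s, (stdGaussian E).real {x | |inner ℝ (a j) x| < r j} ≤
      (stdGaussian E).real {x | ∀ j ∈ s, |inner ℝ (a j) x| < r j} := by
  classical
  induction s using Finset.induction_on with
  | empty => simp
  | insert j s hj ih =>
    have hset : {x : E | ∀ i ∈ insert j s, |inner ℝ (a i) x| < r i} =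
        {x | ∀ i ∈ s, |inner ℝ (a i) x| < r i} ∩ {x | |inner ℝ (a j) x| < r j} := by
      ext x; simp [and_comm]
    have hinter : {x : E | ∀ i ∈ s, |inner ℝ (a i) x| < r i} =
        ⋂ i ∈ s, {x | |inner ℝ (a i) x| < r i} := by
      ext x; simp
    rw [Finset.prod_insert hj, hset, mul_comm]
    refine (mul_le_mul_of_nonneg_right ih measureReal_nonneg).trans
      (stdGaussian_inter_slab (a j) ?_ ?_ ?_ (r j))
    · rw [hinter]
      exact Finset.measurableSet_biInter s fun i _ => measurableSet_slab (a i) (r i)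
    · rw [hinter]
      refine convex_iInter₂ fun i _ => ?_
      have : {x : E | |inner ℝ (a i) x| < r i} = (innerₗ E (a i)) ⁻¹' Set.Ioo (-r i) (r i) := by
        ext x; simp [abs_lt]
      rw [this]
      exact (convex_Ioo _ _).linear_preimage _
    · intro x hx i hi
      simpa using hx i hi

end sidak

/-- The Gaussian tail bound `P(|Z| ≥ r) ≤ exp (-r² / 2)`, without the factor `2` of the Chernoff
bound. -/
theorem one_sub_exp_le_gaussianReal {r : ℝ} (hr : 0 ≤ r) :
    1 - Real.exp (-(r ^ 2 / 2)) ≤ (gaussianReal 0 1).real {s | |s| < r} := by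
  set p := gaussianPDFReal 0 1 with hp
  have hpi : Integrable p := integrable_gaussianPDFReal 0 1
  have hp1 : ∫ x, p x = 1 := integral_gaussianPDFReal_eq_one 0 one_ne_zero
  have hp0 : ∀ x, 0 ≤ p x := gaussianPDFReal_nonneg 0 1
  have heven : ∀ x, p (-x) = p x := fun x => by simp [hp, gaussianPDFReal]
  have hhalf : ∫ x in Set.Ioi 0, p x = 1 / 2 := by
    have h1 : ∫ x in Set.Iic 0, p x = ∫ x in Set.Ioi 0, p x := by
      have := integral_comp_neg_Iic 0 p
      simp only [heven, neg_zero] at this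
      exact this
    have h2 := integral_add_compl (measurableSet_Iic (a := (0 : ℝ))) hpi
    rw [Set.compl_Iic, hp1, h1] at h2
    linarith
  have htail : ∫ x in Set.Ici r, p x ≤ Real.exp (-(r ^ 2 / 2)) * (1 / 2) := by
    rw [integral_Ici_eq_integral_Ioi, ← hhalf, ← integral_const_mul]
    have hshift : ∫ x in Set.Ioi r, p x = ∫ x in Set.Ioi 0, p (x + r) := by
      have := (measurePreserving_add_right volume r).setIntegral_preimage_emb
        (MeasurableEquiv.addRight r).measurableEmbedding p (Set.Ioi r)
      simpa using this.symm
    rw [hshift]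
    -- the density satisfies `p (x + r) ≤ exp (-r² / 2) p x` for `x ≥ 0`
    refine setIntegral_mono_on (hpi.comp_add_right r).integrableOn
      (hpi.const_mul _).integrableOn measurableSet_Ioi fun x hx => ?_
    simp only [hp, gaussianPDFReal]
    rw [mul_left_comm, ← Real.exp_add]
    gcongr
    have : 0 < x := hx
    simp only [NNReal.coe_one, sub_zero, mul_one]
    nlinarith [mul_nonneg this.le hr]
  have hsplit : {s : ℝ | |s| < r}ᶜ ⊆ Set.Iic (-r) ∪ Set.Ici r := by
    intro s hs
    have hs : r ≤ |s| := not_lt.1 hs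
    rcases le_abs.1 hs with h | h
    · exact Or.inr h
    · exact Or.inl (by rw [Set.mem_Iic]; linarith)
  have hm : MeasurableSet {s : ℝ | |s| < r} := measurableSet_lt (by fun_prop) measurable_const
  have hreal : ∀ S : Set ℝ, (gaussianReal 0 1).real S = ∫ x in S, p x := fun S => by
    rw [measureReal_def, gaussianReal_apply_eq_integral 0 one_ne_zero, ENNReal.toReal_ofReal]
    exact integral_nonneg hp0
  have hleft : (gaussianReal 0 1).real (Set.Iic (-r)) = (gaussianReal 0 1).real (Set.Ici r) := by
    rw [hreal, hreal, integral_Ici_eq_integral_Ioi]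
    have := integral_comp_neg_Iic (-r) p
    simpa only [heven, neg_neg] using this
  have hc : (gaussianReal 0 1).real {s : ℝ | |s| < r}ᶜ ≤ Real.exp (-(r ^ 2 / 2)) := by
    refine (measureReal_mono hsplit).trans ((measureReal_union_le _ _).trans ?_)
    rw [hleft, hreal]
    linarith
  rw [probReal_compl_eq_one_sub hm] at hc
  linarith

/-- Lower bound for the joint probability of finitely many linear events in i.i.d. standard Gaussian
variables, in terms of bounds `v j` for the variances. -/
theorem prod_one_sub_exp_le_pi_gaussian {ι J : Type*} [Fintype ι] (s : Finset J) (a : J → ι → ℝ)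
    (r v : J → ℝ) (hr : ∀ j ∈ s, 0 < r j) (hv : ∀ j ∈ s, ∑ i, a j i ^ 2 ≤ v j)
    (hv0 : ∀ j ∈ s, 0 < v j) :
    ∏ j ∈ s, (if a j = 0 then 1 else 1 - Real.exp (-(r j ^ 2 / (2 * v j)))) ≤
      (Measure.pi fun _ : ι => gaussianReal 0 1).real {x | ∀ j ∈ s, |∑ i, a j i * x i| < r j} := by
  set b : J → EuclideanSpace ℝ ι := fun j => WithLp.toLp 2 (a j) with hb
  have hinner : ∀ j (x : ι → ℝ), inner ℝ (b j) (WithLp.toLp 2 x) = ∑ i, a j i * x i := fun j x => by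
    simp [hb, PiLp.inner_apply, mul_comm]
  have hms : MeasurableSet {x : EuclideanSpace ℝ ι | ∀ j ∈ s, |inner ℝ (b j) x| < r j} := by
    have : {x : EuclideanSpace ℝ ι | ∀ j ∈ s, |inner ℝ (b j) x| < r j} =
        ⋂ j ∈ s, {x | |inner ℝ (b j) x| < r j} := by ext x; simp
    rw [this]
    exact Finset.measurableSet_biInter s fun j _ => measurableSet_slab (b j) (r j)
  have hmap : (Measure.pi fun _ : ι => gaussianReal 0 1).real
      {x | ∀ j ∈ s, |∑ i, a j i * x i| < r j} =
      (stdGaussian (EuclideanSpace ℝ ι)).real {x | ∀ j ∈ s, |inner ℝ (b j) x| < r j} := by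
    rw [← map_pi_eq_stdGaussian, map_measureReal_apply (by fun_prop) hms]
    congr 1; ext x
    simp only [Set.mem_ofPred_eq, Set.mem_preimage, hinner]
  rw [hmap]
  refine le_trans (Finset.prod_le_prod (fun j hj => ?_) fun j hj => ?_)
    (sidak_stdGaussian s b r)
  · split_ifs
    · exact zero_le_one
    · rw [sub_nonneg, Real.exp_le_one_iff, neg_nonpos]
      have := hv0 j hj
      positivity
  · split_ifs with h
    · have : b j = 0 := by rw [hb]; simp [h]
      simp [this, hr j hj]
    · have hbne : b j ≠ 0 := fun h0 => h (by simpa [hb] using h0)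
      have hn : 0 < ‖b j‖ := norm_pos_iff.2 hbne
      have hsq : ‖b j‖ ^ 2 = ∑ i, a j i ^ 2 := by
        simp [hb, EuclideanSpace.norm_sq_eq]
      have he : {x : EuclideanSpace ℝ ι | |inner ℝ (b j) x| < r j} =
          {x | |inner ℝ (‖b j‖⁻¹ • b j) x| < r j / ‖b j‖} := by
        ext x
        simp only [Set.mem_ofPred_eq, real_inner_smul_left, abs_mul, abs_inv, abs_norm]
        rw [lt_div_iff₀ hn]
        field_simp
      rw [he, stdGaussian_slab (by rw [norm_smul, norm_inv, norm_norm, inv_mul_cancel₀ hn.ne'])]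
      refine le_trans ?_ (one_sub_exp_le_gaussianReal (div_nonneg (hr j hj).le hn.le))
      have h2 : r j ^ 2 / (2 * v j) ≤ (r j / ‖b j‖) ^ 2 / 2 := by
        rw [div_pow, hsq, div_div, mul_comm _ (2 : ℝ)]
        gcongr
        · rw [← hsq]; positivity
        · exact hv j hj
      have := Real.exp_le_exp.2 (neg_le_neg h2)
      linarith

/-! ### The folds of the modulo-hysteresis operator -/

namespace ModHyst

variable {n : ℕ}

/-- The residual only takes values in `h ℤ`, since it changes in steps of `0` or `±h`. -/
theorem foldState_resid_eq (lam h B : ℝ) (g : (Fin (n + 1) → ℝ) → ℝ) (b : Fin n → ℤ) (r : ℕ)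
    (x : ℝ) : ∃ m : ℤ, (foldState lam h B g b r).resid x = h * m := by
  induction r with
  | zero => exact ⟨_, rfl⟩
  | succ r ih =>
    obtain ⟨m, hm⟩ := ih
    simp only [foldState, foldStep, hm]
    generalize sInf (foldSet lam B g b (foldState lam h B g b r)) = tau
    generalize g (Fin.cons tau fun d => B * (b d : ℝ)) - (foldState lam h B g b r).resid tau = u
    by_cases hx : x ∈ Set.Ici tau
    · rcases Real.sign_apply_eq u with hs | hs | hs <;> rw [hs, Set.indicator_of_mem hx]
      · exact ⟨m - 1, by push_cast; simp; ring⟩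
      · exact ⟨m, by simp⟩
      · exact ⟨m + 1, by push_cast; simp; ring⟩
    · exact ⟨m, by simp [Set.indicator_of_notMem hx]⟩

/-- Before the first fold the residual is the initial constant, at every stage of the recursion up
to the last one. -/
theorem foldState_resid_of_lt {lam h B : ℝ} {g : (Fin (n + 1) → ℝ) → ℝ} {b : Fin n → ℤ} {X : ℝ}
    (hX : ∀ x ∈ foldSet lam B g b (foldState lam h B g b 0), X ≤ x) {r : ℕ}
    (hr : r ≤ numFolds lam h B g b) :
    (r = 0 ∨ X ≤ (foldState lam h B g b r).time) ∧
      ∀ x < X, (foldState lam h B g b r).resid x = h * (initConst lam h B g b : ℝ) := by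
  induction r with
  | zero => exact ⟨Or.inl rfl, fun x _ => rfl⟩
  | succ r ih =>
    obtain ⟨ih1, ih2⟩ := ih (Nat.le_of_succ_le hr)
    have hne : (foldSet lam B g b (foldState lam h B g b r)).Nonempty :=
      Set.nonempty_iff_ne_empty.2 (Nat.notMem_of_lt_sInf (Nat.lt_of_succ_le hr))
    have htime : X ≤ (foldState lam h B g b (r + 1)).time := by
      refine le_csInf hne fun x hx => ?_
      rcases ih1 with rfl | ih1
      · exact hX x hx
      · exact ih1.trans hx.1.le
    refine ⟨Or.inr htime, fun x hx => ?_⟩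
    have hx' : x ∉ Set.Ici (sInf (foldSet lam B g b (foldState lam h B g b r))) :=
      fun hm => absurd (htime.trans hm) (not_le.2 hx)
    simp only [foldState, foldStep, Set.indicator_of_notMem hx', mul_zero, add_zero]
    exact ih2 x hx

/-- The first fold in a band takes at least the time in which the input can rise or fall by `h`: if
the oscillation of the input over the band is at most `2 lam - 3 h`, the folded input starts within
`lam - h` of zero. -/
theorem le_mul_of_mem_foldSet_zero {lam h B ℓ : ℝ} {g : (Fin (n + 1) → ℝ) → ℝ} {b : Fin n → ℤ}
    (hh : 0 < h) (hB : 0 < B)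
    (hbdd : ∃ M, ∀ x, |g x| ≤ M)
    (hosc : ∀ xb ∈ bandRect B b, ∀ xb' ∈ bandRect B b,
      g (Fin.cons 0 xb) - (2 * lam - 3 * h) ≤ g (Fin.cons 0 xb'))
    (hlip : ∀ x1 xb, 0 ≤ x1 → |g (Fin.cons x1 xb) - g (Fin.cons 0 xb)| ≤ ℓ * x1)
    {x : ℝ} (hx : x ∈ foldSet lam B g b (foldState lam h B g b 0)) : h ≤ ℓ * x := by
  obtain ⟨M, hM⟩ := hbdd
  have hband : (bandRect B b).Nonempty := ⟨fun d => b d * B, fun d => ⟨le_rfl, by nlinarith⟩⟩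
  obtain ⟨hx0, hsup⟩ := hx
  replace hx0 : 0 < x := hx0
  set inf := sInf ((fun xb : Fin n → ℝ => g (Fin.cons 0 xb)) '' bandRect B b) with hinf
  have hbelow : BddBelow ((fun xb : Fin n → ℝ => g (Fin.cons 0 xb)) '' bandRect B b) := by
    refine ⟨-M, ?_⟩
    rintro _ ⟨xb, -, rfl⟩
    exact (abs_le.1 (hM _)).1
  have h1 : h * ((initConst lam h B g b : ℤ) : ℝ) ≤ inf + lam - h := by
    have := Int.floor_le ((inf + lam) / h)
    rw [le_div_iff₀ hh] at this
    simp only [initConst, Int.cast_sub, Int.cast_one]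
    rw [← hinf]
    linarith
  have h2 : inf + lam - 2 * h < h * ((initConst lam h B g b : ℤ) : ℝ) := by
    have := Int.lt_floor_add_one ((inf + lam) / h)
    rw [div_lt_iff₀ hh] at this
    simp only [initConst, Int.cast_sub, Int.cast_one]
    rw [← hinf]
    linarith
  have hle : lam ≤ lam - h + ℓ * x := by
    rw [← hsup]
    refine csSup_le (hband.image _) ?_
    rintro _ ⟨xb, hxb, rfl⟩
    rw [hsup]
    obtain ⟨h3, h4⟩ := abs_le.1 (hlip x xb hx0.le)
    have h5 : inf ≤ g (Fin.cons 0 xb) := csInf_le hbelow ⟨xb, hxb, rfl⟩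
    have h6 : g (Fin.cons 0 xb) - (2 * lam - 3 * h) ≤ inf := by
      refine le_csInf (hband.image _) ?_
      rintro _ ⟨xb', hxb', rfl⟩
      exact hosc xb hxb xb' hxb'
    change |g (Fin.cons x xb) - h * ((initConst lam h B g b : ℤ) : ℝ)| ≤ _
    rw [abs_le]
    constructor <;> linarith
  linarith

section samples

variable {V : Matrix (Fin (n + 1)) (Fin (n + 1)) ℝ} {Om : Fin (n + 1) → ℝ}
  {f : EuclideanSpace ℝ (Fin (n + 1)) → ℝ}

theorem sum_le_sqrt_mul_sqrt (Om : Fin (n + 1) → ℝ) :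
    ∑ d, Om d ≤ √((n : ℝ) + 1) * √(∑ d, Om d ^ 2) := by
  rw [← Real.sqrt_mul (by positivity)]
  refine Real.le_sqrt_of_sq_le ?_
  simpa using sq_sum_le_card_mul_sum_sq (s := Finset.univ) (f := Om)

/-- The oscillation of a Paley-Wiener function over a band. -/
theorem PaleyWiener.osc_le (hV : V.det ≠ 0) (hOm : ∀ d, 0 < Om d) (hf : PaleyWiener V Om f)
    {B : ℝ} (hB : 0 < B) {b : Fin n → ℤ} {xb xb' : Fin n → ℝ} (hxb : xb ∈ bandRect B b)
    (hxb' : xb' ∈ bandRect B b) :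
    f (point V (Fin.cons 0 xb)) - f (point V (Fin.cons 0 xb')) ≤
      normInf f * B * √((n : ℝ) + 1) * √(∑ d, Om d ^ 2) := by
  have h1 := hf.abs_sub_le hV hOm (Fin.cons 0 xb') (Fin.cons 0 (xb - xb'))
  have he : (Fin.cons 0 xb' + Fin.cons 0 (xb - xb') : Fin (n + 1) → ℝ) = Fin.cons 0 xb := by
    ext i; refine Fin.cases ?_ (fun j => ?_) i <;> simp
  rw [he] at h1
  refine (le_abs_self _).trans (h1.trans ?_)
  have h2 : ∑ d, Om d * |(Fin.cons 0 (xb - xb') : Fin (n + 1) → ℝ) d| ≤ ∑ d, Om d * B := by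
    refine Finset.sum_le_sum fun d _ => mul_le_mul_of_nonneg_left ?_ (hOm d).le
    refine Fin.cases ?_ (fun j => ?_) d
    · simpa using hB.le
    · simp only [Fin.cons_succ, Pi.sub_apply, abs_le]
      have := hxb j
      have := hxb' j
      constructor <;> nlinarith
  rw [← Finset.sum_mul] at h2
  calc (∑ d, Om d * |(Fin.cons 0 (xb - xb') : Fin (n + 1) → ℝ) d|) * normInf f
      ≤ ((√((n : ℝ) + 1) * √(∑ d, Om d ^ 2)) * B) * normInf f := by
        gcongr
        · exact normInf_nonneg f
        · exact h2.trans (mul_le_mul_of_nonneg_right (sum_le_sqrt_mul_sqrt Om) hB.le)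
    _ = _ := by ring

/-- The folded input at a lattice point. The band of the point is given by the quotients of its
indices by the numbers of samples per band. -/
theorem modHyst_latticePoint (hV : V.det ≠ 0) {T : Fin (n + 1) → ℝ} (hT : ∀ d, 0 < T d)
    {lam h B : ℝ} {NB : Fin n → ℕ} (hB : 0 < B) (hNB : ∀ d, B / T d.succ = (NB d : ℝ))
    {k : Fin (n + 1) → ℤ} (hk : 0 ≤ k 0) :
    modHyst lam h B V f (latticePoint V T k) = f (latticePoint V T k) -
      (foldState lam h B (fun u => f (point V u)) (fun d => k d.succ / (NB d : ℤ))
        (numFolds lam h B (fun u => f (point V u)) (fun d => k d.succ / (NB d : ℤ)))).resid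
          (T 0 * k 0) := by
  have hinv : V⁻¹ *ᵥ (latticePoint V T k).ofLp = fun d => T d * (k d : ℝ) := by
    simp only [latticePoint, point]
    rw [Matrix.mulVec_mulVec, Matrix.nonsing_inv_mul _ (isUnit_iff_ne_zero.2 hV), Matrix.one_mulVec]
  have hband : bandOf B (Fin.tail fun d => T d * (k d : ℝ)) = fun d => k d.succ / (NB d : ℤ) := by
    ext d
    have : T d.succ * (k d.succ : ℝ) / B = (k d.succ : ℝ) / (NB d : ℝ) := by
      rw [← hNB]; field_simp
    rw [bandOf, Fin.tail, this, Int.floor_div_natCast, Int.floor_intCast]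
  rw [modHyst, hinv, modHystLattice, if_pos, modHystPos, hband]
  · rfl
  · exact mul_nonneg (hT 0).le (by exact_mod_cast hk)

/-- The samples of the folded input are those of the input up to integer multiples of `h`, which
depend on the first index and the band only, and which are known to be `initConst` for the first
`N + 1` samples. -/
theorem PaleyWiener.exists_fold_counts (hV : V.det ≠ 0) {T : Fin (n + 1) → ℝ} (hT : ∀ d, 0 < T d)
    (hOm : ∀ d, 0 < Om d) (hf : PaleyWiener V Om f) {lam h B : ℝ} (hh : 0 < h) (hB : 0 < B)
    {NB : Fin n → ℕ} (hNB : ∀ d, B / T d.succ = (NB d : ℝ)) {N : ℕ}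
    (hosc : normInf f * B * √((n : ℝ) + 1) * √(∑ d, Om d ^ 2) ≤ 2 * lam - 3 * h)
    (hsep : ((N : ℝ) + 1) * T 0 * (Om 0 * normInf f) < h) :
    ∃ E : ℤ → (Fin n → ℤ) → ℤ,
      (∀ k : Fin (n + 1) → ℤ, 0 ≤ k 0 → modHyst lam h B V f (latticePoint V T k) =
        f (latticePoint V T k) - h * (E (k 0) (fun d => k d.succ / (NB d : ℤ)) : ℝ)) ∧
      ∀ j : ℤ, j ≤ N + 1 → ∀ b, E j b = initConst lam h B (fun u => f (point V u)) b := by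
  have hF := normInf_nonneg f
  have hlip : ∀ x1 xb, 0 ≤ x1 → |f (point V (Fin.cons x1 xb)) - f (point V (Fin.cons 0 xb))| ≤
      Om 0 * normInf f * x1 := by
    intro x1 xb hx1
    have := hf.abs_sub_le hV hOm (Fin.cons 0 xb) (Fin.cons x1 0)
    have he : (Fin.cons 0 xb + Fin.cons x1 0 : Fin (n + 1) → ℝ) = Fin.cons x1 xb := by
      ext i; refine Fin.cases ?_ (fun j => ?_) i <;> simp
    rw [he, Fin.sum_univ_succ] at this
    simp only [Fin.cons_zero, Fin.cons_succ, Pi.zero_apply, abs_zero, mul_zero,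
      Finset.sum_const_zero, add_zero, abs_of_nonneg hx1] at this
    linarith
  have hfirst : ∀ b, ∀ x ∈ foldSet lam B (fun u => f (point V u)) b
      (foldState lam h B (fun u => f (point V u)) b 0), h ≤ Om 0 * normInf f * x := fun b x hx =>
    le_mul_of_mem_foldSet_zero hh hB ⟨normInf f, fun x => hf.abs_le_normInf _⟩
      (fun xb hxb xb' hxb' => by
        have := hf.osc_le hV hOm hB hxb hxb'
        linarith) hlip hx
  obtain ⟨X, hX, hXfold⟩ : ∃ X : ℝ, ((N : ℝ) + 1) * T 0 < X ∧ ∀ b, ∀ x ∈ foldSet lam B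
      (fun u => f (point V u)) b (foldState lam h B (fun u => f (point V u)) b 0), X ≤ x := by
    rcases hF.eq_or_lt with h0 | h0
    -- the zero function does not fold at all
    · refine ⟨_, lt_add_one _, fun b x hx => ?_⟩
      have := hfirst b x hx
      rw [← h0] at this
      linarith
    · have hpos := mul_pos (hOm 0) h0
      exact ⟨h / (Om 0 * normInf f), (lt_div_iff₀ hpos).2 hsep, fun b x hx => by
        rw [div_le_iff₀ hpos]; linarith [hfirst b x hx]⟩
  have hint : ∀ (j : ℤ) (b : Fin n → ℤ), ∃ m : ℤ, (foldState lam h B (fun u => f (point V u)) b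
      (numFolds lam h B (fun u => f (point V u)) b)).resid (T 0 * j) = h * m ∧
      (j ≤ N + 1 → m = initConst lam h B (fun u => f (point V u)) b) := by
    intro j b
    by_cases hj : j ≤ N + 1
    · refine ⟨_, (foldState_resid_of_lt (hXfold b) le_rfl).2 _ (lt_of_le_of_lt ?_ hX), fun _ => rfl⟩
      have : (j : ℝ) ≤ N + 1 := by exact_mod_cast hj
      nlinarith [hT 0]
    · obtain ⟨m, hm⟩ := foldState_resid_eq lam h B (fun u => f (point V u)) b
        (numFolds lam h B (fun u => f (point V u)) b) (T 0 * j)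
      exact ⟨m, hm, fun h => absurd h hj⟩
  choose E hE1 hE2 using hint
  exact ⟨E, fun k hk => by rw [modHyst_latticePoint hV hT hB hNB hk, hE1], fun j hj b => hE2 j b hj⟩

end samples

end ModHyst

/-! ### Product weights on a block -/

section productWeights

variable {ι : Type*} [Fintype ι] [DecidableEq ι]

/-- Summation over a box, one direction `d₀` first. -/
theorem sum_piFinset_prod_mul (S : ι → Finset ℤ) (p : ι → ℤ → ℝ) (G : (ι → ℤ) → ℝ) (d₀ : ι) :
    ∑ k ∈ Fintype.piFinset S, (∏ d, p d (k d)) * G k =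
      ∑ k ∈ Fintype.piFinset (Function.update S d₀ {0}), (∏ d ∈ Finset.univ.erase d₀, p d (k d)) *
        ∑ j ∈ S d₀, p d₀ j * G (Function.update k d₀ j) := by
  simp_rw [Finset.mul_sum]
  rw [← Finset.sum_product']
  symm
  refine Finset.sum_nbij' (fun z => Function.update z.1 d₀ z.2)
    (fun k => (Function.update k d₀ 0, k d₀)) ?_ ?_ ?_ ?_ ?_
  · rintro ⟨k, j⟩ hz
    simp only [Finset.mem_product, Fintype.mem_piFinset] at hz ⊢
    intro d
    rcases eq_or_ne d d₀ with rfl | hd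
    · simpa using hz.2
    · simpa [hd] using hz.1 d
  · intro k hk
    simp only [Finset.mem_product, Fintype.mem_piFinset] at hk ⊢
    refine ⟨fun d => ?_, hk d₀⟩
    rcases eq_or_ne d d₀ with rfl | hd
    · simp
    · simpa [hd] using hk d
  · rintro ⟨k, j⟩ hz
    simp only [Finset.mem_product, Fintype.mem_piFinset] at hz
    have := hz.1 d₀
    simp only [Function.update_self, Finset.mem_singleton] at this
    simp [← this]
  · intro k hk
    simp
  · rintro ⟨k, j⟩ hz
    rw [← Finset.mul_prod_erase _ _ (Finset.mem_univ d₀)]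
    simp only [Function.update_self]
    have : ∏ d ∈ Finset.univ.erase d₀, p d (Function.update k d₀ j d) =
        ∏ d ∈ Finset.univ.erase d₀, p d (k d) :=
      Finset.prod_congr rfl fun d hd => by
        rw [Function.update_of_ne (Finset.ne_of_mem_erase hd)]
    rw [this]; ring

theorem sum_piFinset_update_prod_erase (S : ι → Finset ℤ) (p : ι → ℤ → ℝ) (d₀ : ι) :
    ∑ k ∈ Fintype.piFinset (Function.update S d₀ {0}), ∏ d ∈ Finset.univ.erase d₀, p d (k d) =
      ∏ d ∈ Finset.univ.erase d₀, ∑ j ∈ S d, p d j := by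
  have h1 : ∀ k : ι → ℤ, ∏ d ∈ Finset.univ.erase d₀, p d (k d) =
      ∏ d, (Function.update p d₀ 1) d (k d) := fun k => by
    rw [← Finset.mul_prod_erase _ _ (Finset.mem_univ d₀)]
    simp only [Function.update_self, Pi.one_apply, one_mul]
    exact Finset.prod_congr rfl fun d hd => by
      rw [Function.update_of_ne (Finset.ne_of_mem_erase hd)]
  simp_rw [h1]
  rw [← Finset.prod_univ_sum, ← Finset.mul_prod_erase _ _ (Finset.mem_univ d₀)]
  simp only [Function.update_self, Finset.sum_singleton, Pi.one_apply, one_mul]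
  exact Finset.prod_congr rfl fun d hd => by
    rw [Function.update_of_ne (Finset.ne_of_mem_erase hd),
      Function.update_of_ne (Finset.ne_of_mem_erase hd)]

/-- A product weight bounds the weighted sum by what it does in one direction `d₀`, if it is of
total mass at most `1` in the others. -/
theorem abs_sum_piFinset_prod_mul_le (S : ι → Finset ℤ) (p : ι → ℤ → ℝ) (G : (ι → ℤ) → ℝ) (d₀ : ι)
    {β : ℝ} (hβ : ∀ k, |∑ j ∈ S d₀, p d₀ j * G (Function.update k d₀ j)| ≤ β)
    (hp : ∀ d ≠ d₀, ∑ j ∈ S d, |p d j| ≤ 1) :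
    |∑ k ∈ Fintype.piFinset S, (∏ d, p d (k d)) * G k| ≤ β := by
  have hβ0 : 0 ≤ β := (abs_nonneg _).trans (hβ 0)
  rw [sum_piFinset_prod_mul S p G d₀]
  calc _ ≤ ∑ k ∈ Fintype.piFinset (Function.update S d₀ {0}),
        (∏ d ∈ Finset.univ.erase d₀, |p d (k d)|) * β := by
        refine (Finset.abs_sum_le_sum_abs _ _).trans (Finset.sum_le_sum fun k _ => ?_)
        rw [abs_mul, Finset.abs_prod]
        exact mul_le_mul_of_nonneg_left (hβ k) (Finset.prod_nonneg fun _ _ => abs_nonneg _)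
    _ = (∏ d ∈ Finset.univ.erase d₀, ∑ j ∈ S d, |p d j|) * β := by
        rw [← Finset.sum_mul, sum_piFinset_update_prod_erase S (fun d j => |p d j|)]
    _ ≤ 1 * β := by
        refine mul_le_mul_of_nonneg_right ?_ hβ0
        exact Finset.prod_le_one (fun d _ => Finset.sum_nonneg fun _ _ => abs_nonneg _)
          fun d hd => hp d (Finset.ne_of_mem_erase hd)
    _ = β := one_mul β

/-- A product weight of mass `1` in the directions other than `d₀` reduces the weighted sum to the
one in direction `d₀`, if the latter is constant on the support of the weight. -/
theorem sum_piFinset_prod_mul_eq (S : ι → Finset ℤ) (p : ι → ℤ → ℝ) (G : (ι → ℤ) → ℝ) (d₀ : ι)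
    {c : ℝ} (hc : ∀ k, (∀ d ≠ d₀, p d (k d) ≠ 0) →
      ∑ j ∈ S d₀, p d₀ j * G (Function.update k d₀ j) = c)
    (hp : ∀ d ≠ d₀, ∑ j ∈ S d, p d j = 1) :
    ∑ k ∈ Fintype.piFinset S, (∏ d, p d (k d)) * G k = c := by
  rw [sum_piFinset_prod_mul S p G d₀]
  calc _ = ∑ k ∈ Fintype.piFinset (Function.update S d₀ {0}),
        (∏ d ∈ Finset.univ.erase d₀, p d (k d)) * c := by
        refine Finset.sum_congr rfl fun k _ => ?_
        by_cases hk : ∀ d ≠ d₀, p d (k d) ≠ 0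
        · rw [hc k hk]
        · push Not at hk
          obtain ⟨d, hd, h0⟩ := hk
          rw [Finset.prod_eq_zero (Finset.mem_erase.2 ⟨hd, Finset.mem_univ d⟩) h0, zero_mul,
            zero_mul]
    _ = c := by
        rw [← Finset.sum_mul, sum_piFinset_update_prod_erase,
          Finset.prod_eq_one fun d hd => hp d (Finset.ne_of_mem_erase hd), one_mul]

theorem sum_piFinset_prod_sq (S : ι → Finset ℤ) (p : ι → ℤ → ℝ) :
    ∑ k ∈ Fintype.piFinset S, (∏ d, p d (k d)) ^ 2 = ∏ d, ∑ j ∈ S d, p d j ^ 2 := by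
  rw [Finset.prod_univ_sum]
  simp_rw [← Finset.prod_pow]

end productWeights

namespace ModHyst

/-- The weights of the prediction error `y (k + 1) - ∑ i < L, c i * y (k - i)`. -/
noncomputable def predWeight (L : ℕ) (c : ℕ → ℝ) (k j : ℤ) : ℝ :=
  (if j = k + 1 then 1 else 0) - ∑ i ∈ Finset.range L, c i * (if j = k - i then 1 else 0)

/-- The weights of the mean over the `m` samples of band `b`. -/
noncomputable def avgWeight (m : ℕ) (b j : ℤ) : ℝ :=
  if j ∈ Finset.Ico (b * m) ((b + 1) * m) then (m : ℝ)⁻¹ else 0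

theorem sum_predWeight_mul {L : ℕ} {c : ℕ → ℝ} {k : ℤ} {S : Finset ℤ} (h1 : k + 1 ∈ S)
    (h2 : ∀ i < L, k - (i : ℤ) ∈ S) (G : ℤ → ℝ) :
    ∑ j ∈ S, predWeight L c k j * G j = G (k + 1) - ∑ i ∈ Finset.range L, c i * G (k - i) := by
  simp only [predWeight, sub_mul, Finset.sum_sub_distrib, Finset.sum_mul]
  rw [Finset.sum_comm]
  congr 1
  · simp [h1]
  · refine Finset.sum_congr rfl fun i hi => ?_
    simp [h2 i (Finset.mem_range.1 hi)]

theorem sum_predWeight_sq {L : ℕ} {c : ℕ → ℝ} {k : ℤ} {S : Finset ℤ} (h1 : k + 1 ∈ S)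
    (h2 : ∀ i < L, k - (i : ℤ) ∈ S) :
    ∑ j ∈ S, predWeight L c k j ^ 2 = 1 + ∑ i ∈ Finset.range L, c i ^ 2 := by
  simp_rw [sq (predWeight L c k _)]
  rw [sum_predWeight_mul h1 h2]
  have e1 : predWeight L c k (k + 1) = 1 := by
    rw [predWeight, if_pos rfl, Finset.sum_eq_zero, sub_zero]
    intro i _
    rw [if_neg (by omega), mul_zero]
  have e2 : ∀ i ∈ Finset.range L, predWeight L c k (k - i) = -c i := by
    intro i hi
    rw [predWeight, if_neg (by omega), zero_sub, Finset.sum_eq_single i]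
    · simp
    · intro j _ hj
      rw [if_neg (by omega), mul_zero]
    · intro h; exact absurd hi h
  rw [e1, Finset.sum_congr rfl fun i hi => by rw [e2 i hi]]
  simp [sq]

theorem sum_avgWeight_comp {m : ℕ} {b : ℤ} {S : Finset ℤ}
    (hS : Finset.Ico (b * m) ((b + 1) * m) ⊆ S) (φ : ℝ → ℝ) (hφ : φ 0 = 0) :
    ∑ j ∈ S, φ (avgWeight m b j) = m * φ (m : ℝ)⁻¹ := by
  have : ∀ j, φ (avgWeight m b j) =
      if j ∈ Finset.Ico (b * m) ((b + 1) * m) then φ (m : ℝ)⁻¹ else 0 := fun j => by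
    rw [avgWeight]; split_ifs <;> simp [hφ]
  simp_rw [this]
  rw [Finset.sum_ite_mem, Finset.inter_eq_right.2 hS, Finset.sum_const, nsmul_eq_mul, Int.card_Ico]
  congr 2
  have : (b + 1) * (m : ℤ) - b * m = m := by ring
  simp [this]

theorem ediv_eq_of_avgWeight_ne_zero {m : ℕ} {b j : ℤ} (h : avgWeight m b j ≠ 0) :
    j / (m : ℤ) = b := by
  rw [avgWeight] at h
  have hj := (ite_ne_right_iff.1 h).1
  rw [Finset.mem_Ico] at hj
  have hm : (0 : ℤ) < m := by nlinarith
  rw [Int.ediv_eq_iff_of_pos hm]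
  constructor <;> nlinarith [hj.1, hj.2]

/-- The range of the band indices in the block. -/
noncomputable def bands {n : ℕ} (Bmax : Fin n → ℕ) : Finset (Fin n → ℤ) :=
  Fintype.piFinset fun d => Finset.Ico 0 (Bmax d : ℤ)

open Classical in
/-- The weights of the linear statistics on which the reconstruction is based. For `Sum.inl (k, b)`
this is the error of the prediction of the mean over band `b` at time `k + 1` from the means at the
`L` preceding times (and `0` if there are less than `L` of these). For `Sum.inr b` with `b ≠ 0` it
is, at time `1`, the mean of the jump from a neighbouring band to band `b` in a direction `d` with
`b d ≠ 0`. -/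
noncomputable def testWeight {n : ℕ} (L : ℕ) (c : ℕ → ℝ) (NB : Fin n → ℕ) :
    (ℕ × (Fin n → ℤ)) ⊕ (Fin n → ℤ) → Fin (n + 1) → ℤ → ℝ
  | Sum.inl (k, b) =>
    if L ≤ k then Fin.cons (predWeight L c k) fun d => avgWeight (NB d) (b d) else 0
  | Sum.inr b => if h : ∃ d, b d ≠ 0 then
      Fin.cons (fun j => if j = 1 then 1 else 0) (Function.update (fun d => avgWeight (NB d) (b d))
        h.choose (predWeight 1 (fun _ => 1) (b h.choose * NB h.choose - 1))) else 0

/-- The statistics within the block: a prediction for each time and band, a jump for each band. -/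
noncomputable def tests {n : ℕ} (K₁ : ℕ) (Bmax : Fin n → ℕ) :
    Finset ((ℕ × (Fin n → ℤ)) ⊕ (Fin n → ℤ)) :=
  (Finset.range K₁ ×ˢ bands Bmax).disjSum (bands Bmax)

end ModHyst

/-! ### Linear statistics and the reconstruction map -/

namespace ModHyst

section decoder

variable {n : ℕ} {L : ℕ} {c : ℕ → ℝ} {NB : Fin n → ℕ} {K : Fin (n + 1) → ℕ} {Bmax : Fin n → ℕ}

/-- The value of the linear statistic `t` at the samples `y`. -/
noncomputable def testStat (L : ℕ) (c : ℕ → ℝ) (NB : Fin n → ℕ) (K : Fin (n + 1) → ℕ)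
    (t : (ℕ × (Fin n → ℤ)) ⊕ (Fin n → ℤ)) (y : block K → ℝ) : ℝ :=
  ∑ k : block K, (∏ d, testWeight L c NB t d (k.1 d)) * y k

theorem testStat_eq_sum (t : (ℕ × (Fin n → ℤ)) ⊕ (Fin n → ℤ)) (G : (Fin (n + 1) → ℤ) → ℝ) :
    testStat L c NB K t (fun k => G k.1) =
      ∑ k ∈ Fintype.piFinset fun d =>
          if d = 0 then Finset.Icc 1 (K d : ℤ) else Finset.Ico 0 (K d : ℤ),
        (∏ d, testWeight L c NB t d (k d)) * G k :=
  Finset.sum_coe_sort (block K) fun k => (∏ d, testWeight L c NB t d (k d)) * G k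

theorem mem_bands {b : Fin n → ℤ} : b ∈ bands Bmax ↔ ∀ d, 0 ≤ b d ∧ b d < Bmax d := by
  simp [bands]

theorem Ico_subset_of_mem_bands (hBmax : ∀ d : Fin n, K d.succ = Bmax d * NB d) {b : Fin n → ℤ}
    (hb : b ∈ bands Bmax) (d : Fin n) :
    Finset.Ico (b d * NB d : ℤ) ((b d + 1) * NB d) ⊆ Finset.Ico 0 (K d.succ : ℤ) := by
  obtain ⟨h0, h1⟩ := mem_bands.1 hb d
  refine Finset.Ico_subset_Ico (by positivity) ?_
  rw [hBmax]
  push_cast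
  exact mul_le_mul_of_nonneg_right (by omega) (by positivity)

theorem sum_avgWeight (hNB : ∀ d, 0 < NB d) (hBmax : ∀ d : Fin n, K d.succ = Bmax d * NB d)
    {b : Fin n → ℤ} (hb : b ∈ bands Bmax) (d : Fin n) :
    ∑ j ∈ Finset.Ico 0 (K d.succ : ℤ), avgWeight (NB d) (b d) j = 1 := by
  have := sum_avgWeight_comp (Ico_subset_of_mem_bands hBmax hb d) id rfl
  have hpos : (NB d : ℝ) ≠ 0 := by exact_mod_cast (hNB d).ne'
  simpa [hpos] using this

theorem sum_abs_avgWeight (hNB : ∀ d, 0 < NB d) (hBmax : ∀ d : Fin n, K d.succ = Bmax d * NB d)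
    {b : Fin n → ℤ} (hb : b ∈ bands Bmax) (d : Fin n) :
    ∑ j ∈ Finset.Ico 0 (K d.succ : ℤ), |avgWeight (NB d) (b d) j| = 1 := by
  have := sum_avgWeight_comp (Ico_subset_of_mem_bands hBmax hb d) abs abs_zero
  have hpos : (NB d : ℝ) ≠ 0 := by exact_mod_cast (hNB d).ne'
  rw [this]
  simp [hpos]

theorem sum_avgWeight_sq (hNB : ∀ d, 0 < NB d) (hBmax : ∀ d : Fin n, K d.succ = Bmax d * NB d)
    {b : Fin n → ℤ} (hb : b ∈ bands Bmax) (d : Fin n) :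
    ∑ j ∈ Finset.Ico 0 (K d.succ : ℤ), avgWeight (NB d) (b d) j ^ 2 = (NB d : ℝ)⁻¹ := by
  have := sum_avgWeight_comp (Ico_subset_of_mem_bands hBmax hb d) (fun x => x ^ 2) (by simp)
  have hpos : (NB d : ℝ) ≠ 0 := by exact_mod_cast (hNB d).ne'
  rw [this]
  field_simp

theorem testWeight_inl {k : ℕ} (hk : L ≤ k) (b : Fin n → ℤ) :
    testWeight L c NB (Sum.inl (k, b)) =
      Fin.cons (predWeight L c k) fun d => avgWeight (NB d) (b d) := by
  simp [testWeight, hk]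

/-- The direction of the jump measured by the test of a band `b ≠ 0`. -/
theorem exists_testWeight_inr {b : Fin n → ℤ} (hb : b ≠ 0) :
    ∃ d, b d ≠ 0 ∧ ∀ (L : ℕ) (c : ℕ → ℝ) (NB : Fin n → ℕ), testWeight L c NB (Sum.inr b) =
      Fin.cons (fun j => if j = 1 then 1 else 0) (Function.update (fun d => avgWeight (NB d) (b d))
        d (predWeight 1 (fun _ => 1) (b d * NB d - 1))) := by
  have h : ∃ d, b d ≠ 0 := Function.ne_iff.1 hb
  exact ⟨h.choose, h.choose_spec, fun L c NB => by simp only [testWeight, dif_pos h]⟩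

theorem predWeight_mem_inl {k : ℕ} (hk : L ≤ k) (hkK : k < K 0) :
    (k : ℤ) + 1 ∈ Finset.Icc 1 (K 0 : ℤ) ∧ ∀ i < L, (k : ℤ) - (i : ℤ) ∈ Finset.Icc 1 (K 0 : ℤ) := by
  simp only [Finset.mem_Icc]
  exact ⟨by omega, fun i hi => by omega⟩

theorem predWeight_mem_inr (hNB : ∀ d, 0 < NB d) (hBmax : ∀ d : Fin n, K d.succ = Bmax d * NB d)
    {b : Fin n → ℤ} (hb : b ∈ bands Bmax) {d : Fin n} (hd : b d ≠ 0) :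
    (b d * NB d - 1 : ℤ) + 1 ∈ Finset.Ico 0 (K d.succ : ℤ) ∧
      ∀ i < 1, (b d * NB d - 1 : ℤ) - (i : ℕ) ∈ Finset.Ico 0 (K d.succ : ℤ) := by
  obtain ⟨h0, h1⟩ := mem_bands.1 hb d
  have h2 : (0 : ℤ) < NB d := by exact_mod_cast hNB d
  have h3 : (NB d : ℤ) ≤ b d * NB d := le_mul_of_one_le_left h2.le (by omega)
  have h4 : b d * (NB d : ℤ) < Bmax d * NB d := mul_lt_mul_of_pos_right h1 h2
  rw [hBmax]
  push_cast
  simp only [Finset.mem_Ico]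
  exact ⟨by omega, fun i hi => by omega⟩

/-- The statistics at samples that depend on the time and the band only. -/
theorem testStat_inl_pattern (hNB : ∀ d, 0 < NB d) (hBmax : ∀ d : Fin n, K d.succ = Bmax d * NB d)
    {b : Fin n → ℤ} (hb : b ∈ bands Bmax) {k : ℕ} (hk : L ≤ k) (hkK : k < K 0)
    (G : ℤ → (Fin n → ℤ) → ℝ) :
    testStat L c NB K (Sum.inl (k, b)) (fun k => G (k.1 0) fun d => k.1 d.succ / (NB d : ℤ)) =
      G (k + 1) b - ∑ i ∈ Finset.range L, c i * G (k - i) b := by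
  rw [testStat_eq_sum (G := fun k => G (k 0) fun d => k d.succ / (NB d : ℤ)), testWeight_inl hk]
  obtain ⟨h1, h2⟩ := predWeight_mem_inl hk hkK
  refine sum_piFinset_prod_mul_eq _ _ _ 0 (fun k' hk' => ?_) fun d hd => ?_
  · have hband : (fun d => k' d.succ / (NB d : ℤ)) = b := by
      ext d
      exact ediv_eq_of_avgWeight_ne_zero (by simpa using hk' d.succ (Fin.succ_ne_zero d))
    simp only [if_pos, Fin.cons_zero, Function.update_self,
      Function.update_of_ne (Fin.succ_ne_zero _), hband]
    exact sum_predWeight_mul h1 h2 fun j => G j b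
  · obtain ⟨d, rfl⟩ := Fin.exists_succ_eq.2 hd
    simpa using sum_avgWeight hNB hBmax hb d

/-- The jump statistic of a band `b ≠ 0` at samples that depend on the time and the band only. -/
theorem testStat_inr_pattern (hNB : ∀ d, 0 < NB d) (hK : 1 ≤ K 0)
    (hBmax : ∀ d : Fin n, K d.succ = Bmax d * NB d) {b : Fin n → ℤ} (hb : b ∈ bands Bmax)
    (hb0 : b ≠ 0) : ∃ d, b d ≠ 0 ∧ ∀ G : ℤ → (Fin n → ℤ) → ℝ,
      testStat L c NB K (Sum.inr b) (fun k => G (k.1 0) fun d => k.1 d.succ / (NB d : ℤ)) =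
        G 1 b - G 1 (Function.update b d (b d - 1)) := by
  obtain ⟨d, hd, hw⟩ := exists_testWeight_inr hb0
  refine ⟨d, hd, fun G => ?_⟩
  rw [testStat_eq_sum (G := fun k => G (k 0) fun d => k d.succ / (NB d : ℤ)), hw]
  obtain ⟨h1, h2⟩ := predWeight_mem_inr hNB hBmax hb hd
  have hm : (0 : ℤ) < NB d := by exact_mod_cast hNB d
  refine sum_piFinset_prod_mul_eq _ _ _ d.succ (fun k' hk' => ?_) fun d' hd' => ?_
  · have hk0 : k' 0 = 1 := by
      have := hk' 0 (Fin.succ_ne_zero d).symm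
      by_contra h
      simp [h] at this
    have hband : ∀ j, (fun d' => Function.update k' d.succ j d'.succ / (NB d' : ℤ)) =
        Function.update b d (j / NB d) := by
      intro j
      ext d'
      by_cases h : d' = d
      · subst h; simp
      · rw [Function.update_of_ne (by simpa using h), Function.update_of_ne h]
        have := hk' d'.succ (by simpa using h)
        rw [Fin.cons_succ, Function.update_of_ne h] at this
        exact ediv_eq_of_avgWeight_ne_zero this
    simp only [hband, Fin.cons_succ, Function.update_self, if_neg (Fin.succ_ne_zero d),
      Function.update_of_ne (Fin.succ_ne_zero d).symm, hk0]
    rw [sum_predWeight_mul h1 h2 fun j => G 1 (Function.update b d (j / NB d))]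
    have e2 : (b d * (NB d : ℤ) - 1) / (NB d : ℤ) = b d - 1 := by
      rw [Int.ediv_eq_iff_of_pos hm]
      constructor <;> nlinarith
    simp [e2, Int.mul_ediv_cancel _ hm.ne']
  · refine Fin.cases (fun _ => ?_) (fun d' hd' => ?_) d' hd'
    · simp [hK]
    · have h : d' ≠ d := fun h => hd' (by rw [h])
      simp only [Fin.cons_succ, Function.update_of_ne h, if_neg (Fin.succ_ne_zero d')]
      exact sum_avgWeight hNB hBmax hb d'

/-- The fold counts `e` relative to band `0` that are to be found: they depend on the time and the
band only, are constant in the first `L` samples of each band, and vanish at the start of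
band `0`. -/
def IsFoldPattern (L : ℕ) (NB : Fin n → ℕ) (K : Fin (n + 1) → ℕ) (e : block K → ℤ) : Prop :=
  ∃ Δ : ℤ → (Fin n → ℤ) → ℤ, (∀ k : block K, e k = Δ (k.1 0) fun d => k.1 d.succ / (NB d : ℤ)) ∧
    (∀ j : ℤ, j ≤ L → ∀ b, Δ j b = Δ 1 b) ∧ Δ 1 0 = 0

/-- The pattern `e` explains the folded samples `y`: after unfolding, all statistics are below
`h / 2`. -/
def Explains (L : ℕ) (c : ℕ → ℝ) (NB : Fin n → ℕ) (K : Fin (n + 1) → ℕ) (Bmax : Fin n → ℕ) (h : ℝ)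
    (y : block K → ℝ) (e : block K → ℤ) : Prop :=
  IsFoldPattern L NB K e ∧
    ∀ t ∈ tests (K 0) Bmax, |testStat L c NB K t (fun k => y k + h * e k)| < h / 2

theorem testStat_sub (t : (ℕ × (Fin n → ℤ)) ⊕ (Fin n → ℤ)) (y y' : block K → ℝ) :
    testStat L c NB K t (fun k => y k - y' k) = testStat L c NB K t y - testStat L c NB K t y' := by
  simp [testStat, mul_sub, Finset.sum_sub_distrib]

/-- At most one pattern explains given samples: two of them agree at the start of each band, by
induction along the neighbouring bands, and then at all times by induction on the time. -/
theorem Explains.unique (hNB : ∀ d, 0 < NB d) (hK : 1 ≤ K 0)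
    (hBmax : ∀ d : Fin n, K d.succ = Bmax d * NB d) {h : ℝ} (hh : 0 < h) {y : block K → ℝ}
    {e e' : block K → ℤ} (he : Explains L c NB K Bmax h y e) (he' : Explains L c NB K Bmax h y e') :
    e = e' := by
  obtain ⟨⟨Δ, hΔ, hΔL, hΔ0⟩, ht⟩ := he
  obtain ⟨⟨Δ', hΔ', hΔL', hΔ0'⟩, ht'⟩ := he'
  -- the statistics of `δ` are integers, and of absolute value below `1`
  set δ : ℤ → (Fin n → ℤ) → ℤ := fun j b => Δ j b - Δ' j b with hδ
  have hstat : ∀ t ∈ tests (K 0) Bmax, |testStat L c NB K t (fun k =>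
      (fun j b => (δ j b : ℝ)) (k.1 0) fun d => k.1 d.succ / (NB d : ℤ))| < 1 := by
    intro t htm
    have h1 := ht t htm
    have h2 := ht' t htm
    have h3 : testStat L c NB K t (fun k => y k + h * e k) -
        testStat L c NB K t (fun k => y k + h * e' k) =
        h * testStat L c NB K t (fun k =>
          (fun j b => (δ j b : ℝ)) (k.1 0) fun d => k.1 d.succ / (NB d : ℤ)) := by
      rw [← testStat_sub]
      simp only [testStat, Finset.mul_sum, hδ, hΔ, hΔ']
      refine Finset.sum_congr rfl fun k _ => ?_
      push_cast
      ring
    have h4 : |h * testStat L c NB K t (fun k =>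
          (fun j b => (δ j b : ℝ)) (k.1 0) fun d => k.1 d.succ / (NB d : ℤ))| < h := by
      rw [← h3]
      refine (abs_sub _ _).trans_lt ?_
      linarith
    rw [abs_mul, abs_of_pos hh] at h4
    nlinarith
  have hint : ∀ z : ℤ, |(z : ℝ)| < 1 → z = 0 := fun z hz => by
    rw [← Int.cast_abs] at hz
    exact Int.abs_lt_one_iff.1 (by exact_mod_cast hz)
  have hstart : ∀ (s : ℕ) (b : Fin n → ℤ), b ∈ bands Bmax → ∑ d, b d = s → δ 1 b = 0 := by
    intro s
    induction s with
    | zero =>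
      intro b hb hs
      have : b = 0 := by
        ext d
        exact (Finset.sum_eq_zero_iff_of_nonneg fun d _ => (mem_bands.1 hb d).1).1
          (by exact_mod_cast hs) d (Finset.mem_univ d)
      simp [hδ, this, hΔ0, hΔ0']
    | succ s ih =>
      intro b hb hs
      have hb0 : b ≠ 0 := by
        rintro rfl
        simp at hs
        omega
      obtain ⟨d, hd, hev⟩ := testStat_inr_pattern (L := L) (c := c) hNB hK hBmax hb hb0
      have h1 := hstat (Sum.inr b) (by simpa [tests] using hb)
      rw [hev (fun j b => (δ j b : ℝ))] at h1
      have hprev : δ 1 (Function.update b d (b d - 1)) = 0 := by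
        refine ih _ (mem_bands.2 fun d' => ?_) ?_
        · have h2 := mem_bands.1 hb d'
          by_cases hdd : d' = d
          · subst hdd; rw [Function.update_self]; omega
          · rw [Function.update_of_ne hdd]; exact h2
        · rw [Finset.sum_update_of_mem (Finset.mem_univ d)]
          rw [← Finset.add_sum_erase _ _ (Finset.mem_univ d)] at hs
          rw [Finset.sdiff_singleton_eq_erase]
          push_cast at hs
          linarith
      rw [hprev, Int.cast_zero, sub_zero] at h1
      exact hint _ h1
  have hall : ∀ (j : ℕ) (b : Fin n → ℤ), b ∈ bands Bmax → 1 ≤ j → j ≤ K 0 → δ j b = 0 := by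
    intro j b hb
    induction j using Nat.strong_induction_on with
    | _ j ih =>
      intro hj1 hjK
      have hs : δ 1 b = 0 :=
        hstart (∑ d, b d).toNat b hb
          (Int.toNat_of_nonneg (Finset.sum_nonneg fun d _ => (mem_bands.1 hb d).1)).symm
      rcases le_or_gt j L with hjL | hjL
      · have h1 := hΔL j (by exact_mod_cast hjL) b
        have h2 := hΔL' j (by exact_mod_cast hjL) b
        simp only [hδ] at hs ⊢
        rw [h1, h2, hs]
      · obtain ⟨k, rfl⟩ : ∃ k, j = k + 1 := ⟨j - 1, by omega⟩
        have h1 := hstat (Sum.inl (k, b)) (by simpa [tests] using ⟨by omega, hb⟩)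
        rw [testStat_inl_pattern hNB hBmax hb (by omega) (by omega)
          (fun j b => (δ j b : ℝ)), Finset.sum_eq_zero fun i hi => ?_, sub_zero] at h1
        · exact hint _ (by exact_mod_cast h1)
        · have hi := Finset.mem_range.1 hi
          have := ih (k - i) (by omega) (by omega) (by omega)
          rw [Nat.cast_sub (by omega)] at this
          rw [this]; simp
  ext k
  have hk := Fintype.mem_piFinset.1 k.2
  have hk0 := hk 0
  simp only [if_pos, Finset.mem_Icc] at hk0
  have hb : (fun d => k.1 d.succ / (NB d : ℤ)) ∈ bands Bmax := by
    refine mem_bands.2 fun d => ?_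
    have := hk d.succ
    rw [if_neg (Fin.succ_ne_zero d), Finset.mem_Ico, hBmax] at this
    have hm : (0 : ℤ) < NB d := by exact_mod_cast hNB d
    exact ⟨Int.ediv_nonneg this.1 hm.le, Int.ediv_lt_of_lt_mul hm (by exact_mod_cast this.2)⟩
  have := hall (k.1 0).toNat _ hb (by omega) (by omega)
  rw [Int.toNat_of_nonneg (by omega)] at this
  rw [hΔ, hΔ']
  simp only [hδ] at this
  omega

/-- The reconstruction map: unfold by the pattern that explains the samples. -/
theorem exists_reconstruction (hNB : ∀ d, 0 < NB d) (hK : 1 ≤ K 0)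
    (hBmax : ∀ d : Fin n, K d.succ = Bmax d * NB d) {h : ℝ} (hh : 0 < h) :
    ∃ R : (block K → ℝ) → (block K → ℝ), Measurable R ∧
      ∀ y e, Explains L c NB K Bmax h y e → R y = fun k => y k + h * e k := by
  classical
  set dec : (block K → ℝ) → (block K → ℤ) := fun y =>
    if hy : ∃ e, Explains L c NB K Bmax h y e then hy.choose else 0 with hdec
  have hdec_eq : ∀ y e, Explains L c NB K Bmax h y e → dec y = e := fun y e he => by
    have hy : ∃ e, Explains L c NB K Bmax h y e := ⟨e, he⟩
    simp only [hdec, dif_pos hy]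
    exact hy.choose_spec.unique hNB hK hBmax hh he
  have hmeas : ∀ e, MeasurableSet {y | Explains L c NB K Bmax h y e} := fun e => by
    simp only [Explains, testStat]
    refine MeasurableSet.inter (MeasurableSet.const _) ?_
    have : {y : block K → ℝ | ∀ t ∈ tests (K 0) Bmax,
        |∑ k : block K, (∏ d, testWeight L c NB t d (k.1 d)) * (y k + h * e k)| < h / 2} =
        ⋂ t ∈ tests (K 0) Bmax, {y : block K → ℝ |
          |∑ k : block K, (∏ d, testWeight L c NB t d (k.1 d)) * (y k + h * e k)| < h / 2} := by
      ext y; simp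
    change MeasurableSet {y : block K → ℝ | ∀ t ∈ tests (K 0) Bmax, _}
    rw [this]
    exact Finset.measurableSet_biInter _ fun t _ =>
      measurableSet_lt (by fun_prop) measurable_const
  have hdm : Measurable dec := by
    refine measurable_to_countable' fun e => ?_
    by_cases he : e = 0
    · have : dec ⁻¹' {e} = {y | Explains L c NB K Bmax h y e} ∪
          (⋃ e', {y | Explains L c NB K Bmax h y e'})ᶜ := by
        ext y
        simp only [Set.mem_preimage, Set.mem_singleton_iff, Set.mem_union, Set.mem_compl_iff,
          Set.mem_iUnion, Set.mem_ofPred_eq]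
        by_cases hy : ∃ e, Explains L c NB K Bmax h y e
        · obtain ⟨e', he'⟩ := hy
          rw [hdec_eq y e' he']
          constructor
          · rintro rfl; exact Or.inl he'
          · rintro (h1 | h1)
            · exact he'.unique hNB hK hBmax hh h1
            · exact absurd ⟨e', he'⟩ h1
        · simp [hdec, hy, he]
      rw [this]
      exact (hmeas e).union (MeasurableSet.iUnion hmeas).compl
    · have : dec ⁻¹' {e} = {y | Explains L c NB K Bmax h y e} := by
        ext y
        simp only [Set.mem_preimage, Set.mem_singleton_iff, Set.mem_ofPred_eq]
        refine ⟨?_, hdec_eq y e⟩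
        rintro rfl
        by_cases hy : ∃ e, Explains L c NB K Bmax h y e
        · simp only [hdec, dif_pos hy]; exact hy.choose_spec
        · exact absurd (by simp [hdec, hy]) he
      rw [this]
      exact hmeas e
  refine ⟨fun y k => y k + h * dec y k, ?_, fun y e he => by
    ext k
    simp only [hdec_eq y e he]⟩
  refine measurable_pi_iff.2 fun k => (measurable_pi_apply k).add (Measurable.const_mul ?_ h)
  exact (measurable_of_countable (fun e : block K → ℤ => (e k : ℝ))).comp hdm

end decoder

end ModHyst

/-! ### Noise margins, biases and variances of the statistics -/

/-- Lower bound for the joint probability of finitely many linear events in i.i.d. Gaussian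
variables of standard deviation `sig`. -/
theorem prod_one_sub_exp_le_measureReal {ι J S : Type*} [Fintype ι] [MeasurableSpace S]
    (P : Measure S) [IsProbabilityMeasure P] {eta : ι → S → ℝ} {sig : ℝ} (hsig : 0 < sig)
    (hind : iIndepFun eta P)
    (hlaw : ∀ k, HasLaw (eta k) (gaussianReal 0 (Real.toNNReal (sig ^ 2))) P)
    (s : Finset J) (w : J → ι → ℝ) (r v : J → ℝ) (hr : ∀ j ∈ s, 0 < r j)
    (hv : ∀ j ∈ s, ∑ i, w j i ^ 2 ≤ v j) (hv0 : ∀ j ∈ s, 0 < v j) :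
    ∏ j ∈ s, (if w j = 0 then 1 else 1 - Real.exp (-(r j ^ 2 / (2 * (sig ^ 2 * v j))))) ≤
      P.real {ω | ∀ j ∈ s, |∑ i, w j i * eta i ω| < r j} := by
  have hlaw' : ∀ k, HasLaw (fun ω => eta k ω / sig) (gaussianReal 0 1) P := fun k => by
    have := gaussianReal_div_const (hlaw k) sig
    convert! this using 2
    · simp
    · ext
      rw [NNReal.coe_div, Real.coe_toNNReal _ (sq_nonneg sig)]
      simp [hsig.ne']
  have hind' : iIndepFun (fun k ω => eta k ω / sig) P :=
    hind.comp (fun _ x => x / sig) fun _ => by fun_prop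
  have hmap : P.map (fun ω k => eta k ω / sig) = Measure.pi fun _ : ι => gaussianReal 0 1 := by
    rw [(iIndepFun_iff_map_fun_eq_pi_map fun k => (hlaw' k).aemeasurable).1 hind']
    congr 1; ext1 k
    exact (hlaw' k).map_eq
  have hmain := prod_one_sub_exp_le_pi_gaussian s (fun j i => sig * w j i) r
    (fun j => sig ^ 2 * v j) hr (fun j hj => by
      simp_rw [mul_pow]
      rw [← Finset.mul_sum]
      exact mul_le_mul_of_nonneg_left (hv j hj) (sq_nonneg sig))
    (fun j hj => mul_pos (by positivity) (hv0 j hj))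
  have hms : MeasurableSet {x : ι → ℝ | ∀ j ∈ s, |∑ i, sig * w j i * x i| < r j} := by
    have : {x : ι → ℝ | ∀ j ∈ s, |∑ i, sig * w j i * x i| < r j} =
        ⋂ j ∈ s, {x | |∑ i, sig * w j i * x i| < r j} := by ext x; simp
    rw [this]
    exact Finset.measurableSet_biInter s fun j _ =>
      measurableSet_lt (by fun_prop) measurable_const
  rw [← hmap, measureReal_def, Measure.map_apply_of_aemeasurable
    (aemeasurable_pi_iff.2 fun k => (hlaw' k).aemeasurable) hms, ← measureReal_def] at hmain
  have hzero : ∀ j, (fun i => sig * w j i) = 0 ↔ w j = 0 := fun j => by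
    simp [funext_iff, hsig.ne']
  simp only [hzero] at hmain
  convert hmain using 2
  ext ω
  have : ∀ j, ∑ i, sig * w j i * (eta i ω / sig) = ∑ i, w j i * eta i ω := fun j =>
    Finset.sum_congr rfl fun i _ => by field_simp
  simp only [Set.mem_preimage, Set.mem_ofPred_eq, this]

/-- For every order `N` there is a linear predictor, using at most `N + 1` samples, whose
error-to-noise ratio is as good as the claimed probability requires. For `N ≠ 2` the last sample
will do: the first differences are at most `a F`, which is below `a e F` if `N = 1`, and
at most `h / 4`, by `(N + 1) a F < h`, if `N ≥ 3`. For `N = 2` the least squares line through the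
last three samples is extrapolated; its error is bounded through the second differences. -/
theorem exists_predictor {N : ℕ} (hN : 1 ≤ N) :
    ∃ (L : ℕ) (c : ℕ → ℝ), L ≤ N + 1 ∧ ∑ i ∈ Finset.range L, c i = 1 ∧
      ∀ h a F : ℝ, 0 ≤ a → 0 ≤ F → 0 < h → (a * Real.exp 1) ^ N * F < h / 2 →
        ((N : ℝ) + 1) * (a * F) < h → ∃ r, 0 < r ∧
          (∀ G : ℤ → ℝ, (∀ k, |G (k + 1) - G k| ≤ a * F) →
            (∀ k, |G (k + 2) - 2 * G (k + 1) + G k| ≤ a ^ 2 * F) →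
            ∀ k, |G (k + 1) - ∑ i ∈ Finset.range L, c i * G (k - i)| ≤ h / 2 - r) ∧
          2 * (1 + ∑ i ∈ Finset.range L, c i ^ 2) *
            ((h / 2 - (a * Real.exp 1) ^ N * F) ^ 2 / 2 ^ (N + 1)) ≤ r ^ 2 := by
  have he : (2.7 : ℝ) < Real.exp 1 := by have := Real.exp_one_gt_d9; linarith
  by_cases h2 : N = 2
  · subst h2
    -- `∑ c i ^ 2 = 7 / 3`, so that `2 (1 + 7 / 3) / 2 ^ 3 = 5 / 6 ≤ 1`
    refine ⟨3, fun i => if i = 0 then 4 / 3 else if i = 1 then 1 / 3 else -2 / 3, le_rfl,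
      by norm_num [Finset.sum_range_succ], fun h a F ha hF hh hb _ => ?_⟩
    have haF : 0 ≤ a ^ 2 * F := by positivity
    have h1 : 5 / 3 * (a ^ 2 * F) ≤ (a * Real.exp 1) ^ 2 * F := by
      rw [mul_pow, mul_right_comm, mul_comm]
      exact mul_le_mul_of_nonneg_left (by nlinarith) haF
    refine ⟨h / 2 - 5 / 3 * (a ^ 2 * F), by linarith, fun G _ hG k => ?_, ?_⟩
    · have g1 := hG (k - 1)
      have g2 := hG (k - 2)
      rw [show k - 1 + 2 = k + 1 by ring, sub_add_cancel] at g1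
      rw [show k - 2 + 1 = k - 1 by ring, sub_add_cancel] at g2
      have e : G (k + 1) - ∑ i ∈ Finset.range 3,
          (if i = 0 then 4 / 3 else if i = 1 then 1 / 3 else -2 / 3) * G (k - (i : ℕ)) =
          (G (k + 1) - 2 * G k + G (k - 1)) + 2 / 3 * (G k - 2 * G (k - 1) + G (k - 2)) := by
        norm_num [Finset.sum_range_succ]
        ring
      rw [e, abs_le]
      obtain ⟨g1, g1'⟩ := abs_le.1 g1
      obtain ⟨g2, g2'⟩ := abs_le.1 g2
      constructor <;> linarith
    · norm_num [Finset.sum_range_succ]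
      have : (h / 2 - (a * Real.exp 1) ^ 2 * F) ^ 2 ≤ (h / 2 - 5 / 3 * (a ^ 2 * F)) ^ 2 := by
        apply pow_le_pow_left₀ <;> linarith
      nlinarith [sq_nonneg (h / 2 - (a * Real.exp 1) ^ 2 * F)]
  · refine ⟨1, fun _ => 1, by omega, by simp, fun h a F ha hF hh hb hs => ?_⟩
    have haF : 0 ≤ a * F := mul_nonneg ha hF
    have hN1 : (1 : ℝ) ≤ N := by exact_mod_cast hN
    refine ⟨h / 2 - a * F, by nlinarith, fun G hG _ k => by simpa using hG k, ?_⟩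
    have hbpos : 0 ≤ (a * Real.exp 1) ^ N * F := by positivity
    simp only [Finset.range_one, one_pow, Finset.sum_singleton]
    rcases Nat.lt_or_ge N 3 with h3 | h3
    · have : N = 1 := by omega
      subst this
      have h1 : a * F ≤ (a * Real.exp 1) ^ 1 * F := by
        rw [pow_one, mul_right_comm]
        exact le_mul_of_one_le_right haF (by linarith)
      have : (h / 2 - (a * Real.exp 1) ^ 1 * F) ^ 2 ≤ (h / 2 - a * F) ^ 2 := by
        apply pow_le_pow_left₀ <;> linarith
      linarith
    · have hN3 : (3 : ℝ) ≤ N := by exact_mod_cast h3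
      have hp : (16 : ℝ) ≤ 2 ^ (N + 1) :=
        le_trans (by norm_num) (pow_le_pow_right₀ (by norm_num) (show 4 ≤ N + 1 by omega))
      have h1 : (h / 2 - (a * Real.exp 1) ^ N * F) ^ 2 / 2 ^ (N + 1) ≤ (h / 2) ^ 2 / 16 := by
        gcongr
        linarith
      have h4 : a * F ≤ h / 4 := by nlinarith
      nlinarith

/-- The jump between neighbouring samples of two bands, measured by a first difference, has the
error-to-noise ratio that the claimed probability requires, for every order `N`. -/
theorem four_mul_sq_div_le_sq_sub {N : ℕ} (hN : 1 ≤ N) {h x y : ℝ} (hx : 0 ≤ x) (hy0 : 0 ≤ y)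
    (hy : y < h / 2) (hxy : N = 1 → x ≤ y) (hx2 : √2 * (((N : ℝ) + 1) * x) < h / 2) :
    0 < h / 2 - x ∧ 4 * ((h / 2 - y) ^ 2 / 2 ^ (N + 1)) ≤ (h / 2 - x) ^ 2 := by
  rcases hN.eq_or_lt with h1 | h1
  · have h2 := hxy h1.symm
    rw [← h1]
    refine ⟨by linarith, ?_⟩
    have : (h / 2 - y) ^ 2 ≤ (h / 2 - x) ^ 2 := by
      apply pow_le_pow_left₀ <;> linarith
    norm_num
    linarith
  · have hN2 : (2 : ℝ) ≤ N := by exact_mod_cast h1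
    have hs : (1.414 : ℝ) ≤ √2 := Real.le_sqrt_of_sq_le (by norm_num)
    have h3 : 1.414 * (3 * x) ≤ √2 * (((N : ℝ) + 1) * x) := by
      gcongr
      linarith
    have hp : (8 : ℝ) ≤ 2 ^ (N + 1) :=
      le_trans (by norm_num) (pow_le_pow_right₀ (by norm_num) (show 3 ≤ N + 1 by omega))
    have h4 : (h / 2 - y) ^ 2 / 2 ^ (N + 1) ≤ (h / 2) ^ 2 / 8 := by
      gcongr
      linarith
    have h5 : x ≤ 0.12 * h := by linarith
    refine ⟨by linarith, ?_⟩
    have h6 : (0.38 * h) ^ 2 ≤ (h / 2 - x) ^ 2 := by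
      apply pow_le_pow_left₀ <;> linarith
    nlinarith

namespace ModHyst

section statistics

variable {n : ℕ} {L : ℕ} {c : ℕ → ℝ} {NB : Fin n → ℕ} {K : Fin (n + 1) → ℕ} {Bmax : Fin n → ℕ}

/-- The prediction statistics of the input itself are bounded by the prediction error `β` on a line
parallel to the time axis. -/
theorem abs_testStat_inl_le (hNB : ∀ d, 0 < NB d) (hBmax : ∀ d : Fin n, K d.succ = Bmax d * NB d)
    {b : Fin n → ℤ} (hb : b ∈ bands Bmax) {k : ℕ} (hkK : k < K 0) {G : (Fin (n + 1) → ℤ) → ℝ}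
    {β : ℝ} (hβ : ∀ x : Fin (n + 1) → ℤ, ∀ k : ℤ, |G (Function.update x 0 (k + 1)) -
      ∑ i ∈ Finset.range L, c i * G (Function.update x 0 (k - i))| ≤ β) :
    |testStat L c NB K (Sum.inl (k, b)) (fun k => G k.1)| ≤ β := by
  by_cases hk : L ≤ k
  · rw [testStat_eq_sum, testWeight_inl hk]
    obtain ⟨h1, h2⟩ := predWeight_mem_inl hk hkK
    refine abs_sum_piFinset_prod_mul_le _ _ _ 0 (fun x => ?_) fun d hd => ?_
    · simp only [if_pos, Fin.cons_zero]
      rw [sum_predWeight_mul h1 h2 fun j => G (Function.update x 0 j)]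
      exact hβ x k
    · obtain ⟨d, rfl⟩ := Fin.exists_succ_eq.2 hd
      simpa using (sum_abs_avgWeight hNB hBmax hb d).le
  · have : testStat L c NB K (Sum.inl (k, b)) (fun k => G k.1) = 0 := by
      simp [testStat, testWeight, hk]
    rw [this, abs_zero]
    exact (abs_nonneg _).trans (hβ 0 0)

/-- The jump statistics of the input itself are bounded by its first differences `β`. -/
theorem abs_testStat_inr_le (hNB : ∀ d, 0 < NB d) (hBmax : ∀ d : Fin n, K d.succ = Bmax d * NB d)
    (hK : 1 ≤ K 0) {b : Fin n → ℤ} (hb : b ∈ bands Bmax) {G : (Fin (n + 1) → ℤ) → ℝ}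
    {β : ℝ} (hβ0 : 0 ≤ β) (hβ : ∀ x : Fin (n + 1) → ℤ, ∀ d : Fin n, ∀ j : ℤ,
      |G (Function.update x d.succ (j + 1)) - G (Function.update x d.succ j)| ≤ β) :
    |testStat L c NB K (Sum.inr b) (fun k => G k.1)| ≤ β := by
  by_cases hb0 : b = 0
  · simpa [testStat, testWeight, hb0] using hβ0
  · obtain ⟨d, hd, hw⟩ := exists_testWeight_inr hb0
    rw [testStat_eq_sum, hw]
    obtain ⟨h1, h2⟩ := predWeight_mem_inr hNB hBmax hb hd
    refine abs_sum_piFinset_prod_mul_le _ _ _ d.succ (fun x => ?_) fun d' hd' => ?_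
    · simp only [if_neg (Fin.succ_ne_zero d), Fin.cons_succ, Function.update_self]
      rw [sum_predWeight_mul h1 h2 fun j => G (Function.update x d.succ j)]
      simpa using hβ x d (b d * NB d - 1)
    · refine Fin.cases (fun _ => ?_) (fun d' hd' => ?_) d' hd'
      · simp only [if_pos, Fin.cons_zero, apply_ite abs, abs_one, abs_zero]
        simp [hK]
      · have h : d' ≠ d := fun h => hd' (by rw [h])
        simp only [Fin.cons_succ, Function.update_of_ne h, if_neg (Fin.succ_ne_zero d')]
        exact (sum_abs_avgWeight hNB hBmax hb d').le

theorem sum_testWeight_sq_eq (t : (ℕ × (Fin n → ℤ)) ⊕ (Fin n → ℤ)) :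
    ∑ k : block K, (∏ d, testWeight L c NB t d (k.1 d)) ^ 2 =
      ∏ d, ∑ j ∈ (if d = 0 then Finset.Icc 1 (K d : ℤ) else Finset.Ico 0 (K d : ℤ)),
        testWeight L c NB t d j ^ 2 :=
  (Finset.sum_coe_sort (block K) fun k => (∏ d, testWeight L c NB t d (k d)) ^ 2).trans
    (sum_piFinset_prod_sq _ _)

/-- The variance of a prediction statistic under noise of variance `1`: averaging over a band
divides the variance by the number of its samples. -/
theorem sum_testWeight_inl_sq_le (hNB : ∀ d, 0 < NB d)
    (hBmax : ∀ d : Fin n, K d.succ = Bmax d * NB d)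
    {b : Fin n → ℤ} (hb : b ∈ bands Bmax) {k : ℕ} (hkK : k < K 0) :
    ∑ x : block K, (∏ d, testWeight L c NB (Sum.inl (k, b)) d (x.1 d)) ^ 2 ≤
      (1 + ∑ i ∈ Finset.range L, c i ^ 2) * ∏ d, (NB d : ℝ)⁻¹ := by
  by_cases hk : L ≤ k
  · obtain ⟨h1, h2⟩ := predWeight_mem_inl hk hkK
    rw [sum_testWeight_sq_eq, testWeight_inl hk, Fin.prod_univ_succ]
    simp only [if_pos, Fin.cons_zero, Fin.cons_succ, if_neg (Fin.succ_ne_zero _)]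
    rw [sum_predWeight_sq h1 h2, Finset.prod_congr rfl fun d _ => sum_avgWeight_sq hNB hBmax hb d]
  · have : testWeight L c NB (Sum.inl (k, b)) = 0 := by simp [testWeight, hk]
    simp only [this, Pi.zero_apply, Finset.prod_const, Finset.card_univ, Fintype.card_fin]
    simp only [ne_eq, Nat.add_eq_zero_iff, one_ne_zero, and_false, not_false_eq_true, zero_pow,
      OfNat.ofNat_ne_zero, Finset.sum_const_zero]
    exact mul_nonneg (add_nonneg zero_le_one (Finset.sum_nonneg fun _ _ => sq_nonneg _))
      (Finset.prod_nonneg fun _ _ => by positivity)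

/-- The variance of a jump statistic under noise of variance `1`. There is no averaging in the
direction of the jump, hence the exponent `n - 1`. -/
theorem sum_testWeight_inr_sq_le (hNB : ∀ d, 0 < NB d)
    (hBmax : ∀ d : Fin n, K d.succ = Bmax d * NB d)
    (hK : 1 ≤ K 0) {b : Fin n → ℤ} (hb : b ∈ bands Bmax) {μ : ℝ} (hμ : 0 < μ)
    (hμNB : ∀ d, μ ≤ NB d) :
    ∑ x : block K, (∏ d, testWeight L c NB (Sum.inr b) d (x.1 d)) ^ 2 ≤ 2 * (μ ^ (n - 1))⁻¹ := by
  by_cases hb0 : b = 0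
  · simp only [hb0, testWeight, Pi.zero_apply, Finset.prod_const, Finset.card_univ,
      Fintype.card_fin, ne_eq, not_true_eq_false, exists_false, dite_false]
    simp only [Nat.add_eq_zero_iff, one_ne_zero, and_false, not_false_eq_true, zero_pow,
      OfNat.ofNat_ne_zero, Finset.sum_const_zero, ne_eq]
    positivity
  · obtain ⟨d, hd, hw⟩ := exists_testWeight_inr hb0
    obtain ⟨h1, h2⟩ := predWeight_mem_inr hNB hBmax hb hd
    rw [sum_testWeight_sq_eq, hw, Fin.prod_univ_succ,
      ← Finset.mul_prod_erase _ _ (Finset.mem_univ d)]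
    simp only [if_pos, Fin.cons_zero, Fin.cons_succ, if_neg (Fin.succ_ne_zero _),
      Function.update_self]
    rw [sum_predWeight_sq h1 h2]
    have e0 : ∑ j ∈ Finset.Icc 1 (K 0 : ℤ), (if j = 1 then (1 : ℝ) else 0) ^ 2 = 1 := by
      simp [hK]
    have e1 : ∏ d' ∈ Finset.univ.erase d, ∑ j ∈ Finset.Ico 0 (K d'.succ : ℤ),
        Function.update (fun d => avgWeight (NB d) (b d)) d
          (predWeight 1 (fun _ => 1) (b d * NB d - 1)) d' j ^ 2 ≤ (μ ^ (n - 1))⁻¹ := by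
      calc _ = ∏ d' ∈ Finset.univ.erase d, (NB d' : ℝ)⁻¹ := Finset.prod_congr rfl fun d' hd' => by
            rw [Function.update_of_ne (Finset.ne_of_mem_erase hd')]
            exact sum_avgWeight_sq hNB hBmax hb d'
        _ ≤ ∏ d' ∈ Finset.univ.erase d, μ⁻¹ := Finset.prod_le_prod (fun _ _ => by positivity)
            fun d' _ => inv_anti₀ hμ (hμNB d')
        _ = (μ ^ (n - 1))⁻¹ := by simp
    rw [e0, one_mul]
    norm_num
    exact e1

end statistics

section samples

variable {n : ℕ} {V : Matrix (Fin (n + 1)) (Fin (n + 1)) ℝ} {Om : Fin (n + 1) → ℝ}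
  {f : EuclideanSpace ℝ (Fin (n + 1)) → ℝ}

theorem latticePoint_update_add (T : Fin (n + 1) → ℝ) (x : Fin (n + 1) → ℤ) (d : Fin (n + 1))
    (j m : ℤ) :
    latticePoint V T (Function.update x d (j + m)) =
      point V ((fun i => T i * (Function.update x d j i : ℝ)) + (m : ℝ) • Pi.single d (T d)) := by
  rw [latticePoint]
  congr 1
  ext i
  by_cases h : i = d
  · subst h; simp; ring
  · simp [h]

theorem sum_mul_abs_single (T : Fin (n + 1) → ℝ) (d : Fin (n + 1)) (hT : 0 < T d) :
    ∑ i, Om i * |(Pi.single d (T d) : Fin (n + 1) → ℝ) i| = T d * Om d := by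
  rw [Finset.sum_eq_single d]
  · rw [Pi.single_eq_same, abs_of_pos hT, mul_comm]
  · intro i _ hi; simp [hi]
  · simp

theorem PaleyWiener.abs_sample_sub_le (hV : V.det ≠ 0) (hOm : ∀ d, 0 < Om d)
    (hf : PaleyWiener V Om f) {T : Fin (n + 1) → ℝ} (hT : ∀ d, 0 < T d) (x : Fin (n + 1) → ℤ)
    (d : Fin (n + 1)) (j : ℤ) :
    |f (latticePoint V T (Function.update x d (j + 1))) -
      f (latticePoint V T (Function.update x d j))| ≤ T d * Om d * normInf f := by
  have := hf.abs_sub_le hV hOm (fun i => T i * (Function.update x d j i : ℝ)) (Pi.single d (T d))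
  rw [sum_mul_abs_single T d (hT d)] at this
  rw [latticePoint_update_add, Int.cast_one, one_smul]
  exact this

theorem PaleyWiener.abs_sample_second_diff_le (hV : V.det ≠ 0) (hOm : ∀ d, 0 < Om d)
    (hf : PaleyWiener V Om f) {T : Fin (n + 1) → ℝ} (hT : ∀ d, 0 < T d) (x : Fin (n + 1) → ℤ)
    (d : Fin (n + 1)) (j : ℤ) :
    |f (latticePoint V T (Function.update x d (j + 2))) -
      2 * f (latticePoint V T (Function.update x d (j + 1))) +
      f (latticePoint V T (Function.update x d j))| ≤ (T d * Om d) ^ 2 * normInf f := by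
  have := hf.abs_second_diff_le hV hOm (fun i => T i * (Function.update x d j i : ℝ))
    (Pi.single d (T d))
  rw [sum_mul_abs_single T d (hT d)] at this
  rw [latticePoint_update_add, latticePoint_update_add, Int.cast_one, one_smul]
  exact_mod_cast this

end samples

end ModHyst

/-! ### The probability bound -/

namespace ModHyst

variable {n : ℕ}

section constants

variable {N : ℕ} {h sig B F : ℝ} {Om T T' : Fin (n + 1) → ℝ}

/-- The condition on the bias at the largest of the `T d * Om d`. -/
theorem iSup_bias_lt (hn : 1 ≤ n)
    (hbias : ∀ d, (T d * Om d * Real.exp 1) ^ N * F < h / 2) :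
    ((⨆ d : Fin n, T d.succ * Om d.succ) * Real.exp 1) ^ N * F < h / 2 := by
  have : Nonempty (Fin n) := ⟨⟨0, hn⟩⟩
  obtain ⟨d, hd⟩ := exists_eq_ciSup_of_finite (f := fun d : Fin n => T d.succ * Om d.succ)
  rw [← hd]
  exact hbias d.succ

theorem constC_pos (hsig : 0 < sig) (hB : 0 < B) (hT : ∀ d, 0 < T d)
    (hbias : ∀ d, (T d * Om d * Real.exp 1) ^ N * F < h / 2) : 0 < constC N h sig B F Om T := by
  refine mul_pos (div_pos (sub_pos.2 (hbias 0)) (by positivity)) (Finset.prod_pos fun d _ => ?_)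
  exact Real.sqrt_pos.2 (div_pos hB (hT _))

theorem iSup_period_pos (hn : 1 ≤ n) (hT : ∀ d, 0 < T d) : 0 < ⨆ d : Fin n, T d.succ :=
  (hT _).trans_le (le_ciSup (f := fun d : Fin n => T d.succ) (Set.finite_range _).bddAbove ⟨0, hn⟩)

theorem constKappa_pos (hn : 1 ≤ n) (hsig : 0 < sig) (hB : 0 < B) (hT : ∀ d, 0 < T d)
    (hbias : ∀ d, (T d * Om d * Real.exp 1) ^ N * F < h / 2) : 0 < constKappa N h sig B F Om T := by
  have := iSup_period_pos hn hT
  exact mul_pos (div_pos (sub_pos.2 (iSup_bias_lt hn hbias)) (by positivity))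
    (Real.sqrt_pos.2 (by positivity))

theorem div_mul_mul_sq (a b s q : ℝ) : (a / (s * q) * b) ^ 2 = a ^ 2 / q ^ 2 / s ^ 2 * b ^ 2 := by
  rw [mul_pow, div_pow, mul_pow, div_div, mul_comm (s ^ 2)]

theorem constC_sq (hB : 0 < B) (hT : ∀ d, 0 < T d) :
    constC N h sig B F Om T ^ 2 =
      (h / 2 - (T 0 * Om 0 * Real.exp 1) ^ N * F) ^ 2 / 2 ^ (N + 1) / sig ^ 2 *
        ∏ d : Fin n, B / T d.succ := by
  rw [constC, div_mul_mul_sq, Real.sq_sqrt (by positivity), ← Finset.prod_pow]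
  congr 1
  exact Finset.prod_congr rfl fun d _ => Real.sq_sqrt (div_pos hB (hT _)).le

theorem constKappa_sq (hn : 1 ≤ n) (hB : 0 < B) (hT : ∀ d, 0 < T d) :
    constKappa N h sig B F Om T ^ 2 =
      (h / 2 - ((⨆ d : Fin n, T d.succ * Om d.succ) * Real.exp 1) ^ N * F) ^ 2 / 2 ^ (N + 1) /
        sig ^ 2 * (B / ⨆ d : Fin n, T d.succ) ^ (n - 1) := by
  have := iSup_period_pos hn hT
  rw [constKappa, div_mul_mul_sq, Real.sq_sqrt (by positivity), Real.sq_sqrt (by positivity),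
    div_pow B]

/-- `C` grows when the sampling periods in the directions `d ≥ 2` shrink. -/
theorem constC_lt_constC (hsig : 0 < sig) (hB : 0 < B)
    (hbias : (T 0 * Om 0 * Real.exp 1) ^ N * F < h / 2) (h0 : T' 0 = T 0)
    (hle : ∀ d : Fin n, 0 < T' d.succ ∧ T' d.succ ≤ T d.succ) (hne : T' ≠ T) :
    constC N h sig B F Om T < constC N h sig B F Om T' := by
  rw [constC, constC, h0]
  refine mul_lt_mul_of_pos_left ?_ (div_pos (sub_pos.2 hbias) (by positivity))
  have hpos : ∀ d : Fin n, 0 < T d.succ := fun d => (hle d).1.trans_le (hle d).2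
  refine Finset.prod_lt_prod (fun d _ => Real.sqrt_pos.2 (div_pos hB (hpos d)))
    (fun d _ => Real.sqrt_le_sqrt (div_le_div_of_nonneg_left hB.le (hle d).1 (hle d).2)) ?_
  obtain ⟨d, hd⟩ := Function.ne_iff.1 hne
  revert hd
  refine Fin.cases (fun hd => absurd h0 hd) (fun d hd => ?_) d
  exact ⟨d, Finset.mem_univ _, Real.sqrt_lt_sqrt (div_pos hB (hpos d)).le
    (div_lt_div_of_pos_left hB (hle d).1 (lt_of_le_of_ne (hle d).2 hd))⟩

/-- `κ_min` does not shrink when the sampling periods in the directions `d ≥ 2` shrink. -/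
theorem constKappa_le_constKappa (hn : 1 ≤ n) (hsig : 0 < sig) (hB : 0 < B) (hF : 0 ≤ F)
    (hOm : ∀ d, 0 < Om d) (hbias : ∀ d, (T d * Om d * Real.exp 1) ^ N * F < h / 2)
    (hle : ∀ d : Fin n, 0 < T' d.succ ∧ T' d.succ ≤ T d.succ) :
    constKappa N h sig B F Om T ≤ constKappa N h sig B F Om T' := by
  have : Nonempty (Fin n) := ⟨⟨0, hn⟩⟩
  have h1 : (⨆ d : Fin n, T' d.succ * Om d.succ) ≤ ⨆ d : Fin n, T d.succ * Om d.succ :=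
    ciSup_mono (Set.finite_range _).bddAbove fun d =>
      mul_le_mul_of_nonneg_right (hle d).2 (hOm _).le
  have h2 : (⨆ d : Fin n, T' d.succ) ≤ ⨆ d : Fin n, T d.succ :=
    ciSup_mono (Set.finite_range _).bddAbove fun d => (hle d).2
  have h3 : 0 < ⨆ d : Fin n, T' d.succ :=
    (hle ⟨0, hn⟩).1.trans_le (le_ciSup (f := fun d : Fin n => T' d.succ)
      (Set.finite_range _).bddAbove ⟨0, hn⟩)
  have h4 : 0 ≤ ⨆ d : Fin n, T' d.succ * Om d.succ :=
    Real.iSup_nonneg fun d => (mul_pos (hle d).1 (hOm _)).le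
  have h5 := iSup_bias_lt hn hbias
  have h6 : ((⨆ d : Fin n, T' d.succ * Om d.succ) * Real.exp 1) ^ N * F ≤
      ((⨆ d : Fin n, T d.succ * Om d.succ) * Real.exp 1) ^ N * F := by gcongr
  rw [constKappa, constKappa]
  refine mul_le_mul ?_ ?_ (Real.sqrt_nonneg _) (div_nonneg (by linarith) (by positivity))
  · gcongr
  · gcongr

theorem tendsto_one_sub_exp_neg_sq {α : Type*} {l : Filter α} {u : α → ℝ} (hu : Tendsto u l atTop) :
    Tendsto (fun x => 1 - Real.exp (-(u x) ^ 2)) l (𝓝 1) := by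
  have h1 : Tendsto (fun x => -(u x) ^ 2) l atBot :=
    tendsto_neg_atTop_atBot.comp ((tendsto_pow_atTop two_ne_zero).comp hu)
  simpa using (Real.tendsto_exp_atBot.comp h1).const_sub 1

/-- In dimension `D ≥ 3` the bound tends to `1` when the sampling periods in the directions
`d ≥ 2` tend to `0`: both constants tend to infinity. -/
theorem tendsto_accBound (hn : 2 ≤ n) (hN : 1 ≤ N) (hsig : 0 < sig) (hB : 0 < B)
    (hOm : ∀ d, 0 < Om d) (hbias : (T 0 * Om 0 * Real.exp 1) ^ N * F < h / 2) (hh : 0 < h)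
    (K₁ : ℕ) (Bmax : Fin n → ℕ) :
    Tendsto (fun Tb : Fin n → ℝ => accBound K₁ Bmax N h sig B F Om (Fin.cons (T 0) Tb))
      (𝓝[{Tb | ∀ d, 0 < Tb d}] 0) (𝓝 1) := by
  set l : Filter (Fin n → ℝ) := 𝓝[{Tb | ∀ d, 0 < Tb d}] 0 with hl
  have hne : Nonempty (Fin n) := ⟨⟨0, by omega⟩⟩
  have hmem : ∀ᶠ Tb in l, ∀ d, 0 < Tb d := self_mem_nhdsWithin
  have hcoord : ∀ d, Tendsto (fun Tb : Fin n → ℝ => Tb d) l (𝓝[>] 0) := fun d =>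
    tendsto_nhdsWithin_iff.2 ⟨(tendsto_pi_nhds.1 (tendsto_id.mono_left nhdsWithin_le_nhds) d),
      hmem.mono fun Tb h => h d⟩
  have hdiv : ∀ d, Tendsto (fun Tb : Fin n → ℝ => √(B / Tb d)) l atTop := fun d => by
    simp_rw [div_eq_mul_inv]
    exact Real.tendsto_sqrt_atTop.comp
      ((tendsto_inv_nhdsGT_zero.comp (hcoord d)).const_mul_atTop hB)
  have hsup : ∀ c : Fin n → ℝ, (∀ d, 0 < c d) →
      Tendsto (fun Tb : Fin n → ℝ => ⨆ d, Tb d * c d) l (𝓝[>] 0) := fun c hc => by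
    refine tendsto_nhdsWithin_iff.2 ⟨?_, ?_⟩
    · have hle : ∀ᶠ Tb in l, ⨆ d, Tb d * c d ≤ ∑ d, Tb d * c d := hmem.mono fun Tb h =>
        ciSup_le fun d => Finset.single_le_sum (f := fun d => Tb d * c d)
          (fun i _ => (mul_pos (h i) (hc i)).le) (Finset.mem_univ d)
      have hge : ∀ᶠ Tb in l, 0 ≤ ⨆ d, Tb d * c d := hmem.mono fun Tb h =>
        Real.iSup_nonneg fun d => (mul_pos (h d) (hc d)).le
      refine tendsto_of_tendsto_of_tendsto_of_le_of_le' tendsto_const_nhds ?_ hge hle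
      have : Tendsto (fun Tb : Fin n → ℝ => ∑ d, Tb d * c d) l (𝓝 (∑ d, (0 : ℝ) * c d)) :=
        tendsto_finsetSum _ fun d _ =>
          ((hcoord d).mono_right nhdsWithin_le_nhds).mul_const (c d)
      simpa using this
    · filter_upwards [hmem] with Tb h
      exact (mul_pos (h hne.some) (hc _)).trans_le
        (le_ciSup (f := fun d => Tb d * c d) (Set.finite_range _).bddAbove hne.some)
  have hC : Tendsto (fun Tb : Fin n → ℝ => constC N h sig B F Om (Fin.cons (T 0) Tb)) l atTop := by
    simp only [constC, Fin.cons_zero, Fin.cons_succ]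
    refine Tendsto.const_mul_atTop (div_pos (sub_pos.2 hbias) (by positivity)) ?_
    have : ∀ s : Finset (Fin n), s.Nonempty →
        Tendsto (fun Tb : Fin n → ℝ => ∏ d ∈ s, √(B / Tb d)) l atTop := by
      intro s hs
      induction hs using Finset.Nonempty.cons_induction with
      | singleton a => simpa using hdiv a
      | cons a s ha hs ih =>
        simp only [Finset.prod_cons]
        exact (hdiv a).atTop_mul_atTop₀ ih
    exact this _ Finset.univ_nonempty
  have hK : Tendsto (fun Tb : Fin n → ℝ => constKappa N h sig B F Om (Fin.cons (T 0) Tb))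
      l atTop := by
    simp only [constKappa, Fin.cons_succ]
    refine Tendsto.pos_mul_atTop (C := h / 2 / (sig * √(2 ^ (N + 1)))) (by positivity) ?_ ?_
    · refine Tendsto.div_const ?_ _
      have h0 : Tendsto (fun Tb : Fin n → ℝ =>
          h / 2 - ((⨆ d : Fin n, Tb d * Om d.succ) * Real.exp 1) ^ N * F) l
          (𝓝 (h / 2 - (0 * Real.exp 1) ^ N * F)) := by
        exact ((((((hsup (fun d => Om d.succ) fun d => hOm _).mono_right
          nhdsWithin_le_nhds).mul_const (Real.exp 1)).pow N).mul_const F).const_sub (h / 2))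
      simpa [show N ≠ 0 by omega] using h0
    · refine Real.tendsto_sqrt_atTop.comp ?_
      have h1 := hsup 1 fun _ => one_pos
      simp only [Pi.one_apply, mul_one] at h1
      simp_rw [← div_pow, div_eq_mul_inv]
      exact (tendsto_pow_atTop (by omega)).comp
        ((tendsto_inv_nhdsGT_zero.comp h1).const_mul_atTop hB)
  have := ((tendsto_one_sub_exp_neg_sq hC).pow (K₁ * ∏ d, Bmax d)).mul
    ((tendsto_one_sub_exp_neg_sq hK).pow (∏ d, Bmax d))
  simpa [accBound] using this

end constants

/-- If the noise is below the given thresholds in all statistics, the reconstruction succeeds: the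
true fold pattern explains the samples. -/
theorem PaleyWiener.explains {L : ℕ} {c : ℕ → ℝ} {NB : Fin n → ℕ} {K : Fin (n + 1) → ℕ}
    {Bmax : Fin n → ℕ} (hNB : ∀ d, 0 < NB d) (hK : 1 ≤ K 0)
    (hBmax : ∀ d : Fin n, K d.succ = Bmax d * NB d)
    {G : (Fin (n + 1) → ℤ) → ℝ} {E : ℤ → (Fin n → ℤ) → ℤ} {h : ℝ} {M : (Fin n → ℤ) → ℤ}
    {rt rb : ℝ} {y eta : block K → ℝ}
    (hE : ∀ j : ℤ, j ≤ L → ∀ b, E j b = M b) (hE1 : ∀ b, E 1 b = M b)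
    (hc : ∑ i ∈ Finset.range L, c i = 1)
    (hy : ∀ k : block K, y k =
      G k.1 - h * (E (k.1 0) fun d => k.1 d.succ / (NB d : ℤ) : ℤ) + eta k)
    (htime : ∀ x : Fin (n + 1) → ℤ, ∀ k : ℤ, |G (Function.update x 0 (k + 1)) -
      ∑ i ∈ Finset.range L, c i * G (Function.update x 0 (k - i))| ≤ h / 2 - rt)
    (hband : ∀ x : Fin (n + 1) → ℤ, ∀ d : Fin n, ∀ j : ℤ,
      |G (Function.update x d.succ (j + 1)) - G (Function.update x d.succ j)| ≤ h / 2 - rb)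
    (hrb : rb ≤ h / 2)
    (hnoise : ∀ t ∈ tests (K 0) Bmax, |testStat L c NB K t eta| <
      Sum.elim (fun _ => rt) (fun _ => rb) t) :
    Explains L c NB K Bmax h y fun k =>
      E (k.1 0) (fun d => k.1 d.succ / (NB d : ℤ)) - M 0 := by
  refine ⟨⟨fun j b => E j b - M 0, fun k => rfl, fun j hj b => ?_, ?_⟩, fun t ht => ?_⟩
  · simp only [hE j hj, hE1]
  · simp [hE1]
  · set G' : (Fin (n + 1) → ℤ) → ℝ := fun k => G k - h * M 0 with hG'
    have hsplit : (fun k => y k +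
        h * ((E (k.1 0) (fun d => k.1 d.succ / (NB d : ℤ)) - M 0 : ℤ) : ℝ)) =
        fun k : block K => G' k.1 - (-eta k) := by
      ext k
      rw [hy k, hG']
      push_cast
      ring
    have hneg : testStat L c NB K t (fun k => -eta k) = -testStat L c NB K t eta := by
      simp [testStat]
    rw [hsplit, testStat_sub (y := fun k => G' k.1), hneg, sub_neg_eq_add]
    refine (abs_add_le _ _).trans_lt ?_
    have hn := hnoise t ht
    rcases t with ⟨k, b⟩ | b
    · simp only [tests, Finset.inl_mem_disjSum, Finset.mem_product, Finset.mem_range] at ht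
      have := abs_testStat_inl_le (L := L) (c := c) hNB hBmax ht.2 ht.1 (G := G') (β := h / 2 - rt)
        fun x k => by
          have e : G' (Function.update x 0 (k + 1)) -
              ∑ i ∈ Finset.range L, c i * G' (Function.update x 0 (k - i)) =
              G (Function.update x 0 (k + 1)) -
              ∑ i ∈ Finset.range L, c i * G (Function.update x 0 (k - i)) := by
            simp only [hG', mul_sub, Finset.sum_sub_distrib, ← Finset.sum_mul, hc]
            ring
          rw [e]
          exact htime x k
      simp only [Sum.elim_inl] at hn
      linarith
    · simp only [tests, Finset.inr_mem_disjSum] at ht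
      have := abs_testStat_inr_le (L := L) (c := c) hNB hBmax hK ht (G := G') (β := h / 2 - rb)
        (by linarith) fun x d j => by
          have e : G' (Function.update x d.succ (j + 1)) - G' (Function.update x d.succ j) =
              G (Function.update x d.succ (j + 1)) - G (Function.update x d.succ j) := by
            simp only [hG']; ring
          rw [e]
          exact hband x d j
      simp only [Sum.elim_inr] at hn
      linarith

/-- The probability of recovery: with `rt` and `rb` the noise margins of the two kinds of
statistics, the joint probability that the noise stays below them is at least the bound. -/
theorem accBound_lt_measureReal {N : ℕ} {h sig B F : ℝ} {Om T : Fin (n + 1) → ℝ} (hn : 1 ≤ n)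
    (hsig : 0 < sig) (hB : 0 < B) (hT : ∀ d, 0 < T d) {L : ℕ} {c : ℕ → ℝ} {NB : Fin n → ℕ}
    (hNB : ∀ d, B / T d.succ = (NB d : ℝ)) {K : Fin (n + 1) → ℕ} (hK : ∀ d, 1 ≤ K d)
    {Bmax : Fin n → ℕ} (hBmax : ∀ d : Fin n, K d.succ = Bmax d * NB d)
    (hbias : ∀ d, (T d * Om d * Real.exp 1) ^ N * F < h / 2)
    {rt rb : ℝ} (hrt : 0 < rt) (hrb : 0 < rb)
    (hrt2 : 2 * (1 + ∑ i ∈ Finset.range L, c i ^ 2) *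
      ((h / 2 - (T 0 * Om 0 * Real.exp 1) ^ N * F) ^ 2 / 2 ^ (N + 1)) ≤ rt ^ 2)
    (hrb2 : 4 * ((h / 2 - ((⨆ d : Fin n, T d.succ * Om d.succ) * Real.exp 1) ^ N * F) ^ 2 /
      2 ^ (N + 1)) ≤ rb ^ 2)
    {S : Type*} [MeasurableSpace S] (P : Measure S) [IsProbabilityMeasure P]
    {eta : block K → S → ℝ} (hind : iIndepFun eta P)
    (hlaw : ∀ k, HasLaw (eta k) (gaussianReal 0 (Real.toNNReal (sig ^ 2))) P) :
    accBound (K 0) Bmax N h sig B F Om T < P.real {s | ∀ t ∈ tests (K 0) Bmax,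
      |testStat L c NB K t fun k => eta k s| < Sum.elim (fun _ => rt) (fun _ => rb) t} := by
  have hNBpos : ∀ d, 0 < NB d := fun d => by
    have : (0 : ℝ) < NB d := hNB d ▸ div_pos hB (hT _)
    exact_mod_cast this
  set Tmax := ⨆ d : Fin n, T d.succ with hTmax
  have hTmaxpos : 0 < Tmax := iSup_period_pos hn hT
  have hμ : 0 < B / Tmax := div_pos hB hTmaxpos
  have hμNB : ∀ d, B / Tmax ≤ NB d := fun d => by
    rw [← hNB d]
    exact div_le_div_of_nonneg_left hB.le (hT _)
      (le_ciSup (f := fun d : Fin n => T d.succ) (Set.finite_range _).bddAbove d)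
  have hc0 : 0 < 1 + ∑ i ∈ Finset.range L, c i ^ 2 :=
    add_pos_of_pos_of_nonneg one_pos (Finset.sum_nonneg fun _ _ => sq_nonneg _)
  have hprod : 0 < ∏ d, (NB d : ℝ)⁻¹ := Finset.prod_pos fun d _ => by
    have := hNBpos d
    positivity
  set v : (ℕ × (Fin n → ℤ)) ⊕ (Fin n → ℤ) → ℝ :=
    Sum.elim (fun _ => (1 + ∑ i ∈ Finset.range L, c i ^ 2) * ∏ d, (NB d : ℝ)⁻¹)
      (fun _ => 2 * ((B / Tmax) ^ (n - 1))⁻¹) with hv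
  set r : (ℕ × (Fin n → ℤ)) ⊕ (Fin n → ℤ) → ℝ := Sum.elim (fun _ => rt) (fun _ => rb) with hr
  set w : (ℕ × (Fin n → ℤ)) ⊕ (Fin n → ℤ) → block K → ℝ := fun t k =>
    ∏ d, testWeight L c NB t d (k.1 d) with hw
  have hgauss := prod_one_sub_exp_le_measureReal P hsig hind hlaw (tests (K 0) Bmax) w r v
    (fun t _ => by rcases t with t | t <;> assumption)
    (fun t ht => by
      rcases t with ⟨k, b⟩ | b
      · simp only [tests, Finset.inl_mem_disjSum, Finset.mem_product, Finset.mem_range] at ht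
        exact sum_testWeight_inl_sq_le hNBpos hBmax ht.2 ht.1
      · simp only [tests, Finset.inr_mem_disjSum] at ht
        exact sum_testWeight_inr_sq_le hNBpos hBmax (hK 0) ht hμ hμNB)
    (fun t _ => by
      rcases t with t | t
      · exact mul_pos hc0 hprod
      · simp only [hv, Sum.elim_inr]; positivity)
  refine lt_of_lt_of_le ?_ hgauss
  set qC := 1 - Real.exp (-(constC N h sig B F Om T) ^ 2) with hqC
  set qK := 1 - Real.exp (-(constKappa N h sig B F Om T) ^ 2) with hqK
  have hCpos : 0 < constC N h sig B F Om T := constC_pos hsig hB hT hbias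
  have hKpos : 0 < constKappa N h sig B F Om T := constKappa_pos hn hsig hB hT hbias
  have hq0 : ∀ u : ℝ, 0 < u → 0 < 1 - Real.exp (-u ^ 2) := fun u hu => by
    rw [sub_pos, Real.exp_lt_one_iff, neg_lt_zero]; positivity
  have hq1 : ∀ u : ℝ, 1 - Real.exp (-u ^ 2) < 1 := fun u => by linarith [Real.exp_pos (-u ^ 2)]
  have hacc : accBound (K 0) Bmax N h sig B F Om T =
      ∏ t ∈ tests (K 0) Bmax, Sum.elim (fun _ => qC) (fun _ => qK) t := by
    have hcard : (bands Bmax).card = ∏ d, Bmax d := by simp [bands, Fintype.card_piFinset]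
    rw [tests, Finset.prod_disjSum]
    simp only [Sum.elim_inl, Sum.elim_inr, Finset.prod_const, Finset.card_product,
      Finset.card_range, hcard]
    rfl
  rw [hacc]
  -- strictness comes from the trivial test of band `0`, which always succeeds
  refine Finset.prod_lt_prod (fun t _ => ?_) (fun t _ => ?_) ⟨Sum.inr 0, ?_, ?_⟩
  · rcases t with t | t
    · exact hq0 _ hCpos
    · exact hq0 _ hKpos
  · split_ifs with h0
    · rcases t with t | t
      · exact (hq1 _).le
      · exact (hq1 _).le
    · rcases t with t | t
      · simp only [Sum.elim_inl, hqC, hr, hv]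
        refine sub_le_sub_left (Real.exp_le_exp.2 (neg_le_neg ?_)) 1
        rw [constC_sq hB hT, Finset.prod_inv_distrib, Finset.prod_congr rfl fun d _ => hNB d]
        have : 0 < ∏ d, (NB d : ℝ) := Finset.prod_pos fun d _ => by exact_mod_cast hNBpos d
        rw [le_div_iff₀ (by positivity)]
        refine le_trans (le_of_eq ?_) hrt2
        field_simp
      · simp only [Sum.elim_inr, hqK, hr, hv]
        refine sub_le_sub_left (Real.exp_le_exp.2 (neg_le_neg ?_)) 1
        rw [constKappa_sq hn hB hT, ← hTmax, le_div_iff₀ (by positivity)]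
        refine le_trans (le_of_eq ?_) hrb2
        field_simp
        ring
  · have hB0 : ∀ d, 0 < Bmax d := fun d => by
      have := hK d.succ
      rw [hBmax] at this
      exact Nat.pos_of_mul_pos_right this
    simp only [tests, Finset.inr_mem_disjSum]
    exact mem_bands.2 fun d => ⟨le_rfl, by simpa using hB0 d⟩
  · have hw0 : w (Sum.inr 0) = 0 := by
      ext k
      simp [hw, testWeight]
    rw [if_pos hw0]
    exact hq1 _

end ModHyst

/-! ### Recovery of the samples -/

theorem theorem3
    -- dimension `D = n + 1 ≥ 2`
    (n : ℕ) (hn : 1 ≤ n)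
    -- the lattice: linearly independent unit vectors (the columns of `V`), sampling periods `T`
    (V : Matrix (Fin (n + 1)) (Fin (n + 1)) ℝ) (hV : V.det ≠ 0)
    (hVunit : ∀ d, ∑ i, V i d ^ 2 = 1)
    (T : Fin (n + 1) → ℝ) (hT : ∀ d, 0 < T d)
    -- the bandwidth
    (Om : Fin (n + 1) → ℝ) (hOm : ∀ d, 0 < Om d)
    -- the parameters of the modulo-hysteresis operator
    (lam h B : ℝ) (hh0 : 0 ≤ h) (hh : h < 2 * lam / 3) (hB : 0 < B)
    -- the number of samples along each edge of a band, and the order of the differences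
    (NB : Fin n → ℕ) (hNB : ∀ d, B / T d.succ = (NB d : ℝ)) (N : ℕ) (hN : 1 ≤ N)
    -- the size of the block, and the number of bands in it
    (K : Fin (n + 1) → ℕ) (hK : ∀ d, 1 ≤ K d)
    (Bmax : Fin n → ℕ) (hBmax : ∀ d : Fin n, K d.succ = Bmax d * NB d) :
    -- a reconstruction map, which depends on nothing but the data above
    ∃ R : (block K → ℝ) → (block K → ℝ), Measurable R ∧
      ∀ f : EuclideanSpace ℝ (Fin (n + 1)) → ℝ, PaleyWiener V Om f →
        normInf f * B * √((n : ℝ) + 1) * √(∑ d, Om d ^ 2) < min (h / 2) (2 * lam - 3 * h) →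
        (∀ d, (T d * Om d * Real.exp 1) ^ N * normInf f < h / 2) →
        ((N : ℝ) + 1) * T 0 * (Om 0 * normInf f) < h →
        (∀ d : Fin n, ((N : ℝ) + 1) * T d.succ < B) →
        ∀ sig : ℝ, 0 < sig →
          -- for i.i.d. Gaussian noise, the samples are recovered with the claimed probability
          (∀ (S : Type*) [MeasurableSpace S] (P : Measure S) [IsProbabilityMeasure P]
              (eta : block K → S → ℝ),
              iIndepFun eta P →
              (∀ k, HasLaw (eta k) (gaussianReal 0 (Real.toNNReal (sig ^ 2))) P) →
              accBound (K 0) Bmax N h sig B (normInf f) Om T <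
                P.real {s | ∀ k : block K,
                  R (fun j => modHyst lam h B V f (latticePoint V T j.1) + eta j s) k =
                    f (latticePoint V T k.1) + eta k s -
                      h * (initConst lam h B (fun u => f (point V u)) 0 : ℝ)}) ∧
          -- `C` and `κ_min` grow when the sampling periods in the dimensions `d ≥ 2` shrink
          (∀ T' : Fin (n + 1) → ℝ, T' 0 = T 0 →
              (∀ d : Fin n, 0 < T' d.succ ∧ T' d.succ ≤ T d.succ) →
              (T' ≠ T →
                constC N h sig B (normInf f) Om T < constC N h sig B (normInf f) Om T') ∧
              constKappa N h sig B (normInf f) Om T ≤ constKappa N h sig B (normInf f) Om T') ∧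
          -- if `D ≥ 3`, the bound tends to `1` when these sampling periods tend to `0`
          (2 ≤ n →
            Tendsto (fun Tb : Fin n → ℝ =>
                accBound (K 0) Bmax N h sig B (normInf f) Om (Fin.cons (T 0) Tb))
              (𝓝[{Tb | ∀ d, 0 < Tb d}] 0) (𝓝 1)) := by
  rcases hh0.eq_or_lt with h0 | hpos
  -- for `h = 0` no input satisfies the first condition
  · refine ⟨id, measurable_id, fun f _ hosc => ?_⟩
    have h1 := hosc.trans_le (min_le_left _ _)
    have h2 : 0 ≤ normInf f * B * √((n : ℝ) + 1) * √(∑ d, Om d ^ 2) :=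
      mul_nonneg (mul_nonneg (mul_nonneg (normInf_nonneg f) hB.le) (Real.sqrt_nonneg _))
        (Real.sqrt_nonneg _)
    linarith
  have hNBpos : ∀ d, 0 < NB d := fun d => by
    have : (0 : ℝ) < NB d := hNB d ▸ div_pos hB (hT _)
    exact_mod_cast this
  have hne : Nonempty (Fin n) := ⟨⟨0, hn⟩⟩
  obtain ⟨L, c, hL, hc, hpred⟩ := exists_predictor hN
  obtain ⟨R, hRm, hR⟩ := exists_reconstruction (L := L) (c := c) hNBpos (hK 0) hBmax hpos
  refine ⟨R, hRm, fun f hf hosc hbias hsep hlen sig hsig => ⟨?_, fun T' h0 hle => ⟨fun hne' =>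
    constC_lt_constC hsig hB (hbias 0) h0 hle hne', constKappa_le_constKappa hn hsig hB
      (normInf_nonneg f) hOm hbias hle⟩, fun hn2 =>
    tendsto_accBound hn2 hN hsig hB hOm (hbias 0) hpos (K 0) Bmax⟩⟩
  intro S _ P _ eta hind hlaw
  have hF := normInf_nonneg f
  obtain ⟨rt, hrt, hrt1, hrt2⟩ := hpred h (T 0 * Om 0) (normInf f) (mul_pos (hT 0) (hOm 0)).le hF
    hpos (hbias 0) (by rw [mul_assoc (T 0), ← mul_assoc]; exact hsep)
  obtain ⟨E, hE, hEinit⟩ := hf.exists_fold_counts hV hT hOm hpos hB hNB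
    (hosc.le.trans (min_le_right _ _)) hsep
  -- the largest first difference between neighbouring samples of two bands
  obtain ⟨d₀, hd₀⟩ := exists_eq_ciSup_of_finite (f := fun d : Fin n => T d.succ * Om d.succ)
  set m := ⨆ d : Fin n, T d.succ * Om d.succ with hm
  have hm0 : 0 ≤ m := hd₀ ▸ (mul_pos (hT _) (hOm _)).le
  have hjump : √2 * (((N : ℝ) + 1) * (m * normInf f)) < h / 2 := by
    refine lt_of_le_of_lt ?_ (hosc.trans_le (min_le_left _ _))
    have h1 : √2 ≤ √((n : ℝ) + 1) := by
      refine Real.sqrt_le_sqrt ?_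
      have : (1 : ℝ) ≤ n := by exact_mod_cast hn
      linarith
    have h2 : Om d₀.succ ≤ √(∑ d, Om d ^ 2) :=
      Real.le_sqrt_of_sq_le (Finset.single_le_sum (f := fun d => Om d ^ 2)
        (fun d _ => sq_nonneg _) (Finset.mem_univ _))
    have h3 : ((N : ℝ) + 1) * T d₀.succ * Om d₀.succ ≤ B * √(∑ d, Om d ^ 2) :=
      mul_le_mul (hlen d₀).le h2 (hOm _).le hB.le
    calc √2 * (((N : ℝ) + 1) * (m * normInf f))
        = √2 * (((N : ℝ) + 1) * T d₀.succ * Om d₀.succ) * normInf f := by rw [← hd₀]; ring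
      _ ≤ √((n : ℝ) + 1) * (B * √(∑ d, Om d ^ 2)) * normInf f := by
          refine mul_le_mul_of_nonneg_right (mul_le_mul h1 h3 ?_ (Real.sqrt_nonneg _)) hF
          exact mul_nonneg (mul_nonneg (by positivity) (hT _).le) (hOm _).le
      _ = _ := by ring
  obtain ⟨hrb, hrb2⟩ := four_mul_sq_div_le_sq_sub hN (mul_nonneg hm0 hF)
    (y := (m * Real.exp 1) ^ N * normInf f) (by positivity) (iSup_bias_lt hn hbias)
    (fun h1 => by
      rw [h1, pow_one, mul_right_comm]
      exact le_mul_of_one_le_right (mul_nonneg hm0 hF) (Real.one_le_exp zero_le_one)) hjump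
  refine (accBound_lt_measureReal hn hsig hB hT hNB hK hBmax hbias hrt hrb hrt2 hrb2 P hind
    hlaw).trans_le (measureReal_mono fun s hs k => ?_)
  have hexp := PaleyWiener.explains hNBpos (hK 0) hBmax (G := fun k => f (latticePoint V T k))
    (E := E) (h := h) (M := initConst lam h B fun u => f (point V u)) (rt := rt)
    (rb := h / 2 - m * normInf f) (eta := fun k => eta k s)
    (y := fun j => modHyst lam h B V f (latticePoint V T j.1) + eta j s)
    (fun j hj => hEinit j (hj.trans (by exact_mod_cast hL))) (hEinit 1 (by omega)) hc
    (fun k => by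
      have hk0 := Fintype.mem_piFinset.1 k.2 0
      simp only [if_pos, Finset.mem_Icc] at hk0
      rw [hE k.1 (by omega)])
    (fun x => hrt1 (fun j => f (latticePoint V T (Function.update x 0 j)))
      (fun j => hf.abs_sample_sub_le hV hOm hT x 0 j)
      (fun j => hf.abs_sample_second_diff_le hV hOm hT x 0 j))
    (fun x d j => by
      rw [sub_sub_cancel]
      refine (hf.abs_sample_sub_le hV hOm hT x d.succ j).trans
        (mul_le_mul_of_nonneg_right ?_ hF)
      exact le_ciSup (f := fun d : Fin n => T d.succ * Om d.succ) (Set.finite_range _).bddAbove d)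
    (by linarith [mul_nonneg hm0 hF]) hs
  have hk0 := Fintype.mem_piFinset.1 k.2 0
  simp only [if_pos, Finset.mem_Icc] at hk0
  rw [hR _ _ hexp]
  simp only [hE k.1 (by omega)]
  push_cast
  ring
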